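/- Write $\mathcal H^2$ for the Hausdorff $2$-measure and $\ell(\gamma)$ for the length of a path $\gamma\colon[0,1]\to X$. A metric space is a path-metric space if the distance of any two points is the infimum of the lengths of the paths joining them. A branched cover is a continuous, open and discrete map, its branch set $B_f$ is the set of points at which $f$ is not a local homeomorphism, and $f$ is $L$-BLD if it is a branched cover with $L^{-1}\ell(\gamma)\le \ell(f\circ\gamma)\le L\,\ell(\gamma)$ for all paths $\gamma$ in the domain. A measure $\mu$ on $X$ is Ahlfors $n$-regular if there is $C\ge1$ with $C^{-1}r^n\le\mu(B(x,r))\le Cr^n$ for all $x\in X$ and $0<r\le\operatorname{diam}X$. For an integer $n\ge 2$, a metric space $X$ is of type (A123) in dimension $n$ if (A1) up to an $\mathcal H^n$-null set it is covered by countably many Lipschitz images of subsets of $\mathbb R^n$, and $\mathcal H^n$ is locally finite on $X$; (A2) $\mathcal H^n$ is Ahlfors $n$-regular on $X$; (A3) every point of $X$ has a neighbourhood that embeds bilipschitzly in some $\mathbb R^N$. A generalized $n$-manifold is a locally compact Hausdorff space $M$, connected and locally connected, such that, for Alexander–Spanier cohomology $H_c^*$ with compact supports and integer coefficients, (1) $H_c^p(U)=0$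 for all open $U\subset M$ and $p>n$; (2) every neighbourhood of every $x\in M$ contains an open neighbourhood $V$ of $x$ with $H_c^n(V)\cong\mathbb Z$, $H_c^{n-1}(V)=0$, and such that $H_c^n(W)\to H_c^n(V)$ is surjective for every open $W$ with $x\in W\subset V$. A point $x$ is a local cut-point if some connected open neighbourhood $U$ of $x$ is such that $U\setminus\{x\}$ is disconnected. **Statement.** There exist a compact (hence complete) path-metric space $X$ on which $\mathcal H^2$ is Ahlfors $2$-regular, and a $2$-BLD map $f\colon X\to X$, such that $\mathcal H^2(B_f)>0$; more precisely, $B_f$ contains a subset $C$ homeomorphic to the Cantor set with $\mathcal H^2(C)>0$. Moreover, $X$ is of type (A123) in dimension $2$ and contains a dense open subset that is a topological $2$-manifold (without boundary), but $X$ has a local cut-point and is not a generalized $n$-manifold for any $n\ge 0$. -/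

import Mathlib

open Set Topology MeasureTheory
open scoped NNReal ENNReal unitInterval

/-! ### Paths, path-metric spaces, branched covers, BLD maps -/

/-- The length of a path: the supremum of `∑ d(γ(t_{j-1}), γ(t_j))` over all partitions of
`[0,1]`. -/
noncomputable def pathLength {X : Type*} [MetricSpace X] (γ : C(I, X)) : ℝ≥0∞ :=
  eVariationOn γ univ

/-- `X` is a path-metric space: the distance of two points is the infimum of the lengths of the
paths joining them (the infimum over the empty set being `∞`). -/
def IsPathMetricSpace (X : Type*) [MetricSpace X] : Prop :=
  ∀ x y : X, edist x y = ⨅ γ : Path x y, pathLength γ.toContinuousMap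

/-- A branched cover is a continuous, open and discrete map. -/
structure IsBranchedCover {X Y : Type*} [TopologicalSpace X] [TopologicalSpace Y]
    (f : X → Y) : Prop where
  continuous : Continuous f
  isOpenMap : IsOpenMap f
  discrete : ∀ y : Y, IsDiscrete (f ⁻¹' {y})

/-- The branch set: the points at which `f` fails to be a local homeomorphism. -/
def branchSet {X Y : Type*} [TopologicalSpace X] [TopologicalSpace Y] (f : X → Y) : Set X :=
  {x | ¬ IsLocalHomeomorphOn f {x}}

/-- `f` is an `L`-BLD map, i.e. a branched cover that distorts the length of every path
(rectifiable or not) by a factor of at most `L`. -/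
structure IsBLD {X Y : Type*} [MetricSpace X] [MetricSpace Y] (L : ℝ≥0) (f : X → Y) : Prop where
  one_le : 1 ≤ L
  isBranchedCover : IsBranchedCover f
  length_le : ∀ γ : C(I, X),
    (L : ℝ≥0∞)⁻¹ * pathLength γ ≤
        pathLength (ContinuousMap.comp ⟨f, isBranchedCover.continuous⟩ γ) ∧
      pathLength (ContinuousMap.comp ⟨f, isBranchedCover.continuous⟩ γ) ≤ L * pathLength γ

/-! ### Ahlfors regularity and spaces of type (A123) -/

/-- The measure `μ` is Ahlfors `n`-regular: `C⁻¹ rⁿ ≤ μ(B(x,r)) ≤ C rⁿ` for all `x ∈ X` and all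
`0 < r ≤ diam X`. -/
def IsAhlforsRegular {X : Type*} [MetricSpace X] [MeasurableSpace X] (n : ℕ)
    (μ : Measure X) : Prop :=
  ∃ C : ℝ≥0, 1 ≤ C ∧ ∀ (x : X) (r : ℝ), 0 < r →
    ENNReal.ofReal r ≤ Metric.ediam (univ : Set X) →
      (C : ℝ≥0∞)⁻¹ * ENNReal.ofReal r ^ n ≤ μ (Metric.ball x r) ∧
        μ (Metric.ball x r) ≤ C * ENNReal.ofReal r ^ n

/-- `X` is `n`-rectifiable: up to a set of Hausdorff `n`-measure zero it is covered by countably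
many Lipschitz images of subsets of `ℝⁿ`. -/
def IsRectifiableSpace (n : ℕ) (X : Type*) [MetricSpace X] [MeasurableSpace X]
    [BorelSpace X] : Prop :=
  ∃ (E : ℕ → Set (EuclideanSpace ℝ (Fin n))) (g : ℕ → EuclideanSpace ℝ (Fin n) → X)
    (K : ℕ → ℝ≥0), (∀ i, LipschitzOnWith (K i) (g i) (E i)) ∧
      (μH[n] : Measure X) (⋃ i, g i '' E i)ᶜ = 0

/-- Every point of `X` has a neighbourhood that embeds bilipschitzly in some `ℝᴺ`. -/
def IsLocallyBilipschitzEmbeddable (X : Type*) [MetricSpace X] : Prop :=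
  ∀ x : X, ∃ U ∈ 𝓝 x, ∃ (N : ℕ) (φ : U → EuclideanSpace ℝ (Fin N)) (K K' : ℝ≥0),
    LipschitzWith K φ ∧ AntilipschitzWith K' φ

/-- Spaces of type (A123) in dimension `n`. -/
structure IsTypeA123 (n : ℕ) (X : Type*) [MetricSpace X] [MeasurableSpace X]
    [BorelSpace X] : Prop where
  two_le : 2 ≤ n
  rectifiable : IsRectifiableSpace n X
  locallyFinite : IsLocallyFiniteMeasure (μH[n] : Measure X)
  ahlforsRegular : IsAhlforsRegular n (μH[n] : Measure X)
  bilipschitz : IsLocallyBilipschitzEmbeddable X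

/-- `x` is a local cut-point of `X`: some connected open neighbourhood of `x` is disconnected by
the removal of `x`. -/
def IsLocalCutPoint {X : Type*} [TopologicalSpace X] (x : X) : Prop :=
  ∃ U : Set X, IsOpen U ∧ IsConnected U ∧ x ∈ U ∧ ¬ IsPreconnected (U \ {x})

/-! ### Alexander–Spanier cohomology with compact supports, integer coefficients

For an open subset `V` of a locally compact Hausdorff space `X`, the Alexander–Spanier cochains of
`V` with compact support are, up to locally zero ones, the cochains of `X` whose support is compact
and contained in `V` (extend by zero, after cutting off outside a compact neighbourhood of the
support). In this model the standard homomorphism `H_c^p(W) → H_c^p(V)` for `W ⊆ V`, extension by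
zero, is induced by the inclusion of cochain groups. -/

namespace AlexanderSpanier

variable {X : Type*}

/-- A `p`-cochain is an arbitrary function `X^{p+1} → ℤ`. -/
abbrev Cochain (X : Type*) (p : ℕ) : Type _ := (Fin (p + 1) → X) → ℤ

/-- `(δφ)(x₀, …, x_{p+1}) = ∑ᵢ (-1)ⁱ φ(x₀, …, x̂ᵢ, …, x_{p+1})`. -/
def coboundary (p : ℕ) : Cochain X p →+ Cochain X (p + 1) where
  toFun φ s := ∑ i : Fin (p + 2), (-1) ^ (i : ℕ) * φ (fun j => s (i.succAbove j))
  map_zero' := by ext s; simp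
  map_add' φ ψ := by ext s; simp [mul_add, Finset.sum_add_distrib]

variable [TopologicalSpace X]

/-- The support of a cochain: `x` lies outside it iff the cochain vanishes on all tuples of points
of some neighbourhood of `x`. -/
def support {p : ℕ} (φ : Cochain X p) : Set X :=
  {x | ∀ N ∈ 𝓝 x, ∃ s : Fin (p + 1) → X, (∀ i, s i ∈ N) ∧ φ s ≠ 0}

theorem notMem_support {p : ℕ} {φ : Cochain X p} {x : X} :
    x ∉ support φ ↔ ∃ N ∈ 𝓝 x, ∀ s : Fin (p + 1) → X, (∀ i, s i ∈ N) → φ s = 0 := by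
  simp [support]

theorem support_zero {p : ℕ} : support (0 : Cochain X p) = ∅ := by
  refine eq_empty_of_forall_notMem fun x => ?_
  exact notMem_support.2 ⟨univ, Filter.univ_mem, fun _ _ => rfl⟩

theorem support_neg {p : ℕ} (φ : Cochain X p) : support (-φ) = support φ := by
  simp [support]

theorem support_add {p : ℕ} (φ ψ : Cochain X p) :
    support (φ + ψ) ⊆ support φ ∪ support ψ := by
  intro x hx
  by_contra h
  rw [mem_union, not_or] at h
  obtain ⟨N, hN, h1⟩ := notMem_support.1 h.1
  obtain ⟨M, hM, h2⟩ := notMem_support.1 h.2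
  refine notMem_support.2 ⟨N ∩ M, Filter.inter_mem hN hM, fun s hs => ?_⟩ hx
  simp [h1 s fun i => (hs i).1, h2 s fun i => (hs i).2]

theorem isClosed_support {p : ℕ} (φ : Cochain X p) : IsClosed (support φ) := by
  rw [← isOpen_compl_iff, isOpen_iff_mem_nhds]
  intro x hx
  obtain ⟨N, hN, h⟩ := notMem_support.1 hx
  filter_upwards [eventually_mem_nhds_iff.2 hN] with y hy
  exact notMem_support.2 ⟨N, hy, h⟩

/-- The locally zero cochains, i.e. those that vanish near the diagonal. -/
def locallyZero (X : Type*) [TopologicalSpace X] (p : ℕ) : AddSubgroup (Cochain X p) where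
  carrier := {φ | support φ = ∅}
  zero_mem' := support_zero
  add_mem' {φ ψ} hφ hψ := by
    have := support_add φ ψ
    simp_all
  neg_mem' {φ} hφ := by simpa [support_neg] using hφ

/-- The cochains whose support is compact and contained in `V`. -/
def compactlySupported (V : Set X) (p : ℕ) : AddSubgroup (Cochain X p) where
  carrier := {φ | IsCompact (support φ) ∧ support φ ⊆ V}
  zero_mem' := by simp [support_zero]
  add_mem' {φ ψ} hφ hψ :=
    ⟨(hφ.1.union hψ.1).of_isClosed_subset (isClosed_support _) (support_add φ ψ),
      (support_add φ ψ).trans (union_subset hφ.2 hψ.2)⟩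
  neg_mem' {φ} hφ := by simpa [support_neg] using hφ

theorem compactlySupported_mono {W V : Set X} (h : W ⊆ V) (p : ℕ) :
    compactlySupported W p ≤ compactlySupported V p :=
  fun _ hφ => ⟨hφ.1, hφ.2.trans h⟩

/-- Compactly supported cochains that are cocycles modulo locally zero cochains. -/
def cocycles (V : Set X) (p : ℕ) : AddSubgroup (Cochain X p) :=
  compactlySupported V p ⊓ (locallyZero X (p + 1)).comap (coboundary p)

/-- Coboundaries of compactly supported cochains, modulo locally zero cochains. -/
def coboundaries (V : Set X) : (p : ℕ) → AddSubgroup (Cochain X p)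
  | 0 => locallyZero X 0
  | p + 1 => locallyZero X (p + 1) ⊔ (compactlySupported V p).map (coboundary p)

theorem cocycles_mono {W V : Set X} (h : W ⊆ V) (p : ℕ) : cocycles W p ≤ cocycles V p :=
  inf_le_inf_right _ (compactlySupported_mono h p)

theorem coboundaries_mono {W V : Set X} (h : W ⊆ V) (p : ℕ) :
    coboundaries W p ≤ coboundaries V p := by
  cases p with
  | zero => exact le_rfl
  | succ p => exact sup_le_sup_left (AddSubgroup.map_mono (compactlySupported_mono h p)) _

/-- `H_c^p(V; ℤ)` for an open subset `V` of a locally compact Hausdorff space. -/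
abbrev Cohomology (V : Set X) (p : ℕ) : Type _ :=
  cocycles V p ⧸ (coboundaries V p).addSubgroupOf (cocycles V p)

/-- The standard homomorphism `H_c^p(W) → H_c^p(V)` for `W ⊆ V`. -/
def cohomologyMap {W V : Set X} (h : W ⊆ V) (p : ℕ) : Cohomology W p →+ Cohomology V p :=
  QuotientAddGroup.map _ _ (AddSubgroup.inclusion (cocycles_mono h p))
    fun _ hφ => coboundaries_mono h p hφ

end AlexanderSpanier

/-- `X` is a generalized `n`-manifold. The cohomological dimension is at most `n` if `H_c^p(U) = 0`
for all open `U` and all `p > n`; the local cohomology groups are `ℤ` in degree `n` and zero in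
degree `n - 1` if every point has arbitrarily small open neighbourhoods `V` with `H_c^n(V) ≅ ℤ`,
`H_c^{n-1}(V) = 0`, and such that `H_c^n(W) → H_c^n(V)` is onto for all smaller open
neighbourhoods `W` of the point. -/
structure IsGeneralizedManifold (n : ℕ) (X : Type*) [TopologicalSpace X] : Prop where
  locallyCompact : LocallyCompactSpace X
  t2 : T2Space X
  connected : ConnectedSpace X
  locallyConnected : LocallyConnectedSpace X
  cohomologicalDimension_le : ∀ p : ℕ, n < p → ∀ U : Set X, IsOpen U →
    Subsingleton (AlexanderSpanier.Cohomology U p)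
  localCohomology : ∀ (x : X) (U : Set X), IsOpen U → x ∈ U →
    ∃ V : Set X, IsOpen V ∧ x ∈ V ∧ V ⊆ U ∧
      Nonempty (AlexanderSpanier.Cohomology V n ≃+ ℤ) ∧
      (∀ m : ℕ, m + 1 = n → Subsingleton (AlexanderSpanier.Cohomology V m)) ∧
      ∀ (W : Set X) (h : W ⊆ V), IsOpen W → x ∈ W →
        Function.Surjective (AlexanderSpanier.cohomologyMap h n)

/-! ### A Cantor set of positive length in the unit interval -/

/-! The space is the unit interval with a bead of size `2⁻ᵏ` hanging by a corner, its foot, at each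
dyadic number whose reduced denominator is `2ᵏ`. A bead consists of two square sheets glued along a
Cantor set of positive area. Only at the endpoint 0 are the sheets glued everywhere, so that this
bead is a single square. The map is the tent map on the interval and the identity on the squares.
Away from the endpoints the tent map doubles the size of beads; it sends both endpoints to 0, so the
two sheets of the bead at 1 are folded onto the single square at 0. Each point of the Cantor set in
the bead at 1 is then a limit of pairs of distinct points with equal images, hence a branch point.

The folding is nevertheless BLD, because near each point it does not shorten the distances from that
point (`eventually_dist_le_tentMap`): from a point of the Cantor set both sheets are seen at planar
distance, and near any other point of the bead only one sheet is present. Discreteness follows at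
once, and the lower length bound follows by continuous induction along paths
(`edist_le_eVariationOn_of_radial`). Openness comes from lifts that do not increase distances
(`exists_tentMap_eq`).

The geometry rests on `min_dyadicScale_le`: distinct places are at least as far apart as the smaller
of their scales. Hence beads shrink towards every place, which gives compactness; place, planar
position and signed distance from the seam are bilipschitz coordinates in four-space; and the areas
of the small beads in a ball form a geometric series, which gives Ahlfors regularity.

Generalized manifolds are excluded dimension by dimension. For `n = 0`, a proper subset of a
connected space has no compactly supported cohomology in degree 0. For `n = 1`, summation over fine
grids in a sheet detects a nonzero class in degree 2. For `n = 2`, a neighbourhood of a Cantor point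
carries independent classes from the two sheets. For `n ≥ 3`, a small planar disc has no cohomology
in degree `n` (`cocycles_le_coboundaries`), which contradicts surjectivity onto `ℤ`. That vanishing
uses a brick tiling: rounding to bricks takes at most three values near a point, and alternating
cochains of degree at least three vanish on three vertices. -/

namespace FatCantor

/-- The real number in `[0,1]` whose digits in base `m + 2` are `m + 1` where `a` is true and `0`
where it is false. -/
noncomputable def digitValue (m : ℕ) (a : ℕ → Bool) : ℝ :=
  Real.ofDigits fun n => (if a n then Fin.last (m + 1) else 0 : Fin (m + 2))

theorem digitValue_nonneg (m : ℕ) (a : ℕ → Bool) : 0 ≤ digitValue m a := Real.ofDigits_nonneg _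

theorem digitValue_le_one (m : ℕ) (a : ℕ → Bool) : digitValue m a ≤ 1 := Real.ofDigits_le_one _

theorem continuous_digitValue (m : ℕ) : Continuous (digitValue m) := by
  refine Real.continuous_ofDigits.comp (continuous_pi fun n => ?_)
  exact (continuous_of_discreteTopology
    (f := fun c : Bool => (if c then Fin.last (m + 1) else 0 : Fin (m + 2)))).comp
      (continuous_apply n)

theorem digitValue_false (m : ℕ) : digitValue m (fun _ => false) = 0 := by
  simp [digitValue, Real.ofDigits, Real.ofDigitsTerm]

/-- Digit values are ordered lexicographically, with a gap. -/
theorem digitValue_gap (m : ℕ) {a a' : ℕ → Bool} {n : ℕ} (h : ∀ i < n, a i = a' i)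
    (ha : a n = true) (ha' : a' n = false) :
    digitValue m a' + m * (((m + 2 : ℕ) : ℝ) ^ (n + 1))⁻¹ ≤ digitValue m a := by
  unfold digitValue
  -- Split after digit `n`: the earlier digits agree, digit `n` is worth `m + 1` units against 0,
  -- and the tail is worth at most one unit, which leaves `m` units.
  rw [Real.ofDigits_eq_sum_add_ofDigits _ (n + 1), Real.ofDigits_eq_sum_add_ofDigits
    (fun n => (if a n then Fin.last (m + 1) else 0 : Fin (m + 2))) (n + 1),
    Finset.sum_range_succ, Finset.sum_range_succ]
  have hs : ∑ i ∈ Finset.range n, Real.ofDigitsTerm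
        (fun n => (if a' n then Fin.last (m + 1) else 0 : Fin (m + 2))) i =
      ∑ i ∈ Finset.range n, Real.ofDigitsTerm
        (fun n => (if a n then Fin.last (m + 1) else 0 : Fin (m + 2))) i :=
    Finset.sum_congr rfl fun i hi => by
      simp [Real.ofDigitsTerm, h i (Finset.mem_range.mp hi)]
  rw [hs]
  have hp : 0 < (((m + 2 : ℕ) : ℝ) ^ (n + 1))⁻¹ := by positivity
  have h1 := Real.ofDigits_le_one
    (fun i => (if a' (i + (n + 1)) then Fin.last (m + 1) else 0 : Fin (m + 2)))
  have h0 := Real.ofDigits_nonneg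
    (fun i => (if a (i + (n + 1)) then Fin.last (m + 1) else 0 : Fin (m + 2)))
  simp only [Real.ofDigitsTerm, ha, ha', if_true, Fin.val_last]
  have e : ((if (false = true) then Fin.last (m + 1) else 0 : Fin (m + 2)) : ℕ) = 0 := by simp
  rw [e]
  push_cast at *
  nlinarith [mul_le_mul_of_nonneg_left h1 hp.le, mul_nonneg hp.le h0]

theorem exists_first_diff {a a' : ℕ → Bool} (h : a ≠ a') :
    ∃ n, (∀ i < n, a i = a' i) ∧ a n ≠ a' n := by
  have hex : ∃ n, a n ≠ a' n := Function.ne_iff.1 h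
  classical
  exact ⟨Nat.find hex, fun i hi => not_not.1 (Nat.find_min hex hi), Nat.find_spec hex⟩

/-- The parametrization of a Cantor set of positive length, the mean of the binary and the ternary
value. -/
noncomputable def param (a : ℕ → Bool) : ℝ := (digitValue 0 a + digitValue 1 a) / 2

theorem continuous_param : Continuous param :=
  ((continuous_digitValue 0).add (continuous_digitValue 1)).div_const 2

theorem param_mem (a : ℕ → Bool) : param a ∈ Icc (0 : ℝ) 1 := by
  have := digitValue_nonneg 0 a
  have := digitValue_nonneg 1 a
  have := digitValue_le_one 0 a
  have := digitValue_le_one 1 a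
  constructor <;> unfold param <;> linarith

theorem param_false : param (fun _ => false) = 0 := by
  simp [param, digitValue_false]

/-- At the first differing digit the binary values are weakly ordered and the ternary values
strictly, in the same sense, so the mean cannot cancel. The binary value is thus a 2-Lipschitz
function of `param`; as it fills `[0,1]`, the image of `param` has positive length. -/
theorem param_expand {a a' : ℕ → Bool} (h : a ≠ a') :
    |digitValue 0 a - digitValue 0 a'| / 2 < |param a - param a'| := by
  obtain ⟨n, hn, hne⟩ := exists_first_diff h
  have key : ∀ {a a' : ℕ → Bool}, (∀ i < n, a i = a' i) → a n = true → a' n = false →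
      |digitValue 0 a - digitValue 0 a'| / 2 < |param a - param a'| := by
    intro a a' hn ha ha'
    have h0 := digitValue_gap 0 hn ha ha'
    have h1 := digitValue_gap 1 hn ha ha'
    have hp : 0 < (((1 + 2 : ℕ) : ℝ) ^ (n + 1))⁻¹ := by positivity
    simp only [Nat.cast_zero, zero_mul, add_zero] at h0
    simp only [Nat.cast_one, one_mul] at h1
    unfold param
    rw [abs_of_nonneg (by linarith), abs_of_nonneg (by linarith)]
    linarith
  cases ha : a n <;> cases ha' : a' n <;> simp_all only [ne_eq, not_true_eq_false]
  · rw [abs_sub_comm, abs_sub_comm (param a)]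
    exact key (fun i hi => (hn i hi).symm) ha' ha
  · exact key hn ha ha'

theorem injective_param : Function.Injective param := by
  intro a a' h
  by_contra hne
  have := param_expand hne
  rw [h, sub_self, abs_zero] at this
  linarith [abs_nonneg (digitValue 0 a - digitValue 0 a')]

theorem digitValue_zero_surj {y : ℝ} (hy : y ∈ Icc (0 : ℝ) 1) : ∃ a, digitValue 0 a = y := by
  obtain ⟨d, -, hd⟩ := Real.ofDigits_SurjOn (b := 2) one_lt_two hy
  refine ⟨fun n => d n = 1, ?_⟩
  rw [← hd, digitValue]
  congr 1
  ext n
  obtain h | h : d n = 0 ∨ d n = 1 := by omega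
  all_goals simp [h]

theorem param_mem_Ioo {a : ℕ → Bool} (h0 : a ≠ fun _ => false) (h1 : a ≠ fun _ => true) :
    param a ∈ Ioo (0 : ℝ) 1 := by
  obtain ⟨m0, -⟩ := param_mem a
  refine ⟨lt_of_le_of_ne m0 fun h => h0 (injective_param (h ▸ param_false.symm)), ?_⟩
  refine lt_of_lt_of_le ?_ (param_mem fun _ => true).2
  obtain ⟨n, hn, hne⟩ := exists_first_diff h1
  have e : a n = false := by simpa using hne
  have g0 := digitValue_gap 0 (fun i hi => (hn i hi).symm) (a := fun _ => true) rfl e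
  have g1 := digitValue_gap 1 (fun i hi => (hn i hi).symm) (a := fun _ => true) rfl e
  have hp : 0 < (((1 + 2 : ℕ) : ℝ) ^ (n + 1))⁻¹ := by positivity
  simp only [Nat.cast_zero, zero_mul, add_zero] at g0
  simp only [Nat.cast_one, one_mul] at g1
  unfold param
  linarith

theorem isEmbedding_param : IsEmbedding param :=
  (continuous_param.isClosedEmbedding injective_param).isEmbedding

/-- An interval contained in the image would be a connected part of a copy of the Cantor space,
which is totally disconnected. -/
theorem exists_notMem_range_param {a b : ℝ} (h : a < b) : ∃ x ∈ Ioo a b, x ∉ range param := by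
  by_contra! hc
  have hsub : Ioo a b ⊆ range param := hc
  have ht : IsTotallyDisconnected (range param) :=
    isEmbedding_param.isTotallyDisconnected_range.2 inferInstance
  have hs := ht _ hsub isPreconnected_Ioo
  have := hs (show (a + (b - a) / 3) ∈ Ioo a b by constructor <;> linarith)
    (show (a + (b - a) / 2) ∈ Ioo a b by constructor <;> linarith)
  linarith

/-- The parametrization of the Cantor set in the unit square, by the even and the odd terms. -/
noncomputable def squareParam (a : ℕ → Bool) : I × I :=
  (⟨param fun n => a (2 * n), param_mem _⟩, ⟨param fun n => a (2 * n + 1), param_mem _⟩)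

theorem continuous_squareParam : Continuous squareParam := by
  refine Continuous.prodMk (Continuous.subtype_mk (continuous_param.comp ?_) _)
    (Continuous.subtype_mk (continuous_param.comp ?_) _) <;>
  exact continuous_pi fun n => continuous_apply _

/-- The binary counterpart of `squareParam`. -/
noncomputable def squareValue (a : ℕ → Bool) : ℝ × ℝ :=
  (digitValue 0 fun n => a (2 * n), digitValue 0 fun n => a (2 * n + 1))

theorem dist_squareValue_le (a a' : ℕ → Bool) :
    dist (squareValue a) (squareValue a') ≤ 2 * dist (squareParam a) (squareParam a') := by
  have key : ∀ a a' : ℕ → Bool, |digitValue 0 a - digitValue 0 a'| ≤ 2 * |param a - param a'| := by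
    intro a a'
    by_cases h : a = a'
    · simp [h]
    · linarith [param_expand h]
  rw [Prod.dist_eq, Prod.dist_eq, mul_max_of_nonneg _ _ zero_le_two]
  exact max_le_max (key _ _) (key _ _)

theorem injective_squareParam : Function.Injective squareParam := by
  intro a a' h
  simp only [squareParam, Prod.mk.injEq, Subtype.mk.injEq] at h
  have h1 := injective_param h.1
  have h2 := injective_param h.2
  ext n
  obtain ⟨k, rfl | rfl⟩ := n.even_or_odd'
  · exact congrFun h1 k
  · exact congrFun h2 k

theorem squareValue_surj {y : ℝ × ℝ} (hy : y ∈ Icc (0 : ℝ) 1 ×ˢ Icc (0 : ℝ) 1) :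
    ∃ a, squareValue a = y := by
  obtain ⟨b, hb⟩ := digitValue_zero_surj hy.1
  obtain ⟨c, hc⟩ := digitValue_zero_surj hy.2
  refine ⟨fun n => if n % 2 = 0 then b (n / 2) else c (n / 2), ?_⟩
  refine Prod.ext ?_ ?_
  · rw [← hb]
    simp only [squareValue]
    congr 1
    ext n
    simp
  · rw [← hc]
    simp only [squareValue]
    congr 1
    ext n
    rw [if_neg (by omega)]
    congr 1
    omega

/-- The Cantor set of positive area in the unit square. -/
def cantorSquare : Set (I × I) := range squareParam

theorem isCompact_cantorSquare : IsCompact cantorSquare := isCompact_range continuous_squareParam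

theorem zero_mem_cantorSquare : (0 : I × I) ∈ cantorSquare :=
  ⟨fun _ => false, Prod.ext (Subtype.ext param_false) (Subtype.ext param_false)⟩

/-- The open unit square. -/
def openSquare : Set (I × I) := {z | z.1 ∈ Ioo 0 1 ∧ z.2 ∈ Ioo 0 1}

theorem isOpen_openSquare : IsOpen openSquare :=
  (isOpen_Ioo.preimage continuous_fst).inter (isOpen_Ioo.preimage continuous_snd)

/-- The grid sums of the cohomological argument only control cochains supported over the open
square, so a Cantor point in its interior is needed; the foot is a corner. -/
theorem exists_mem_cantorSquare_mem_openSquare : ∃ c ∈ cantorSquare, c ∈ openSquare := by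
  have h : param (fun n => decide (n = 0)) ∈ Ioo (0 : ℝ) 1 :=
    param_mem_Ioo (fun h => by simpa using congrFun h 0) (fun h => by simpa using congrFun h 1)
  -- Both the even and the odd terms of this sequence are `true, false, false, …`, which is not
  -- constant.
  refine ⟨squareParam fun n => decide (n < 2), mem_range_self _, ?_⟩
  have e1 : (fun n => decide (2 * n < 2)) = fun n => decide (n = 0) := by
    ext n; congr 1; simp; omega
  have e2 : (fun n => decide (2 * n + 1 < 2)) = fun n => decide (n = 0) := by
    ext n; congr 1; simp
  simp only [openSquare, squareParam, mem_ofPred_eq, mem_Ioo, ← Subtype.coe_lt_coe, e1, e2]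
  exact ⟨h, h⟩

theorem exists_Ioo_near (x : I) {ε : ℝ} (hε : 0 < ε) :
    ∃ a b : ℝ, a < b ∧ ∀ y ∈ Ioo a b, y ∈ Ioo (0 : ℝ) 1 ∧ |(x : ℝ) - y| < ε := by
  obtain ⟨x, h0, h1⟩ := x
  by_cases h : x ≤ 1 / 2
  · refine ⟨x, min (x + ε) 1, lt_min (by linarith) (by linarith), fun y hy => ?_⟩
    have := hy.1
    obtain ⟨h2, h3⟩ := lt_min_iff.1 hy.2
    exact ⟨⟨by linarith, h3⟩, abs_lt.2 ⟨by simp; linarith, by simp; linarith⟩⟩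
  · refine ⟨max (x - ε) 0, x, max_lt (by linarith) (by linarith), fun y hy => ?_⟩
    have := hy.2
    obtain ⟨h2, h3⟩ := max_lt_iff.1 hy.1
    exact ⟨⟨h3, by linarith⟩, abs_lt.2 ⟨by simp; linarith, by simp; linarith⟩⟩

theorem exists_notMem_cantorSquare_near (z : I × I) {ε : ℝ} (hε : 0 < ε) :
    ∃ w ∈ openSquare, w ∉ cantorSquare ∧ dist z w < ε := by
  obtain ⟨a, b, hab, h⟩ := exists_Ioo_near z.1 hε
  obtain ⟨a', b', hab', h'⟩ := exists_Ioo_near z.2 hε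
  -- It suffices that one coordinate avoids the linear Cantor set.
  obtain ⟨x, hx, hxE⟩ := exists_notMem_range_param hab
  obtain ⟨y, hy⟩ : ∃ y, y ∈ Ioo a' b' := nonempty_Ioo.2 hab'
  refine ⟨(⟨x, Ioo_subset_Icc_self (h x hx).1⟩, ⟨y, Ioo_subset_Icc_self (h' y hy).1⟩),
    ⟨(h x hx).1, (h' y hy).1⟩, ?_, max_lt (h x hx).2 (h' y hy).2⟩
  rintro ⟨c, hc⟩
  exact hxE ⟨_, congrArg (fun z : I × I => (z.1 : ℝ)) hc⟩

end FatCantor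

/-! ### Dyadic numbers -/

/-- `q` is an integer multiple of `2⁻ᵏ`. -/
def IsDyadicAt (k : ℕ) (q : ℝ) : Prop := ∃ m : ℤ, q * 2 ^ k = m

theorem IsDyadicAt.mono {k l : ℕ} {q : ℝ} (h : IsDyadicAt k q) (hkl : k ≤ l) : IsDyadicAt l q := by
  obtain ⟨m, hm⟩ := h
  obtain ⟨j, rfl⟩ := Nat.exists_eq_add_of_le hkl
  exact ⟨m * 2 ^ j, by push_cast; rw [pow_add, ← mul_assoc, hm]⟩

open Classical in
/-- The largest `2⁻ᵏ` of which `q` is an integer multiple, and `0` if there is none. -/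
noncomputable def dyadicScale (q : ℝ) : ℝ :=
  if h : ∃ k, IsDyadicAt k q then (1 / 2) ^ Nat.find h else 0

theorem dyadicScale_nonneg (q : ℝ) : 0 ≤ dyadicScale q := by
  unfold dyadicScale; split_ifs <;> positivity

theorem dyadicScale_le_one (q : ℝ) : dyadicScale q ≤ 1 := by
  unfold dyadicScale; split_ifs
  · exact pow_le_one₀ (by norm_num) (by norm_num)
  · exact zero_le_one

theorem pow_le_dyadicScale_iff {k : ℕ} {q : ℝ} :
    (1 / 2) ^ k ≤ dyadicScale q ↔ IsDyadicAt k q := by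
  classical
  unfold dyadicScale
  split_ifs with h
  · rw [pow_le_pow_iff_right_of_lt_one₀ (by norm_num) (by norm_num)]
    exact ⟨fun hk => (Nat.find_spec h).mono hk, fun hk => Nat.find_min' h hk⟩
  · refine ⟨fun hk => absurd hk (not_le.2 (by positivity)), fun hk => absurd ⟨k, hk⟩ h⟩

theorem dyadicScale_eq_zero_or (q : ℝ) :
    dyadicScale q = 0 ∨ ∃ k : ℕ, dyadicScale q = (1 / 2) ^ k ∧ IsDyadicAt k q := by
  classical
  by_cases h : ∃ k, IsDyadicAt k q
  · exact Or.inr ⟨Nat.find h, by rw [dyadicScale, dif_pos h], Nat.find_spec h⟩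
  · exact Or.inl (by rw [dyadicScale, dif_neg h])

theorem IsDyadicAt.pow_le_dist {k : ℕ} {q q' : ℝ} (h : IsDyadicAt k q) (h' : IsDyadicAt k q')
    (hne : q ≠ q') : (1 / 2) ^ k ≤ |q - q'| := by
  obtain ⟨m, hm⟩ := h
  obtain ⟨m', hm'⟩ := h'
  have hp : (0 : ℝ) < 2 ^ k := by positivity
  have hmm : m - m' ≠ 0 := by
    intro h0
    have : (m : ℝ) = m' := by exact_mod_cast sub_eq_zero.1 h0
    exact hne (mul_right_cancel₀ hp.ne' (by rw [hm, hm', this]))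
  have h1 : (1 : ℝ) ≤ |((m - m' : ℤ) : ℝ)| := by
    exact_mod_cast Int.one_le_abs hmm
  rw [div_pow, one_pow, div_le_iff₀ hp]
  calc (1 : ℝ) ≤ |((m - m' : ℤ) : ℝ)| := h1
    _ = |q - q'| * 2 ^ k := by
      rw [← abs_of_pos hp, ← abs_mul, sub_mul, hm, hm', Int.cast_sub]

/-- If both scales are positive, both numbers are multiples of the smaller one. This separation
keeps large beads apart. -/
theorem min_dyadicScale_le {q q' : ℝ} (h : q ≠ q') :
    min (dyadicScale q) (dyadicScale q') ≤ |q - q'| := by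
  obtain h0 | ⟨k, hk, hd⟩ := dyadicScale_eq_zero_or q
  · exact (min_le_left _ _).trans (h0.le.trans (abs_nonneg _))
  obtain h0 | ⟨l, hl, hd'⟩ := dyadicScale_eq_zero_or q'
  · exact (min_le_right _ _).trans (h0.le.trans (abs_nonneg _))
  obtain hkl | hkl := le_total k l
  · exact (min_le_right _ _).trans (hl.le.trans ((hd.mono hkl).pow_le_dist hd' h))
  · exact (min_le_left _ _).trans (hk.le.trans (hd.pow_le_dist (hd'.mono hkl) h))

/-- Two numbers of scale at least `ε` within `ε / 2` of `q` would violate `min_dyadicScale_le`, so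
there is at most one to avoid besides `q`. -/
theorem eventually_dyadicScale_lt (q : ℝ) {ε : ℝ} (hε : 0 < ε) :
    ∀ᶠ q' in 𝓝[≠] q, dyadicScale q' < ε := by
  by_cases h : ∃ a, a ≠ q ∧ |a - q| < ε / 2 ∧ ε ≤ dyadicScale a
  · obtain ⟨a, haq, ha, hs⟩ := h
    have h1 : ∀ᶠ q' in 𝓝[≠] q, q' ≠ a :=
      (isOpen_ne.eventually_mem haq.symm).filter_mono nhdsWithin_le_nhds
    have h2 : ∀ᶠ q' in 𝓝[≠] q, |q' - q| < ε / 2 :=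
      nhdsWithin_le_nhds (Metric.ball_mem_nhds q (half_pos hε))
    filter_upwards [h1, h2] with q' hq1 hq2
    by_contra! hc
    have := (le_min hc hs).trans (min_dyadicScale_le hq1)
    have := abs_sub_le q' q a
    rw [abs_sub_comm q a] at this
    linarith
  · push Not at h
    have h2 : ∀ᶠ q' in 𝓝[≠] q, |q' - q| < ε / 2 :=
      nhdsWithin_le_nhds (Metric.ball_mem_nhds q (half_pos hε))
    filter_upwards [h2, self_mem_nhdsWithin] with q' hq hne
    exact h q' hne hq

theorem dyadicScale_zero : dyadicScale 0 = 1 :=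
  le_antisymm (dyadicScale_le_one _) (by simpa using (pow_le_dyadicScale_iff (k := 0)).2 ⟨0, by simp⟩)

theorem dyadicScale_one : dyadicScale 1 = 1 :=
  le_antisymm (dyadicScale_le_one _) (by simpa using (pow_le_dyadicScale_iff (k := 0)).2 ⟨1, by simp⟩)

/-- The tent map. -/
noncomputable def tent (q : I) : I :=
  ⟨1 - |2 * (q : ℝ) - 1|, by
    have := abs_le.2 (⟨by linarith [q.2.1], by linarith [q.2.2]⟩ : -1 ≤ 2 * (q : ℝ) - 1 ∧ _)
    constructor <;> linarith [abs_nonneg (2 * (q : ℝ) - 1)]⟩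

theorem coe_tent_of_le {q : I} (h : (q : ℝ) ≤ 1 / 2) : (tent q : ℝ) = 2 * q := by
  rw [tent]; dsimp only; rw [abs_of_nonpos (by linarith)]; ring

theorem coe_tent_of_ge {q : I} (h : 1 / 2 ≤ (q : ℝ)) : (tent q : ℝ) = 2 - 2 * q := by
  rw [tent]; dsimp only; rw [abs_of_nonneg (by linarith)]; ring

theorem tent_zero : tent 0 = 0 := Subtype.ext (by rw [coe_tent_of_le] <;> simp)

theorem tent_one : tent 1 = 0 := Subtype.ext (by rw [coe_tent_of_ge] <;> norm_num)

theorem dist_tent_le (q q' : I) : |(tent q : ℝ) - tent q'| ≤ 2 * |(q : ℝ) - q'| := by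
  have h := abs_abs_sub_abs_le (2 * (q' : ℝ) - 1) (2 * q - 1)
  have e : (2 * (q' : ℝ) - 1) - (2 * q - 1) = 2 * (q' - q) := by ring
  have e2 : (tent q : ℝ) - tent q' = |2 * (q' : ℝ) - 1| - |2 * (q : ℝ) - 1| := by
    simp only [tent]; ring
  rw [e2]
  rw [e, abs_mul, abs_two, abs_sub_comm (q' : ℝ)] at h
  exact h

/-- Away from the endpoints the tent map doubles the scale. -/
theorem dyadicScale_tent {q : I} (h0 : q ≠ 0) (h1 : q ≠ 1) :
    dyadicScale (tent q) = 2 * dyadicScale q := by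
  have hiff : ∀ k, IsDyadicAt k (tent q) ↔ IsDyadicAt (k + 1) q := by
    intro k
    obtain h | h := le_total (q : ℝ) (1 / 2)
    · simp only [IsDyadicAt, coe_tent_of_le h, pow_succ]
      refine exists_congr fun m => by rw [← mul_assoc, mul_comm (2 : ℝ), mul_right_comm]
    · simp only [IsDyadicAt, coe_tent_of_ge h, pow_succ]
      refine ⟨fun ⟨m, hm⟩ => ⟨2 * 2 ^ k - m, ?_⟩, fun ⟨m, hm⟩ => ⟨2 * 2 ^ k - m, ?_⟩⟩ <;>
      push_cast <;> rw [← hm] <;> ring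
  -- Off the endpoints the scale is at most `1 / 2`, so that there is room for doubling.
  have hnot : ¬ IsDyadicAt 0 q := by
    rintro ⟨m, hm⟩
    rw [pow_zero, mul_one] at hm
    have l0 : (0 : ℝ) < q := lt_of_le_of_ne q.2.1 fun h => h0 (Subtype.ext h.symm)
    have l1 : (q : ℝ) < 1 := lt_of_le_of_ne q.2.2 fun h => h1 (Subtype.ext h)
    rw [hm] at l0 l1
    have a0 : (0 : ℤ) < m := by exact_mod_cast l0
    have a1 : m < (1 : ℤ) := by exact_mod_cast l1
    omega
  apply le_antisymm
  · obtain h | ⟨k, hk, hd⟩ := dyadicScale_eq_zero_or (tent q)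
    · rw [h]; linarith [dyadicScale_nonneg q]
    · have := pow_le_dyadicScale_iff.2 ((hiff k).1 hd)
      rw [hk]; rw [pow_succ] at this; linarith
  · obtain h | ⟨k, hk, hd⟩ := dyadicScale_eq_zero_or q
    · rw [h]; linarith [dyadicScale_nonneg (tent q)]
    · cases k with
      | zero => exact absurd hd hnot
      | succ k =>
        have := pow_le_dyadicScale_iff.2 ((hiff k).2 hd)
        rw [hk, pow_succ]; linarith

theorem dyadicScale_le_tent (q : I) : dyadicScale q ≤ dyadicScale (tent q) := by
  by_cases h0 : q = 0
  · rw [h0, tent_zero]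
  by_cases h1 : q = 1
  · rw [h1, tent_one]; simp [dyadicScale_zero, dyadicScale_one]
  rw [dyadicScale_tent h0 h1]; linarith [dyadicScale_nonneg q]

theorem dyadicScale_tent_le (q : I) : dyadicScale (tent q) ≤ 2 * dyadicScale q := by
  by_cases h0 : q = 0
  · rw [h0, tent_zero]; simp [dyadicScale_zero]
  by_cases h1 : q = 1
  · rw [h1, tent_one]; simp [dyadicScale_zero, dyadicScale_one]
  rw [dyadicScale_tent h0 h1]

/-- Only distances from the fixed centre are doubled: around `1 / 2` symmetric points have the same
image. This is why all lower bounds below are radial. -/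
theorem eventually_dist_tent (q : I) :
    ∀ᶠ q' in 𝓝 q, |(tent q : ℝ) - tent q'| = 2 * |(q : ℝ) - q'| := by
  have e : ∀ x y : ℝ, |2 * x - 2 * y| = 2 * |x - y| := fun x y => by
    rw [← mul_sub, abs_mul, abs_two]
  have e' : ∀ x y : ℝ, |(2 - 2 * x) - (2 - 2 * y)| = 2 * |x - y| := fun x y => by
    rw [← e x y, abs_sub_comm]; congr 1; ring
  obtain h | h | h := lt_trichotomy (q : ℝ) (1 / 2)
  · filter_upwards [continuous_subtype_val.continuousAt.eventually_lt_const h] with q' h'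
    rw [coe_tent_of_le h.le, coe_tent_of_le h'.le, e]
  · refine Filter.Eventually.of_forall fun q' => ?_
    obtain h' | h' := le_total (q' : ℝ) (1 / 2)
    · rw [coe_tent_of_le h.le, coe_tent_of_le h', e]
    · rw [coe_tent_of_ge h.ge, coe_tent_of_ge h', e']
  · filter_upwards [continuous_subtype_val.continuousAt.eventually_const_lt h] with q' h'
    rw [coe_tent_of_ge h.le, coe_tent_of_ge h'.le, e']

/-- Preimages under the tent map, on the same side. -/
theorem exists_tent_eq (q p : I) :
    ∃ q', tent q' = p ∧ |(tent q : ℝ) - p| = 2 * |(q : ℝ) - q'| := by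
  obtain h | h := le_total (q : ℝ) (1 / 2)
  · refine ⟨⟨p / 2, by linarith [p.2.1], by linarith [p.2.2]⟩, Subtype.ext ?_, ?_⟩
    · rw [coe_tent_of_le (by simp; linarith [p.2.2])]; simp; ring
    · have e : 2 * (q : ℝ) - p = 2 * (q - p / 2) := by ring
      rw [coe_tent_of_le h, e, abs_mul, abs_two]
  · refine ⟨⟨1 - p / 2, by linarith [p.2.2], by linarith [p.2.1]⟩, Subtype.ext ?_, ?_⟩
    · rw [coe_tent_of_ge (by simp; linarith [p.2.2])]; simp; ring
    · have e : 2 - 2 * (q : ℝ) - p = -(2 * (q - (1 - p / 2))) := by ring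
      rw [coe_tent_of_ge h, e, abs_neg, abs_mul, abs_two]

/-! ### Two sheets glued along a compact set -/

section Gluing

variable {S : Type*} [PseudoMetricSpace S] {G : Set S}

/-- The distance from `z` to `w` through a point of `G`. -/
noncomputable def throughDist (G : Set S) (z w : S) : ℝ := ⨅ c : G, (dist z c + dist (c : S) w)

theorem throughDist_le {c : S} (hc : c ∈ G) (z w : S) :
    throughDist G z w ≤ dist z c + dist c w :=
  ciInf_le (f := fun c : G => dist z c + dist (c : S) w)
    ⟨0, by rintro _ ⟨c, rfl⟩; positivity⟩ ⟨c, hc⟩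

theorem exists_throughDist_eq (hG : IsCompact G) (hne : G.Nonempty) (z w : S) :
    ∃ c ∈ G, throughDist G z w = dist z c + dist c w := by
  obtain ⟨c, hc, hmin⟩ := hG.exists_isMinOn hne
    (f := fun c => dist z c + dist c w) (by fun_prop)
  have : Nonempty G := ⟨⟨c, hc⟩⟩
  exact ⟨c, hc, le_antisymm (throughDist_le hc z w) (le_ciInf fun d => hmin d.2)⟩

theorem dist_le_throughDist (hne : G.Nonempty) (z w : S) : dist z w ≤ throughDist G z w := by
  have := hne.to_subtype
  exact le_ciInf fun c => dist_triangle _ _ _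

theorem infDist_le_throughDist (hne : G.Nonempty) (z w : S) :
    Metric.infDist z G + Metric.infDist w G ≤ throughDist G z w := by
  have := hne.to_subtype
  refine le_ciInf fun c => add_le_add (Metric.infDist_le_dist_of_mem c.2) ?_
  rw [dist_comm]
  exact Metric.infDist_le_dist_of_mem c.2

theorem throughDist_comm (G : Set S) (z w : S) : throughDist G z w = throughDist G w z := by
  unfold throughDist
  congr 1
  ext c
  rw [dist_comm z, dist_comm _ w, add_comm]

/-- The distance on the space that arises from two copies of `S` when the two copies of `G` are
identified. -/
noncomputable def sheetDist (G : Set S) (z : S) (i : Bool) (w : S) (j : Bool) : ℝ :=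
  if i = j then dist z w else throughDist G z w

theorem sheetDist_same (G : Set S) (z w : S) (i : Bool) : sheetDist G z i w i = dist z w :=
  if_pos rfl

theorem sheetDist_comm (G : Set S) (z : S) (i : Bool) (w : S) (j : Bool) :
    sheetDist G z i w j = sheetDist G w j z i := by
  unfold sheetDist
  by_cases h : i = j
  · rw [if_pos h, if_pos h.symm, dist_comm]
  · rw [if_neg h, if_neg (Ne.symm h), throughDist_comm]

theorem dist_le_sheetDist (hne : G.Nonempty) (z : S) (i : Bool) (w : S) (j : Bool) :
    dist z w ≤ sheetDist G z i w j := by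
  unfold sheetDist
  split_ifs
  exacts [le_rfl, dist_le_throughDist hne z w]

theorem sheetDist_le {c : S} (hc : c ∈ G) (z : S) (i : Bool) (w : S)
    (j : Bool) : sheetDist G z i w j ≤ dist z c + dist c w := by
  unfold sheetDist
  split_ifs
  exacts [dist_triangle _ _ _, throughDist_le hc z w]

theorem sheetDist_of_mem (hne : G.Nonempty) {z : S} (hz : z ∈ G) (i : Bool) (w : S) (j : Bool) :
    sheetDist G z i w j = dist z w :=
  le_antisymm (by simpa using sheetDist_le hz z i w j) (dist_le_sheetDist hne z i w j)

/-- If the end sheets differ, exactly one of the two legs changes sheet, and it does so at a point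
of `G` that also serves the direct route. -/
theorem sheetDist_triangle (hG : IsCompact G) (hne : G.Nonempty) (z : S) (i : Bool) (w : S)
    (j : Bool) (v : S) (k : Bool) :
    sheetDist G z i v k ≤ sheetDist G z i w j + sheetDist G w j v k := by
  by_cases hik : i = k
  · subst hik
    rw [sheetDist_same]
    exact (dist_triangle z w v).trans
      (add_le_add (dist_le_sheetDist hne _ _ _ _) (dist_le_sheetDist hne _ _ _ _))
  by_cases hij : i = j
  · subst hij
    rw [sheetDist_same]
    obtain ⟨c, hc, e⟩ := exists_throughDist_eq hG hne w v
    rw [sheetDist, if_neg hik, sheetDist, if_neg hik, e]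
    linarith [throughDist_le hc z v, dist_triangle z w c]
  · obtain rfl : j = k := by cases i <;> cases j <;> cases k <;> simp_all
    obtain ⟨c, hc, e⟩ := exists_throughDist_eq hG hne z w
    rw [sheetDist_same, sheetDist, if_neg hik, sheetDist, if_neg hik, e]
    linarith [throughDist_le hc z v, dist_triangle c w v]

theorem abs_infDist_le (z w : S) (G : Set S) :
    |Metric.infDist z G - Metric.infDist w G| ≤ dist z w := by
  rw [abs_sub_le_iff]
  constructor
  · linarith [Metric.infDist_le_infDist_add_dist (s := G) (x := z) (y := w)]
  · linarith [Metric.infDist_le_infDist_add_dist (s := G) (x := w) (y := z), dist_comm z w]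

/-- The height of a point: the distance to `G`, with a sign that depends on the sheet. -/
noncomputable def sheetHeight (G : Set S) (z : S) (i : Bool) : ℝ :=
  if i then Metric.infDist z G else -Metric.infDist z G

theorem abs_sheetHeight (G : Set S) (z : S) (i : Bool) :
    |sheetHeight G z i| = Metric.infDist z G := by
  unfold sheetHeight
  split_ifs
  · exact abs_of_nonneg Metric.infDist_nonneg
  · rw [abs_neg]; exact abs_of_nonneg Metric.infDist_nonneg

theorem abs_sheetHeight_sub_le (hne : G.Nonempty) (z : S) (i : Bool) (w : S) (j : Bool) :
    |sheetHeight G z i - sheetHeight G w j| ≤ sheetDist G z i w j := by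
  by_cases h : i = j
  · subst h
    rw [sheetDist_same]
    cases i
    · have : sheetHeight G z false - sheetHeight G w false =
        -(Metric.infDist z G - Metric.infDist w G) := by simp [sheetHeight]; ring
      rw [this, abs_neg]
      exact abs_infDist_le z w G
    · simpa [sheetHeight] using abs_infDist_le z w G
  · rw [sheetDist, if_neg h]
    refine (abs_sub _ _).trans ?_
    rw [abs_sheetHeight, abs_sheetHeight]
    exact infDist_le_throughDist hne z w

/-- On different sheets the heights have opposite signs, so their difference dominates the distance
from `z` to `G`; the detour through the nearest point of `G` costs at most twice that. -/
theorem sheetDist_le_dist_add (hG : IsCompact G) (hne : G.Nonempty) (z : S) (i : Bool) (w : S)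
    (j : Bool) :
    sheetDist G z i w j ≤ dist z w + 2 * |sheetHeight G z i - sheetHeight G w j| := by
  by_cases h : i = j
  · rw [sheetDist, if_pos h]
    linarith [abs_nonneg (sheetHeight G z i - sheetHeight G w j)]
  · obtain ⟨c, hc, e⟩ := hG.exists_infDist_eq_dist hne z
    have h1 : ∀ i j, i ≠ j → |sheetHeight G z i - sheetHeight G w j| =
        Metric.infDist z G + Metric.infDist w G := by
      clear e h i j
      intro i j h
      have a := Metric.infDist_nonneg (x := z) (s := G)
      have b := Metric.infDist_nonneg (x := w) (s := G)
      cases i <;> cases j <;> simp only [ne_eq, not_true_eq_false] at h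
      · simp only [sheetHeight, Bool.false_eq_true, if_false, if_true]
        rw [abs_of_nonpos (by linarith)]; ring
      · simp only [sheetHeight, Bool.false_eq_true, if_false, if_true]
        rw [abs_of_nonneg (by linarith)]; ring
    rw [sheetDist, if_neg h, h1 i j h]
    have := throughDist_le hc z w
    have := dist_triangle c z w
    rw [dist_comm c z] at this
    linarith [Metric.infDist_nonneg (x := w) (s := G)]

end Gluing

/-! ### The space -/

namespace BeadedInterval

open FatCantor

/-- The set along which the two sheets of the bead at `q` are glued: everything at `q = 0`, and a
Cantor set of positive area otherwise. -/
noncomputable def seam (q : I) : Set (I × I) :=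
  open Classical in if q = 0 then univ else cantorSquare

theorem cantorSquare_subset_seam (q : I) : cantorSquare ⊆ seam q := by
  unfold seam; split_ifs
  exacts [subset_univ _, le_rfl]

theorem seam_zero : seam 0 = univ := if_pos rfl

theorem seam_of_ne {q : I} (h : q ≠ 0) : seam q = cantorSquare := if_neg h

theorem isCompact_seam (q : I) : IsCompact (seam q) := by
  unfold seam; split_ifs
  exacts [isCompact_univ, isCompact_cantorSquare]

theorem zero_mem_seam (q : I) : (0 : I × I) ∈ seam q :=
  cantorSquare_subset_seam q zero_mem_cantorSquare

theorem seam_nonempty (q : I) : (seam q).Nonempty := ⟨0, zero_mem_seam q⟩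

theorem norm_pos_le_one (z : I × I) : dist z 0 ≤ 1 := by
  refine max_le ?_ ?_ <;>
  · rw [Subtype.dist_eq, Real.dist_eq, abs_le]
    constructor <;> simp <;> linarith [z.1.2.1, z.1.2.2, z.2.2.1, z.2.2.2]

/-- A point of the bead at `q`: a point of the unit square and the name of a sheet. -/
structure PrePoint where
  /-- the place of the bead -/
  q : I
  /-- the point of the square -/
  z : I × I
  /-- the sheet -/
  i : Bool

/-- The distance of a point from the foot of its bead. -/
noncomputable def PrePoint.height (x : PrePoint) : ℝ := dyadicScale x.q * dist x.z 0

theorem PrePoint.height_nonneg (x : PrePoint) : 0 ≤ x.height :=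
  mul_nonneg (dyadicScale_nonneg _) dist_nonneg

theorem PrePoint.height_le (x : PrePoint) : x.height ≤ dyadicScale x.q :=
  mul_le_of_le_one_right (dyadicScale_nonneg _) (norm_pos_le_one _)

open Classical in
/-- The distance on the beaded interval. -/
noncomputable def preDist (x y : PrePoint) : ℝ :=
  if x.q = y.q then dyadicScale x.q * sheetDist (seam x.q) x.z x.i y.z y.i
  else x.height + |(x.q : ℝ) - y.q| + y.height

theorem preDist_of_eq {x y : PrePoint} (h : x.q = y.q) :
    preDist x y = dyadicScale x.q * sheetDist (seam x.q) x.z x.i y.z y.i := if_pos h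

theorem preDist_of_ne {x y : PrePoint} (h : x.q ≠ y.q) :
    preDist x y = x.height + |(x.q : ℝ) - y.q| + y.height := if_neg h

theorem preDist_comm (x y : PrePoint) : preDist x y = preDist y x := by
  by_cases h : x.q = y.q
  · rw [preDist_of_eq h, preDist_of_eq h.symm, h, sheetDist_comm]
  · rw [preDist_of_ne h, preDist_of_ne (Ne.symm h), abs_sub_comm]; ring

theorem preDist_le (x y : PrePoint) :
    preDist x y ≤ x.height + |(x.q : ℝ) - y.q| + y.height := by
  by_cases h : x.q = y.q
  · rw [preDist_of_eq h, h, sub_self, abs_zero, add_zero, PrePoint.height, PrePoint.height, h,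
      ← mul_add]
    refine mul_le_mul_of_nonneg_left ?_ (dyadicScale_nonneg _)
    rw [dist_comm y.z]
    exact sheetDist_le (zero_mem_seam _) _ _ _ _
  · exact (preDist_of_ne h).le

theorem height_le_add_preDist (x y : PrePoint) : x.height ≤ preDist x y + y.height := by
  by_cases h : x.q = y.q
  · rw [preDist_of_eq h, PrePoint.height, PrePoint.height, ← h, ← mul_add]
    refine mul_le_mul_of_nonneg_left ?_ (dyadicScale_nonneg _)
    exact (dist_triangle _ y.z _).trans
      (add_le_add_left (dist_le_sheetDist (seam_nonempty _) _ _ _ _) _)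
  · rw [preDist_of_ne h]
    linarith [abs_nonneg ((x.q : ℝ) - y.q), y.height_nonneg]

/-- A route between different beads passes through both feet; within a bead, `height_le_add_preDist`
compares the ways to the foot. -/
theorem preDist_triangle (x y v : PrePoint) : preDist x v ≤ preDist x y + preDist y v := by
  by_cases hxy : x.q = y.q
  · by_cases hyv : y.q = v.q
    · rw [preDist_of_eq (hxy.trans hyv), preDist_of_eq hxy, preDist_of_eq hyv, ← hxy, ← mul_add]
      exact mul_le_mul_of_nonneg_left (sheetDist_triangle (isCompact_seam _) (seam_nonempty _) ..)
        (dyadicScale_nonneg _)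
    · rw [preDist_of_ne (hxy ▸ hyv), preDist_of_ne hyv, hxy]
      linarith [height_le_add_preDist x y]
  · by_cases hyv : y.q = v.q
    · rw [preDist_of_ne (hyv ▸ hxy), preDist_of_ne hxy, ← hyv]
      linarith [height_le_add_preDist v y, preDist_comm y v]
    · rw [preDist_of_ne hxy, preDist_of_ne hyv]
      have := preDist_le x v
      linarith [abs_sub_le (x.q : ℝ) y.q v.q, y.height_nonneg]

noncomputable instance : PseudoMetricSpace PrePoint where
  dist := preDist
  dist_self x := by
    rw [preDist_of_eq rfl, sheetDist_same, dist_self, mul_zero]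
  dist_comm := preDist_comm
  dist_triangle := preDist_triangle

theorem dist_of_eq {x y : PrePoint} (h : x.q = y.q) :
    dist x y = dyadicScale x.q * sheetDist (seam x.q) x.z x.i y.z y.i := if_pos h

theorem dist_of_ne {x y : PrePoint} (h : x.q ≠ y.q) :
    dist x y = x.height + |(x.q : ℝ) - y.q| + y.height := if_neg h

theorem dist_le_heights (x y : PrePoint) :
    dist x y ≤ x.height + |(x.q : ℝ) - y.q| + y.height := preDist_le x y

theorem dist_mk_mk (q : I) (z w : I × I) (i : Bool) :
    dist (PrePoint.mk q z i) ⟨q, w, i⟩ = dyadicScale q * dist z w := by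
  rw [dist_of_eq (x := ⟨q, z, i⟩) (y := ⟨q, w, i⟩) rfl, sheetDist_same]

theorem abs_q_sub_le (x y : PrePoint) : |(x.q : ℝ) - y.q| ≤ dist x y := by
  by_cases h : x.q = y.q
  · rw [h, sub_self, abs_zero]; exact dist_nonneg
  · rw [dist_of_ne h]; linarith [x.height_nonneg, y.height_nonneg]

theorem dist_foot (q q' : I) (i i' : Bool) :
    dist (PrePoint.mk q 0 i) ⟨q', 0, i'⟩ = |(q : ℝ) - q'| := by
  refine le_antisymm ?_ (abs_q_sub_le ⟨q, 0, i⟩ ⟨q', 0, i'⟩)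
  simpa [PrePoint.height] using dist_le_heights ⟨q, 0, i⟩ ⟨q', 0, i'⟩

theorem dist_seam {q : I} {z : I × I} (hz : z ∈ seam q) (i j : Bool) :
    dist (PrePoint.mk q z i) ⟨q, z, j⟩ = 0 := by
  rw [dist_of_eq (x := ⟨q, z, i⟩) (y := ⟨q, z, j⟩) rfl]
  simp [sheetDist_of_mem (seam_nonempty q) hz]

/-- The points near a bead point that does not lie on the Cantor set. -/
theorem exists_same_sheet {q : I} {z : I × I} {i : Bool} {y : PrePoint}
    (h : dist (PrePoint.mk q z i) y < dyadicScale q * Metric.infDist z cantorSquare) :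
    y.q = q ∧ dist (PrePoint.mk q y.z i) y = 0 := by
  -- The foot belongs to the Cantor set, so leaving the bead costs at least as much as reaching the
  -- Cantor set.
  have hz : Metric.infDist z cantorSquare ≤ dist z 0 :=
    Metric.infDist_le_dist_of_mem zero_mem_cantorSquare
  have hq : q = y.q := by
    by_contra hne
    rw [dist_of_ne hne] at h
    have : (PrePoint.mk q z i).height = dyadicScale q * dist z 0 := rfl
    have h2 := mul_le_mul_of_nonneg_left hz (dyadicScale_nonneg q)
    linarith [abs_nonneg ((q : ℝ) - y.q), y.height_nonneg]
  refine ⟨hq.symm, ?_⟩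
  obtain ⟨q', w, j⟩ := y
  obtain rfl : q = q' := hq
  by_cases h0 : q = 0
  · exact dist_seam (by rw [h0, seam_zero]; trivial) _ _
  by_cases hij : i = j
  · rw [hij, dist_self]
  · rw [dist_of_eq (x := ⟨q, z, i⟩) (y := ⟨q, w, j⟩) rfl] at h
    dsimp only at h
    rw [sheetDist, if_neg hij, seam_of_ne h0] at h
    have h1 := infDist_le_throughDist (G := cantorSquare) ⟨0, zero_mem_cantorSquare⟩ z w
    have h2 := mul_le_mul_of_nonneg_left
      (le_of_add_le_of_nonneg_left h1 Metric.infDist_nonneg) (dyadicScale_nonneg q)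
    exact absurd h (not_lt.2 h2)

/-- The places converge to some `q` along an ultrafilter. Either it lives on the bead at `q`, where
compactness of the square applies, or it avoids that bead; then the beads shrink and it converges to
the foot at `q`. -/
instance : CompactSpace PrePoint := by
  refine ⟨isCompact_iff_ultrafilter_le_nhds.2 fun F _ => ?_⟩
  obtain ⟨q, -, hq⟩ := isCompact_iff_ultrafilter_le_nhds.1 (isCompact_univ (X := I))
    (F.map PrePoint.q) (by simp)
  by_cases hF : {x : PrePoint | x.q = q} ∈ F
  · obtain ⟨⟨z, i⟩, -, hz⟩ := isCompact_iff_ultrafilter_le_nhds.1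
      (isCompact_univ (X := (I × I) × Bool)) (F.map fun x => (x.z, x.i)) (by simp)
    refine ⟨⟨q, z, i⟩, trivial, ?_⟩
    rw [nhds_prod_eq] at hz
    have h1 : Filter.Tendsto PrePoint.z F (𝓝 z) := Filter.tendsto_fst.comp hz
    have h2 : Filter.Tendsto PrePoint.i F (𝓝 i) := Filter.tendsto_snd.comp hz
    rw [nhds_discrete] at h2
    rw [Metric.nhds_basis_ball.ge_iff]
    intro ε hε
    filter_upwards [hF, h2 (Filter.mem_pure.2 rfl : ({i} : Set Bool) ∈ pure i),
      h1 (Metric.ball_mem_nhds z hε)] with x hxq hxi hxz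
    obtain ⟨q', w, j⟩ := x
    obtain rfl : q' = q := hxq
    obtain rfl : j = i := hxi
    rw [Metric.mem_ball, dist_mk_mk]
    exact lt_of_le_of_lt (mul_le_of_le_one_left dist_nonneg (dyadicScale_le_one _)) hxz
  · have hF' : ∀ᶠ x in (F : Filter PrePoint), x.q ≠ q := Ultrafilter.compl_mem_iff_notMem.2 hF
    refine ⟨⟨q, 0, false⟩, trivial, ?_⟩
    have h1 : Filter.Tendsto (fun x : PrePoint => (x.q : ℝ)) F (𝓝 (q : ℝ)) :=
      (continuous_subtype_val.tendsto q).comp hq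
    have h2 : Filter.Tendsto (fun x : PrePoint => (x.q : ℝ)) F (𝓝[≠] (q : ℝ)) :=
      tendsto_nhdsWithin_iff.2 ⟨h1, hF'.mono fun x hx h => hx (Subtype.ext h)⟩
    rw [Metric.nhds_basis_ball.ge_iff]
    intro ε hε
    filter_upwards [h2.eventually (eventually_dyadicScale_lt q (half_pos hε)),
      h1 (Metric.ball_mem_nhds _ (half_pos hε))] with x hx hxq
    rw [Metric.mem_ball]
    have := dist_le_heights x ⟨q, 0, false⟩
    have e : (PrePoint.mk q 0 false).height = 0 := by simp [PrePoint.height]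
    have hxq' : |(x.q : ℝ) - q| < ε / 2 := hxq
    rw [e] at this
    linarith [x.height_le]

end BeadedInterval

open BeadedInterval

/-- The unit interval with a bead of diameter comparable to `2⁻ᵏ` attached at each dyadic number
with denominator `2ᵏ`. -/
abbrev BeadedInterval : Type := SeparationQuotient PrePoint

/-! ### Lengths of paths -/

section Length

variable {X Y : Type*} [PseudoEMetricSpace X] [PseudoEMetricSpace Y]

/-- The radius in `hf` depends on the centre, without uniformity, so partitioning finely is of no
use. Continuous induction works instead: the estimate centred at `t` serves both to arrive at `t`
from the left and to proceed to the right. -/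
theorem edist_le_eVariationOn_of_radial {f : X → Y} {γ : I → X} (hγ : Continuous γ)
    (hf : ∀ x, ∀ᶠ y in 𝓝 x, edist x y ≤ edist (f x) (f y)) {a b : I} (hab : a ≤ b) :
    edist (γ a) (γ b) ≤ eVariationOn (f ∘ γ) (Icc a b) := by
  set P : I → Prop := fun t => edist (γ a) (γ t) ≤ eVariationOn (f ∘ γ) (Icc a t)
  have hloc : ∀ t, ∀ᶠ u in 𝓝 t, edist (γ t) (γ u) ≤ edist (f (γ t)) (f (γ u)) := fun t =>
    hγ.continuousAt.eventually (hf (γ t))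
  have step : ∀ u v, a ≤ u → u ≤ v → P u →
      edist (γ u) (γ v) ≤ edist (f (γ u)) (f (γ v)) → P v := by
    intro u v hau huv hu h
    calc edist (γ a) (γ v) ≤ edist (γ a) (γ u) + edist (γ u) (γ v) := edist_triangle _ _ _
      _ ≤ eVariationOn (f ∘ γ) (Icc a u) + eVariationOn (f ∘ γ) (Icc u v) :=
        add_le_add hu (h.trans (eVariationOn.edist_le (f ∘ γ) (left_mem_Icc.2 huv)
          (right_mem_Icc.2 huv)))
      _ = eVariationOn (f ∘ γ) (Icc a v) := by
        simpa using eVariationOn.Icc_add_Icc (f ∘ γ) (s := univ) hau huv trivial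
  set s : Set I := {t | ∀ u ∈ Icc a t, P u}
  have hPa : P a := by simp [P]
  have hs : b ∈ s := by
    refine IsClosed.mem_of_ge_of_forall_exists_gt (a := a) ?_ ?_ hab ?_
    · refine isClosed_of_closure_subset fun t ht => ?_
      have htI : t ∈ Icc a b := by
        simpa using closure_mono (inter_subset_right : s ∩ Icc a b ⊆ Icc a b) ht
      refine ⟨?_, htI⟩
      have hlt : ∀ u, a ≤ u → u < t → P u := by
        intro u hau hut
        obtain ⟨v, hv, huv⟩ := ((mem_closure_iff_frequently.1 ht).and_eventually
          (lt_mem_nhds hut)).exists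
        exact hv.1 u ⟨hau, huv.le⟩
      intro u hu
      obtain hut | rfl := hu.2.lt_or_eq
      · exact hlt u hu.1 hut
      obtain rfl | hau := hu.1.eq_or_lt
      · exact hPa
      have : (𝓝[<] u).NeBot := nhdsLT_neBot_of_exists_lt ⟨a, hau⟩
      obtain ⟨v, hv, hvu, hav⟩ := (((hloc u).filter_mono nhdsWithin_le_nhds).and
        ((eventually_mem_nhdsWithin (a := u) (s := Iio u)).and
          ((lt_mem_nhds hau).filter_mono nhdsWithin_le_nhds))).exists
      refine step v u hav.le (le_of_lt hvu) (hlt v hav.le hvu) ?_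
      rwa [edist_comm, edist_comm (f (γ v))]
    · intro u hu
      rw [Icc_self, mem_singleton_iff] at hu
      rw [hu]
      exact hPa
    · rintro t ⟨hts, hat, htb⟩
      obtain ⟨c', htc', hcs'⟩ := (mem_nhdsGE_iff_exists_Ico_subset' htb).1
        ((hloc t).filter_mono nhdsWithin_le_nhds)
      obtain ⟨c, htc, hcc⟩ := exists_between (mem_Ioi.1 htc')
      have hcs := (Icc_subset_Ico_right hcc).trans hcs'
      refine ⟨min c b, ?_, lt_min htc htb, min_le_right _ _⟩
      intro u hu
      obtain hut | htu := le_total u t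
      · exact hts u ⟨hu.1, hut⟩
      · exact step t u hat htu (hts t ⟨hat, le_rfl⟩) (hcs ⟨htu, hu.2.trans (min_le_left _ _)⟩)
  exact hs b ⟨hab, le_rfl⟩

/-- A map that does not decrease the distances from each point locally does not decrease the
lengths of paths. -/
theorem eVariationOn_le_comp_of_radial {f : X → Y} {γ : I → X} (hγ : Continuous γ)
    (hf : ∀ x, ∀ᶠ y in 𝓝 x, edist x y ≤ edist (f x) (f y)) :
    eVariationOn γ univ ≤ eVariationOn (f ∘ γ) univ := by
  refine iSup_le fun ⟨n, u, hu, _⟩ => ?_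
  dsimp only
  calc ∑ i ∈ Finset.range n, edist (γ (u (i + 1))) (γ (u i))
      ≤ ∑ i ∈ Finset.range n, eVariationOn (f ∘ γ) (Icc (u i) (u (i + 1))) :=
        Finset.sum_le_sum fun i _ => by
          rw [edist_comm]
          exact edist_le_eVariationOn_of_radial hγ hf (hu i.le_succ)
    _ = eVariationOn (f ∘ γ) (Icc (u 0) (u n)) := eVariationOn.sum' _ hu
    _ ≤ eVariationOn (f ∘ γ) univ := eVariationOn.mono _ (subset_univ _)

end Length

section PathMetric

variable {X : Type*} [MetricSpace X]

/-- The infimum of the lengths of the paths from `x` to `y`. -/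
noncomputable def pathDist (x y : X) : ℝ≥0∞ := ⨅ γ : Path x y, pathLength γ.toContinuousMap

theorem edist_le_pathDist (x y : X) : edist x y ≤ pathDist x y := by
  refine le_iInf fun γ => ?_
  have := eVariationOn.edist_le γ (mem_univ (0 : I)) (mem_univ 1)
  rwa [γ.source, γ.target] at this

theorem pathLength_trans_le {x y z : X} (γ : Path x y) (γ' : Path y z) :
    pathLength (γ.trans γ').toContinuousMap ≤
      pathLength γ.toContinuousMap + pathLength γ'.toContinuousMap := by
  have hh : (1 / 2 : ℝ) ∈ I := by constructor <;> norm_num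
  set h : I := ⟨1 / 2, hh⟩
  have e : pathLength (γ.trans γ').toContinuousMap =
      eVariationOn (γ.trans γ') (Icc 0 h) + eVariationOn (γ.trans γ') (Icc h 1) := by
    have := eVariationOn.Icc_add_Icc (γ.trans γ') (s := univ) (a := 0) (b := h) (c := 1)
      h.2.1 h.2.2 trivial
    simp only [univ_inter] at this
    rw [this, unitInterval.univ_eq_Icc.symm]
    rfl
  rw [e]
  refine add_le_add ?_ ?_
  · have h1 : EqOn (γ.trans γ') (γ ∘ fun t : I => projIcc 0 1 zero_le_one (2 * (t : ℝ)))
        (Icc 0 h) := by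
      intro t ht
      have ht2 : (t : ℝ) ≤ 1 / 2 := ht.2
      rw [Path.trans_apply, dif_pos ht2, Function.comp_apply, projIcc_of_mem]
    rw [eVariationOn.congr h1]
    exact eVariationOn.comp_le_of_monotoneOn _ _ (fun a _ b _ hab =>
      monotone_projIcc _ (mul_le_mul_of_nonneg_left hab zero_le_two)) (mapsTo_univ _ _)
  · have h1 : EqOn (γ.trans γ') (γ' ∘ fun t : I => projIcc 0 1 zero_le_one (2 * (t : ℝ) - 1))
        (Icc h 1) := by
      intro t ht
      have ht2 : 1 / 2 ≤ (t : ℝ) := ht.1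
      -- At time `1 / 2` the concatenation is defined by the first path, and the formula for the
      -- second holds because the paths meet.
      obtain ht3 | ht3 := ht2.eq_or_lt
      · have : t = h := Subtype.ext ht3.symm
        rw [Path.trans_apply, dif_pos ht3.ge, Function.comp_apply]
        have e1 : (⟨2 * (t : ℝ), (unitInterval.mul_pos_mem_iff zero_lt_two).2
          ⟨t.2.1, ht3.ge⟩⟩ : I) = 1 := Subtype.ext (by simp [← ht3])
        rw [e1, γ.target, ← ht3, projIcc_of_le_left _ (by norm_num)]
        exact γ'.source.symm
      · rw [Path.trans_apply, dif_neg (not_le.2 ht3), Function.comp_apply, projIcc_of_mem]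
    rw [eVariationOn.congr h1]
    exact eVariationOn.comp_le_of_monotoneOn _ _ (fun a _ b _ hab =>
      monotone_projIcc _ (sub_le_sub_right (mul_le_mul_of_nonneg_left (show (a : ℝ) ≤ b from hab) zero_le_two) 1))
      (mapsTo_univ _ _)

theorem pathDist_triangle (x y z : X) : pathDist x z ≤ pathDist x y + pathDist y z := by
  refine ENNReal.le_iInf_add_iInf fun γ γ' => ?_
  exact (iInf_le _ (γ.trans γ')).trans (pathLength_trans_le γ γ')

theorem eVariationOn_id_unitInterval : eVariationOn (fun t : I => (t : ℝ)) univ ≤ 1 := by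
  have := MonotoneOn.eVariationOn_eq (f := fun t : I => (t : ℝ)) (s := univ)
    (fun a _ b _ h => h) (mem_univ (0 : I)) (mem_univ 1)
  rw [← unitInterval.univ_eq_Icc, inter_self] at this
  simp [this]

theorem pathDist_le_of_lipschitz {γ : I → X} {K : ℝ≥0} (hγ : LipschitzWith K γ) :
    pathDist (γ 0) (γ 1) ≤ K := by
  refine (iInf_le _ ⟨⟨γ, hγ.continuous⟩, rfl, rfl⟩).trans ?_
  -- Factor the path through the real line, so that its length is at most `K` times the variation of
  -- the inclusion of the interval.
  have h : LipschitzWith K (fun t : ℝ => γ (projIcc 0 1 zero_le_one t)) := by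
    simpa [Function.comp_def] using hγ.comp (LipschitzWith.projIcc (zero_le_one (α := ℝ)))
  have := h.lipschitzOnWith.comp_eVariationOn_le (g := fun t : I => (t : ℝ))
    (mapsTo_univ _ univ)
  have e : (fun t : ℝ => γ (projIcc 0 1 zero_le_one t)) ∘ (fun t : I => (t : ℝ)) = γ := by
    ext t; simp
  rw [e] at this
  refine this.trans ?_
  simpa using mul_le_mul_right eVariationOn_id_unitInterval (K : ℝ≥0∞)

end PathMetric

/-- The segment between two points of the unit interval. -/
noncomputable def unitSegment (a b : I) (t : I) : I :=
  projIcc 0 1 zero_le_one ((a : ℝ) + t * (b - a))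

theorem unitSegment_zero (a b : I) : unitSegment a b 0 = a := by simp [unitSegment]

theorem unitSegment_one (a b : I) : unitSegment a b 1 = b := by simp [unitSegment]

theorem dist_unitSegment_le (a b t u : I) :
    dist (unitSegment a b t) (unitSegment a b u) ≤ dist a b * dist t u := by
  have h := (LipschitzWith.projIcc (zero_le_one (α := ℝ))).dist_le_mul
    ((a : ℝ) + t * (b - a)) ((a : ℝ) + u * (b - a))
  refine h.trans (le_of_eq ?_)
  rw [NNReal.coe_one, one_mul, Real.dist_eq, Subtype.dist_eq, Subtype.dist_eq, Real.dist_eq,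
    Real.dist_eq, abs_sub_comm (a : ℝ), ← abs_mul]
  congr 1
  ring

namespace BeadedInterval

open FatCantor

theorem continuous_q : Continuous PrePoint.q :=
  (LipschitzWith.of_dist_le_mul (K := 1) fun x y => by
    simpa [Subtype.dist_eq, Real.dist_eq] using abs_q_sub_le x y).continuous

theorem edist_mk (x y : PrePoint) :
    edist (SeparationQuotient.mk x) (SeparationQuotient.mk y) = ENNReal.ofReal (dist x y) := by
  rw [SeparationQuotient.edist_mk, edist_dist]

theorem mk_eq_mk_of_dist {x y : PrePoint} (h : dist x y = 0) :
    SeparationQuotient.mk x = SeparationQuotient.mk y :=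
  SeparationQuotient.mk_eq_mk.2 (Metric.inseparable_iff.2 h)

theorem pathDist_sheet_le (q : I) (z w : I × I) (i : Bool) :
    pathDist (SeparationQuotient.mk (PrePoint.mk q z i)) (SeparationQuotient.mk ⟨q, w, i⟩) ≤
      ENNReal.ofReal (dyadicScale q * dist z w) := by
  have h : LipschitzWith (Real.toNNReal (dyadicScale q * dist z w)) (fun t : I =>
      SeparationQuotient.mk (PrePoint.mk q (unitSegment z.1 w.1 t, unitSegment z.2 w.2 t) i)) := by
    refine LipschitzWith.of_dist_le_mul fun t u => ?_
    rw [SeparationQuotient.dist_mk, dist_mk_mk, Real.coe_toNNReal _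
      (mul_nonneg (dyadicScale_nonneg _) dist_nonneg), mul_assoc]
    refine mul_le_mul_of_nonneg_left ?_ (dyadicScale_nonneg _)
    refine max_le ?_ ?_
    · exact (dist_unitSegment_le _ _ _ _).trans
        (mul_le_mul_of_nonneg_right (le_max_left _ _) dist_nonneg)
    · exact (dist_unitSegment_le _ _ _ _).trans
        (mul_le_mul_of_nonneg_right (le_max_right _ _) dist_nonneg)
  have := pathDist_le_of_lipschitz h
  simp only [unitSegment_zero, unitSegment_one] at this
  exact this

theorem pathDist_foot_le (q q' : I) (i i' : Bool) :
    pathDist (SeparationQuotient.mk (PrePoint.mk q 0 i)) (SeparationQuotient.mk ⟨q', 0, i'⟩) ≤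
      ENNReal.ofReal |(q : ℝ) - q'| := by
  have h : LipschitzWith (Real.toNNReal |(q : ℝ) - q'|) (fun t : I =>
      SeparationQuotient.mk (PrePoint.mk (unitSegment q q' t) 0 i)) := by
    refine LipschitzWith.of_dist_le_mul fun t u => ?_
    rw [SeparationQuotient.dist_mk, dist_foot, Real.coe_toNNReal _ (abs_nonneg _)]
    exact dist_unitSegment_le q q' t u
  have := pathDist_le_of_lipschitz h
  simp only [unitSegment_zero, unitSegment_one] at this
  rwa [mk_eq_mk_of_dist (dist_seam (zero_mem_seam q') i i')] at this

/-- Every distance is a sum of legs realised by segments in sheets or in the interval. Between two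
sheets the seam is compact, so the best crossing point is attained. -/
theorem isPathMetricSpace : IsPathMetricSpace BeadedInterval := by
  intro x y
  refine le_antisymm (edist_le_pathDist x y) ?_
  change pathDist x y ≤ edist x y
  obtain ⟨⟨q, z, i⟩, rfl⟩ := SeparationQuotient.surjective_mk x
  obtain ⟨⟨q', w, j⟩, rfl⟩ := SeparationQuotient.surjective_mk y
  rw [edist_mk]
  by_cases hq : q = q'
  · subst hq
    by_cases hij : i = j
    · subst hij
      rw [dist_mk_mk]
      exact pathDist_sheet_le q z w i
    · obtain ⟨c, hc, e⟩ := exists_throughDist_eq (isCompact_seam q) (seam_nonempty q) z w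
      rw [dist_of_eq (x := ⟨q, z, i⟩) (y := ⟨q, w, j⟩) rfl]
      dsimp only
      rw [sheetDist, if_neg hij, e, mul_add,
        ENNReal.ofReal_add (mul_nonneg (dyadicScale_nonneg _) dist_nonneg)
          (mul_nonneg (dyadicScale_nonneg _) dist_nonneg)]
      refine (pathDist_triangle _ (SeparationQuotient.mk ⟨q, c, i⟩) _).trans
        (add_le_add (pathDist_sheet_le q z c i) ?_)
      rw [mk_eq_mk_of_dist (dist_seam hc i j)]
      exact pathDist_sheet_le q c w j
  · rw [dist_of_ne hq, ENNReal.ofReal_add (add_nonneg (PrePoint.height_nonneg _) (abs_nonneg _))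
      (PrePoint.height_nonneg _), ENNReal.ofReal_add (PrePoint.height_nonneg _) (abs_nonneg _)]
    refine (pathDist_triangle _ (SeparationQuotient.mk ⟨q', 0, j⟩) _).trans (add_le_add
      ((pathDist_triangle _ (SeparationQuotient.mk ⟨q, 0, i⟩) _).trans (add_le_add
        (pathDist_sheet_le q z 0 i) (pathDist_foot_le q q' i j))) ?_)
    have := pathDist_sheet_le q' 0 w j
    rwa [dist_comm] at this

instance : PathConnectedSpace BeadedInterval := by
  refine ⟨⟨SeparationQuotient.mk ⟨0, 0, false⟩⟩, fun x y => ?_⟩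
  by_contra h
  have : IsEmpty (Path x y) := not_nonempty_iff.1 h
  have h2 := isPathMetricSpace x y
  rw [iInf_of_isEmpty] at h2
  exact edist_ne_top x y (by simp at h2)

/-! ### The map -/

/-- The tent map on the interval and the identity on beads. -/
noncomputable def preMap (x : PrePoint) : PrePoint := ⟨tent x.q, x.z, x.i⟩

/-- Seams can only grow, and do so at `q = 1` alone; points that are glued stay glued and routes
through the seam survive. -/
theorem seam_subset_seam_tent (q : I) : seam q ⊆ seam (tent q) := by
  by_cases h : q = 0
  · rw [h, tent_zero]
  · rw [seam_of_ne h]; exact cantorSquare_subset_seam _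

theorem tent_ne_zero {q : I} (h0 : q ≠ 0) (h1 : q ≠ 1) : tent q ≠ 0 := by
  intro h
  obtain h2 | h2 := le_total (q : ℝ) (1 / 2)
  · exact h0 (Subtype.ext (by simpa [h] using coe_tent_of_le h2))
  · have := coe_tent_of_ge h2
    rw [h] at this
    rw [Icc.coe_zero] at this
    exact h1 (Subtype.ext (by rw [Icc.coe_one]; linarith))

theorem sheetDist_anti {S : Type*} [PseudoMetricSpace S] {G G' : Set S} (h : G ⊆ G')
    (hG : IsCompact G) (hne : G.Nonempty) (z : S) (i : Bool) (w : S) (j : Bool) :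
    sheetDist G' z i w j ≤ sheetDist G z i w j := by
  unfold sheetDist
  split_ifs
  · exact le_rfl
  · obtain ⟨c, hc, e⟩ := exists_throughDist_eq hG hne z w
    rw [e]
    exact throughDist_le (h hc) z w

theorem height_preMap_le (x : PrePoint) : (preMap x).height ≤ 2 * x.height := by
  rw [PrePoint.height, PrePoint.height, ← mul_assoc]
  exact mul_le_mul_of_nonneg_right (dyadicScale_tent_le _) dist_nonneg

theorem height_le_preMap (x : PrePoint) : x.height ≤ (preMap x).height :=
  mul_le_mul_of_nonneg_right (dyadicScale_le_tent _) dist_nonneg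

theorem dist_preMap_le (x y : PrePoint) : dist (preMap x) (preMap y) ≤ 2 * dist x y := by
  by_cases h : x.q = y.q
  · rw [dist_of_eq h, dist_of_eq (x := preMap x) (y := preMap y) (congrArg tent h), ← mul_assoc]
    refine mul_le_mul (dyadicScale_tent_le _) ?_
      (dist_nonneg.trans (dist_le_sheetDist (seam_nonempty _) _ _ _ _))
      (mul_nonneg zero_le_two (dyadicScale_nonneg _))
    exact sheetDist_anti (seam_subset_seam_tent _) (isCompact_seam _) (seam_nonempty _) _ _ _ _
  · rw [dist_of_ne h]
    have := dist_le_heights (preMap x) (preMap y)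
    have h2 : |((preMap x).q : ℝ) - (preMap y).q| ≤ _ := dist_tent_le x.q y.q
    linarith [height_preMap_le x, height_preMap_le y]

/-- Only the bead at 1 could lose distance, as its image is glued more. But from a point of its
Cantor set both sheets are at planar distance, and near any other of its points there is one sheet
only. Elsewhere the seam is unchanged and the scale does not drop. -/
theorem eventually_dist_le_preMap (x : PrePoint) :
    ∀ᶠ y in 𝓝 x, dist x y ≤ dist (preMap x) (preMap y) := by
  have hb : ∀ᶠ y in 𝓝 x, x.q = 1 → x.z ∉ cantorSquare →
      dist x y < dyadicScale x.q * Metric.infDist x.z cantorSquare := by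
    by_cases h : x.q = 1 ∧ x.z ∉ cantorSquare
    · have : 0 < dyadicScale x.q * Metric.infDist x.z cantorSquare := by
        rw [h.1]
        simp only [Icc.coe_one, dyadicScale_one, one_mul]
        exact (isCompact_cantorSquare.isClosed.notMem_iff_infDist_pos
          ⟨0, zero_mem_cantorSquare⟩).1 h.2
      filter_upwards [Metric.ball_mem_nhds x this] with y hy _ _
      rwa [dist_comm]
    · exact Filter.Eventually.of_forall fun y h1 h2 => absurd ⟨h1, h2⟩ h
  filter_upwards [continuous_q.continuousAt.eventually (eventually_dist_tent x.q), hb] with y hy hb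
  by_cases h : x.q = y.q
  · rw [dist_of_eq (x := preMap x) (y := preMap y) (congrArg tent h)]
    by_cases h0 : x.q = 0
    · rw [dist_of_eq h]
      simp only [preMap, h0, tent_zero, le_refl]
    by_cases h1 : x.q = 1
    · have hd : dist x y = dist x.z y.z := by
        by_cases hz : x.z ∈ cantorSquare
        · rw [dist_of_eq h, h1]
          simp only [Icc.coe_one, dyadicScale_one, one_mul]
          exact sheetDist_of_mem (seam_nonempty _) (cantorSquare_subset_seam _ hz) _ _ _
        · obtain ⟨e, he⟩ := exists_same_sheet (q := x.q) (z := x.z) (i := x.i) (hb h1 hz)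
          have h3 := dist_triangle x ⟨x.q, y.z, x.i⟩ y
          have h4 := dist_triangle x y ⟨x.q, y.z, x.i⟩
          rw [dist_comm y, he] at h4
          rw [he] at h3
          have h5 : dist x ⟨x.q, y.z, x.i⟩ = dyadicScale x.q * dist x.z y.z := dist_mk_mk _ _ _ _
          rw [h1, Icc.coe_one, dyadicScale_one, one_mul, ← h1] at h5
          linarith
      rw [hd]
      simp only [preMap, h1, tent_one, Icc.coe_zero, dyadicScale_zero, one_mul]
      exact dist_le_sheetDist (seam_nonempty _) _ _ _ _
    · rw [dist_of_eq h]
      simp only [preMap]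
      rw [seam_of_ne h0, seam_of_ne (tent_ne_zero h0 h1)]
      exact mul_le_mul_of_nonneg_right (dyadicScale_le_tent _) (dist_nonneg.trans
        (dist_le_sheetDist ⟨0, zero_mem_cantorSquare⟩ _ _ _ _))
  · have hne : (preMap x).q ≠ (preMap y).q := by
      intro he
      have he' : tent x.q = tent y.q := he
      rw [he', sub_self, abs_zero] at hy
      exact h (Subtype.ext (sub_eq_zero.1 (abs_eq_zero.1 (by linarith))))
    rw [dist_of_ne h, dist_of_ne hne]
    have h2 : |((preMap x).q : ℝ) - (preMap y).q| = _ := hy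
    linarith [height_le_preMap x, height_le_preMap y, abs_nonneg ((x.q : ℝ) - y.q)]

/-- Points of the target can be lifted without increasing the distance from a given point. -/
theorem exists_preMap_eq (x y : PrePoint) :
    ∃ v, dist (preMap v) y = 0 ∧ dist x v ≤ dist (preMap x) y := by
  obtain ⟨q, z, i⟩ := x
  obtain ⟨p, w, j⟩ := y
  by_cases hp : tent q = p
  · subst hp
    by_cases h0 : q = 0
    · subst h0
      refine ⟨⟨0, w, j⟩, ?_, ?_⟩ <;> simp [preMap, tent_zero]
    by_cases h1 : q = 1
    · subst h1
      -- In the bead at 0 the label of the sheet is immaterial, so the lift may stay on the sheet of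
      -- `x`, where the distance is planar.
      refine ⟨⟨1, w, i⟩, ?_, ?_⟩
      · exact dist_seam (by rw [tent_one, seam_zero]; trivial) _ _
      · rw [dist_mk_mk, dist_of_eq (x := preMap ⟨1, z, i⟩) (y := ⟨tent 1, w, j⟩) rfl]
        simp only [preMap, tent_one, Icc.coe_zero, Icc.coe_one, dyadicScale_zero, dyadicScale_one,
          one_mul]
        exact dist_le_sheetDist (seam_nonempty _) _ _ _ _
    · refine ⟨⟨q, w, j⟩, dist_self _, ?_⟩
      rw [dist_of_eq (x := ⟨q, z, i⟩) (y := ⟨q, w, j⟩) rfl,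
        dist_of_eq (x := preMap ⟨q, z, i⟩) (y := ⟨tent q, w, j⟩) rfl]
      simp only [preMap]
      rw [seam_of_ne h0, seam_of_ne (tent_ne_zero h0 h1)]
      exact mul_le_mul_of_nonneg_right (dyadicScale_le_tent _) (dist_nonneg.trans
        (dist_le_sheetDist ⟨0, zero_mem_cantorSquare⟩ _ _ _ _))
  · obtain ⟨q', rfl, hd⟩ := exists_tent_eq q p
    refine ⟨⟨q', w, j⟩, dist_self _, ?_⟩
    rw [dist_of_ne (x := preMap ⟨q, z, i⟩) (y := ⟨tent q', w, j⟩) hp]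
    refine (dist_le_heights _ _).trans ?_
    have h1 := height_le_preMap ⟨q, z, i⟩
    have h2 := height_le_preMap ⟨q', w, j⟩
    simp only [preMap] at h1 h2 ⊢
    linarith [abs_nonneg ((q : ℝ) - q')]

/-- The tent map on the interval, extended over the beads. -/
noncomputable def tentMap : BeadedInterval → BeadedInterval :=
  SeparationQuotient.lift (fun x => SeparationQuotient.mk (preMap x)) fun x y h =>
    mk_eq_mk_of_dist (le_antisymm ((dist_preMap_le x y).trans
      (by rw [Metric.inseparable_iff.1 h, mul_zero])) dist_nonneg)

theorem lipschitzWith_tentMap : LipschitzWith 2 tentMap := by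
  refine LipschitzWith.of_dist_le_mul fun x y => ?_
  obtain ⟨x, rfl⟩ := SeparationQuotient.surjective_mk x
  obtain ⟨y, rfl⟩ := SeparationQuotient.surjective_mk y
  exact dist_preMap_le x y

theorem eventually_dist_le_tentMap (x : BeadedInterval) :
    ∀ᶠ y in 𝓝 x, dist x y ≤ dist (tentMap x) (tentMap y) := by
  obtain ⟨x, rfl⟩ := SeparationQuotient.surjective_mk x
  rw [← SeparationQuotient.map_mk_nhds, Filter.eventually_map]
  exact eventually_dist_le_preMap x

theorem exists_tentMap_eq (x y : BeadedInterval) :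
    ∃ v, tentMap v = y ∧ dist x v ≤ dist (tentMap x) y := by
  obtain ⟨x, rfl⟩ := SeparationQuotient.surjective_mk x
  obtain ⟨y, rfl⟩ := SeparationQuotient.surjective_mk y
  obtain ⟨v, hv, h⟩ := exists_preMap_eq x y
  exact ⟨SeparationQuotient.mk v, mk_eq_mk_of_dist hv, h⟩

/-- Lifting without increase of distance puts the ball around `tentMap x` inside the image of the
ball of the same radius around `x`. Points of the fibre close to `x` are at distance 0 from it by
the radial bound. -/
theorem isBranchedCover_tentMap : IsBranchedCover tentMap where
  continuous := lipschitzWith_tentMap.continuous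
  isOpenMap := by
    rw [isOpenMap_iff_nhds_le]
    intro x
    rw [Metric.nhds_basis_ball.map tentMap |>.ge_iff]
    intro ε hε
    filter_upwards [Metric.ball_mem_nhds (tentMap x) hε] with y hy
    obtain ⟨v, hv, hd⟩ := exists_tentMap_eq x y
    rw [Metric.mem_ball, dist_comm] at hy
    exact ⟨v, by rw [Metric.mem_ball, dist_comm]; exact hd.trans_lt hy, hv⟩
  discrete y := by
    refine IsDiscrete.of_nhdsWithin fun x hx => ?_
    rw [Filter.le_pure_iff]
    filter_upwards [nhdsWithin_le_nhds (eventually_dist_le_tentMap x), self_mem_nhdsWithin]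
      with v hv hvy
    rw [mem_preimage, mem_singleton_iff] at hx hvy
    rw [hx, hvy, dist_self] at hv
    exact (dist_le_zero.1 hv).symm

theorem isBLD_tentMap : IsBLD 2 tentMap where
  one_le := one_le_two
  isBranchedCover := isBranchedCover_tentMap
  length_le γ := by
    constructor
    · have h : pathLength γ ≤ eVariationOn (tentMap ∘ γ) univ := by
        refine eVariationOn_le_comp_of_radial γ.continuous fun x => ?_
        filter_upwards [eventually_dist_le_tentMap x] with y hy
        rw [edist_dist, edist_dist]
        exact ENNReal.ofReal_le_ofReal hy
      -- Lengths do not decrease at all; the factor 2 is only needed in the upper bound.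
      refine (mul_le_of_le_one_left zero_le ?_).trans h
      rw [ENNReal.inv_le_one]
      exact_mod_cast one_le_two
    · exact lipschitzWith_tentMap.lipschitzOnWith.comp_eVariationOn_le (mapsTo_univ γ univ)

/-! ### The branch set -/

noncomputable instance : MeasurableSpace BeadedInterval := borel _

instance : BorelSpace BeadedInterval := ⟨rfl⟩

/-- The Cantor set in the bead at `1`. -/
noncomputable def branchParam (a : ℕ → Bool) : BeadedInterval :=
  SeparationQuotient.mk ⟨1, squareParam a, false⟩

theorem dist_mk_one (z w : I × I) (i : Bool) :
    dist (SeparationQuotient.mk (PrePoint.mk 1 z i)) (SeparationQuotient.mk ⟨1, w, i⟩) =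
      dist z w := by
  rw [SeparationQuotient.dist_mk, dist_mk_mk, Icc.coe_one, dyadicScale_one, one_mul]

theorem isometry_mk_one (i : Bool) :
    Isometry fun z : I × I => SeparationQuotient.mk (PrePoint.mk 1 z i) :=
  Isometry.of_dist_eq fun z w => dist_mk_one z w i

theorem isEmbedding_branchParam : IsEmbedding branchParam :=
  (isometry_mk_one false).isEmbedding.comp
    (continuous_squareParam.isClosedEmbedding injective_squareParam).isEmbedding

/-- Arbitrarily close to a Cantor point there are points `w` of the square off the Cantor set; their
two copies in the bead at 1 are distinct and have the same image, so no restriction to a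
neighbourhood is injective. -/
theorem branchParam_mem_branchSet (a : ℕ → Bool) : branchParam a ∈ branchSet tentMap := by
  intro h
  obtain ⟨e, he, hf⟩ := h _ rfl
  obtain ⟨ε, hε, hball⟩ := Metric.isOpen_iff.1 e.open_source _ he
  obtain ⟨w, -, hwC, hw⟩ := exists_notMem_cantorSquare_near (squareParam a) hε
  have hmem : ∀ i, SeparationQuotient.mk (PrePoint.mk 1 w i) ∈ e.source := by
    intro i
    apply hball
    rw [Metric.mem_ball, branchParam, mk_eq_mk_of_dist (dist_seam
      (cantorSquare_subset_seam 1 (mem_range_self a)) false i), dist_mk_one, dist_comm]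
    exact hw
  have himg : tentMap (SeparationQuotient.mk (PrePoint.mk 1 w false)) =
      tentMap (SeparationQuotient.mk (PrePoint.mk 1 w true)) := by
    refine mk_eq_mk_of_dist ?_
    simp only [preMap, tent_one]
    exact dist_seam (by rw [seam_zero]; trivial) _ _
  rw [hf] at himg
  have heq := e.injOn (hmem false) (hmem true) himg
  have hd : dist (PrePoint.mk 1 w false) ⟨1, w, true⟩ = 0 := by
    rw [← SeparationQuotient.dist_mk, heq, dist_self]
  rw [dist_of_eq (x := ⟨1, w, false⟩) (y := ⟨1, w, true⟩) rfl] at hd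
  simp only [Icc.coe_one, dyadicScale_one, one_mul] at hd
  rw [sheetDist, if_neg (by simp), seam_of_ne (by simp)] at hd
  have h1 := infDist_le_throughDist (G := cantorSquare) ⟨0, zero_mem_cantorSquare⟩ w w
  have h2 := (isCompact_cantorSquare.isClosed.notMem_iff_infDist_pos
    ⟨0, zero_mem_cantorSquare⟩).1 hwC
  linarith

end BeadedInterval

/-- By `hK`, `v` factors through a Lipschitz map on the range of `j`. Its image contains the unit
square, and a Lipschitz image of a null set is null. -/
theorem hausdorffMeasure_range_pos_of_dist_le {A X : Type*} [MetricSpace X] [MeasurableSpace X]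
    [BorelSpace X] {j : A → X} {v : A → ℝ × ℝ} {K : ℝ≥0}
    (hK : ∀ a b, dist (v a) (v b) ≤ K * dist (j a) (j b))
    (hv : Icc (0 : ℝ) 1 ×ˢ Icc (0 : ℝ) 1 ⊆ range v) : 0 < (μH[2] : Measure X) (range j) := by
  have h0 : (volume : Measure (ℝ × ℝ)) (Icc (0 : ℝ) 1 ×ˢ Icc (0 : ℝ) 1) = 1 := by
    rw [Measure.volume_eq_prod, Measure.prod_prod]; simp
  obtain ⟨a0, -⟩ := hv (show ((0, 0) : ℝ × ℝ) ∈ _ by simp)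
  have : Nonempty A := ⟨a0⟩
  set g : X → ℝ × ℝ := fun x => v (Function.invFun j x)
  have hinv : ∀ x ∈ range j, j (Function.invFun j x) = x := fun x hx => Function.invFun_eq hx
  have hg : LipschitzOnWith K g (range j) := LipschitzOnWith.of_dist_le_mul fun x hx y hy => by
    have := hK (Function.invFun j x) (Function.invFun j y)
    rwa [hinv x hx, hinv y hy] at this
  have himg : range v ⊆ g '' range j := by
    rintro _ ⟨a, rfl⟩
    refine ⟨j a, mem_range_self a, ?_⟩
    have := hK (Function.invFun j (j a)) a
    rw [hinv _ (mem_range_self a), dist_self, mul_zero] at this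
    exact dist_le_zero.1 this
  have h1 := hg.hausdorffMeasure_image_le (d := 2) zero_le_two
  rw [hausdorffMeasure_prod_real] at h1
  by_contra hc
  rw [not_lt, nonpos_iff_eq_zero] at hc
  rw [hc, mul_zero] at h1
  have := (measure_mono (hv.trans himg)).trans h1
  rw [h0] at this
  exact absurd this (by simp)

namespace BeadedInterval

open FatCantor

theorem hausdorffMeasure_range_branchParam_pos :
    0 < (μH[2] : Measure BeadedInterval) (range branchParam) := by
  refine hausdorffMeasure_range_pos_of_dist_le (v := squareValue) (K := 2) (fun a b => ?_)
    fun y hy => squareValue_surj hy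
  rw [branchParam, branchParam, dist_mk_one]
  exact dist_squareValue_le a b

/-! ### The local cut-point -/

theorem isLocalCutPoint_zero :
    IsLocalCutPoint (SeparationQuotient.mk ⟨0, 0, false⟩ : BeadedInterval) := by
  refine ⟨univ, isOpen_univ, isConnected_univ, trivial, fun h => ?_⟩
  set o : BeadedInterval := SeparationQuotient.mk ⟨0, 0, false⟩
  -- `A` is the bead at 0 without its foot and `B` is everything at places `q > 0`. Both are unions
  -- of balls, hence open: the radii are the distance to the foot and a lower bound for the distance
  -- to the bead at 0.
  set A : Set BeadedInterval :=
    ⋃ z : I × I, Metric.ball (SeparationQuotient.mk ⟨0, z, false⟩) (dist z 0)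
  set B : Set BeadedInterval :=
    ⋃ x : PrePoint, Metric.ball (SeparationQuotient.mk x) (x.q : ℝ)
  have hA : ∀ x : PrePoint, SeparationQuotient.mk x ∈ A → x.q = 0 := by
    intro x hx
    obtain ⟨z, hz⟩ := mem_iUnion.1 hx
    rw [Metric.mem_ball, SeparationQuotient.dist_mk] at hz
    by_contra hne
    rw [dist_comm, dist_of_ne (x := ⟨0, z, false⟩) (Ne.symm hne)] at hz
    have : (PrePoint.mk 0 z false).height = dist z 0 := by
      simp [PrePoint.height, dyadicScale_zero]
    linarith [abs_nonneg (((PrePoint.mk 0 z false).q : ℝ) - x.q), x.height_nonneg]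
  have hB : ∀ x : PrePoint, SeparationQuotient.mk x ∈ B → x.q ≠ 0 := by
    intro x hx h0
    obtain ⟨y, hy⟩ := mem_iUnion.1 hx
    rw [Metric.mem_ball, SeparationQuotient.dist_mk] at hy
    have := abs_q_sub_le x y
    rw [h0, Icc.coe_zero, zero_sub, abs_neg] at this
    linarith [le_abs_self (y.q : ℝ)]
  have hcover : ∀ x : PrePoint, SeparationQuotient.mk x ≠ o →
      SeparationQuotient.mk x ∈ A ∨ SeparationQuotient.mk x ∈ B := by
    rintro ⟨q, z, i⟩ hx
    by_cases hq : q = 0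
    · subst hq
      have e : (SeparationQuotient.mk ⟨0, z, i⟩ : BeadedInterval) =
        SeparationQuotient.mk ⟨0, z, false⟩ :=
        mk_eq_mk_of_dist (dist_seam (by rw [seam_zero]; trivial) _ _)
      rw [e] at hx ⊢
      refine Or.inl (mem_iUnion.2 ⟨z, Metric.mem_ball_self (dist_pos.2 ?_)⟩)
      rintro rfl
      exact hx rfl
    · refine Or.inr (mem_iUnion.2 ⟨⟨q, z, i⟩, Metric.mem_ball_self ?_⟩)
      exact lt_of_le_of_ne q.2.1 fun h => hq (Subtype.ext h.symm)
  have hne : ∀ q : I, (SeparationQuotient.mk ⟨q, 1, false⟩ : BeadedInterval) = o → q ≠ 1 ∧ q ≠ 0 := by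
    intro q hq
    have hd : dist (PrePoint.mk q 1 false) ⟨0, 0, false⟩ = 0 := by
      rw [← SeparationQuotient.dist_mk, hq, dist_self]
    have h1 := abs_q_sub_le ⟨q, 1, false⟩ ⟨0, 0, false⟩
    rw [hd] at h1
    constructor
    · rintro rfl
      norm_num at h1
    · rintro rfl
      rw [dist_mk_mk, Icc.coe_zero, dyadicScale_zero, one_mul] at hd
      have := congrArg Prod.fst (dist_eq_zero.1 hd)
      simp at this
  obtain ⟨x, ⟨-, -⟩, hxA, hxB⟩ := h A B (isOpen_iUnion fun _ => Metric.isOpen_ball)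
    (isOpen_iUnion fun _ => Metric.isOpen_ball) (by
      rintro x ⟨-, hx⟩
      obtain ⟨x, rfl⟩ := SeparationQuotient.surjective_mk x
      exact hcover x hx) (by
      have hx : (SeparationQuotient.mk ⟨0, 1, false⟩ : BeadedInterval) ≠ o := fun h =>
        (hne 0 h).2 rfl
      exact ⟨_, ⟨trivial, hx⟩, (hcover _ hx).resolve_right fun h => hB _ h rfl⟩) (by
      have hx : (SeparationQuotient.mk ⟨1, 1, false⟩ : BeadedInterval) ≠ o := fun h =>
        (hne 1 h).1 rfl
      exact ⟨_, ⟨trivial, hx⟩, (hcover _ hx).resolve_left fun h => by simpa using hA _ h⟩)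
  obtain ⟨x, rfl⟩ := SeparationQuotient.surjective_mk x
  exact hB x hxB (hA x hxA)

end BeadedInterval

namespace BeadedInterval

open FatCantor

/-! ### Coordinates -/

theorem mk_eq_foot {q : I} (h : dyadicScale q = 0) (z : I × I) (i : Bool) :
    (SeparationQuotient.mk ⟨q, z, i⟩ : BeadedInterval) = SeparationQuotient.mk ⟨q, 0, false⟩ := by
  refine mk_eq_mk_of_dist ?_
  rw [dist_of_eq (x := ⟨q, z, i⟩) (y := ⟨q, 0, false⟩) rfl]
  dsimp only
  rw [h, zero_mul]

theorem mk_eq_mk_iff {q q' : I} {z w : I × I} {i j : Bool} (h : 0 < dyadicScale q)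
    (he : (SeparationQuotient.mk ⟨q, z, i⟩ : BeadedInterval) = SeparationQuotient.mk ⟨q', w, j⟩) :
    q = q' ∧ z = w := by
  have hd : dist (PrePoint.mk q z i) ⟨q', w, j⟩ = 0 := by
    rw [← SeparationQuotient.dist_mk, he, dist_self]
  have h1 := abs_q_sub_le ⟨q, z, i⟩ ⟨q', w, j⟩
  rw [hd] at h1
  obtain rfl : q = q' := Subtype.ext (sub_eq_zero.1 (abs_eq_zero.1 (le_antisymm h1 (abs_nonneg _))))
  refine ⟨rfl, ?_⟩
  rw [dist_of_eq (x := ⟨q, z, i⟩) (y := ⟨q, w, j⟩) rfl] at hd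
  have h2 := (mul_eq_zero.1 hd).resolve_left h.ne'
  exact dist_le_zero.1 ((dist_le_sheetDist (seam_nonempty q) z i w j).trans h2.le)

theorem PrePoint.height_eq (x : PrePoint) :
    x.height = max (dyadicScale x.q * x.z.1) (dyadicScale x.q * x.z.2) := by
  rw [PrePoint.height, ← mul_max_of_nonneg _ _ (dyadicScale_nonneg _), Prod.dist_eq]
  have h : ∀ a : I, dist a 0 = a := fun a => by
    rw [Subtype.dist_eq, Real.dist_eq, Icc.coe_zero, sub_zero]
    exact abs_of_nonneg a.2.1
  rw [Prod.fst_zero, Prod.snd_zero, h, h]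

theorem abs_scale_mul_sub_le {g : PrePoint → ℝ} (x y : PrePoint)
    (hx : |g x| ≤ x.height) (hy : |g y| ≤ y.height)
    (h : x.q = y.q → |g x - g y| ≤
      dyadicScale x.q * sheetDist (seam x.q) x.z x.i y.z y.i) :
    |g x - g y| ≤ dist x y := by
  by_cases hq : x.q = y.q
  · rw [dist_of_eq hq]
    exact h hq
  · rw [dist_of_ne hq]
    linarith [abs_sub (g x) (g y), abs_nonneg ((x.q : ℝ) - y.q)]

theorem abs_fst_sub_le (x y : PrePoint) :
    |dyadicScale x.q * x.z.1 - dyadicScale y.q * y.z.1| ≤ dist x y := by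
  have hb : ∀ x : PrePoint, |dyadicScale x.q * x.z.1| ≤ x.height := fun x => by
    rw [abs_of_nonneg (mul_nonneg (dyadicScale_nonneg _) x.z.1.2.1), x.height_eq]
    exact le_max_left _ _
  refine abs_scale_mul_sub_le (g := fun x => dyadicScale x.q * x.z.1) x y (hb x) (hb y) fun h => ?_
  rw [← h, ← mul_sub, abs_mul, abs_of_nonneg (dyadicScale_nonneg _)]
  refine mul_le_mul_of_nonneg_left ?_ (dyadicScale_nonneg _)
  exact (le_max_left _ _).trans (dist_le_sheetDist (seam_nonempty _) _ _ _ _)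

theorem abs_snd_sub_le (x y : PrePoint) :
    |dyadicScale x.q * x.z.2 - dyadicScale y.q * y.z.2| ≤ dist x y := by
  have hb : ∀ x : PrePoint, |dyadicScale x.q * x.z.2| ≤ x.height := fun x => by
    rw [abs_of_nonneg (mul_nonneg (dyadicScale_nonneg _) x.z.2.2.1), x.height_eq]
    exact le_max_right _ _
  refine abs_scale_mul_sub_le (g := fun x => dyadicScale x.q * x.z.2) x y (hb x) (hb y) fun h => ?_
  rw [← h, ← mul_sub, abs_mul, abs_of_nonneg (dyadicScale_nonneg _)]
  refine mul_le_mul_of_nonneg_left ?_ (dyadicScale_nonneg _)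
  exact (le_max_right _ _).trans (dist_le_sheetDist (seam_nonempty _) _ _ _ _)

theorem abs_sheetHeight_scale_sub_le (x y : PrePoint) :
    |dyadicScale x.q * sheetHeight (seam x.q) x.z x.i -
      dyadicScale y.q * sheetHeight (seam y.q) y.z y.i| ≤ dist x y := by
  have hb : ∀ x : PrePoint, |dyadicScale x.q * sheetHeight (seam x.q) x.z x.i| ≤ x.height :=
    fun x => by
      rw [abs_mul, abs_sheetHeight, abs_of_nonneg (dyadicScale_nonneg _), PrePoint.height]
      exact mul_le_mul_of_nonneg_left (Metric.infDist_le_dist_of_mem (zero_mem_seam _))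
        (dyadicScale_nonneg _)
  refine abs_scale_mul_sub_le (g := fun x => dyadicScale x.q * sheetHeight (seam x.q) x.z x.i)
    x y (hb x) (hb y) fun h => ?_
  rw [← h, ← mul_sub, abs_mul, abs_of_nonneg (dyadicScale_nonneg _)]
  exact mul_le_mul_of_nonneg_left (abs_sheetHeight_sub_le (seam_nonempty _) _ _ _ _)
    (dyadicScale_nonneg _)

/-- Within a bead, the planar coordinates bound the planar distance and the signed height tells the
sheets apart. Between beads, one scale is at most `|q - q'| ≤ M`, so one height is at most `M`, the
other at most `2 * M`, and the distance is at most `M + M + 2 * M`. -/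
theorem dist_le_of_coordinates {x y : PrePoint} {M : ℝ} (h0 : |(x.q : ℝ) - y.q| ≤ M)
    (h1 : |dyadicScale x.q * x.z.1 - dyadicScale y.q * y.z.1| ≤ M)
    (h2 : |dyadicScale x.q * x.z.2 - dyadicScale y.q * y.z.2| ≤ M)
    (h3 : |dyadicScale x.q * sheetHeight (seam x.q) x.z x.i -
      dyadicScale y.q * sheetHeight (seam y.q) y.z y.i| ≤ M) : dist x y ≤ 4 * M := by
  have hM := (abs_nonneg _).trans h0
  by_cases hq : x.q = y.q
  · rw [← hq, ← mul_sub, abs_mul, abs_of_nonneg (dyadicScale_nonneg _)] at h1 h2 h3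
    have hd : dyadicScale x.q * dist x.z y.z ≤ M := by
      rw [Prod.dist_eq, mul_max_of_nonneg _ _ (dyadicScale_nonneg _)]
      exact max_le h1 h2
    rw [dist_of_eq hq]
    have := mul_le_mul_of_nonneg_left (sheetDist_le_dist_add (isCompact_seam x.q)
      (seam_nonempty x.q) x.z x.i y.z y.i) (dyadicScale_nonneg x.q)
    linarith
  · have hne : (x.q : ℝ) ≠ y.q := fun h => hq (Subtype.ext h)
    have hmin := (min_dyadicScale_le hne).trans h0
    have hh : |x.height - y.height| ≤ M := by
      rw [x.height_eq, y.height_eq]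
      exact (abs_max_sub_max_le_max _ _ _ _).trans (max_le h1 h2)
    rw [dist_of_ne hq]
    have := abs_le.1 hh
    obtain h | h := min_le_iff.1 hmin
    · linarith [x.height_le]
    · linarith [y.height_le]

/-- The position of a point in its bead, scaled. -/
noncomputable def planar : BeadedInterval → ℝ × ℝ :=
  SeparationQuotient.lift (fun x : PrePoint => (dyadicScale x.q * x.z.1, dyadicScale x.q * x.z.2))
    fun x y h => by
      have h' := Metric.inseparable_iff.1 h
      have h1 := abs_fst_sub_le x y
      have h2 := abs_snd_sub_le x y
      rw [h'] at h1 h2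
      exact Prod.ext (sub_eq_zero.1 (abs_eq_zero.1 (le_antisymm h1 (abs_nonneg _))))
        (sub_eq_zero.1 (abs_eq_zero.1 (le_antisymm h2 (abs_nonneg _))))

theorem planar_mk (x : PrePoint) :
    planar (SeparationQuotient.mk x) = (dyadicScale x.q * x.z.1, dyadicScale x.q * x.z.2) := rfl

theorem lipschitzWith_planar : LipschitzWith 1 planar := by
  refine LipschitzWith.of_dist_le_mul fun x y => ?_
  obtain ⟨x, rfl⟩ := SeparationQuotient.surjective_mk x
  obtain ⟨y, rfl⟩ := SeparationQuotient.surjective_mk y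
  rw [NNReal.coe_one, one_mul, SeparationQuotient.dist_mk]
  exact max_le (abs_fst_sub_le x y) (abs_snd_sub_le x y)

/-! ### The bilipschitz embedding -/

/-- The bilipschitz embedding in space, on representatives. -/
noncomputable def preEmbed (x : PrePoint) : EuclideanSpace ℝ (Fin 4) :=
  !₂[(x.q : ℝ), dyadicScale x.q * x.z.1, dyadicScale x.q * x.z.2,
    dyadicScale x.q * sheetHeight (seam x.q) x.z x.i]

theorem dist_preEmbed_le (x y : PrePoint) : dist (preEmbed x) (preEmbed y) ≤ 2 * dist x y := by
  rw [EuclideanSpace.dist_eq, Real.sqrt_le_left (by positivity), Fin.sum_univ_four]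
  have h : ∀ {a b : ℝ}, |a - b| ≤ dist x y → dist a b ^ 2 ≤ dist x y ^ 2 := fun h =>
    pow_le_pow_left₀ dist_nonneg h 2
  have h0 := h (abs_q_sub_le x y)
  have h1 := h (abs_fst_sub_le x y)
  have h2 := h (abs_snd_sub_le x y)
  have h3 := h (abs_sheetHeight_scale_sub_le x y)
  simp only [preEmbed, PiLp.toLp_apply, Matrix.cons_val]
  linarith

theorem dist_le_preEmbed (x y : PrePoint) : dist x y ≤ 4 * dist (preEmbed x) (preEmbed y) := by
  have h : ∀ k, |preEmbed x k - preEmbed y k| ≤ dist (preEmbed x) (preEmbed y) := fun k => by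
    rw [dist_eq_norm]
    exact PiLp.norm_apply_le (preEmbed x - preEmbed y) k
  exact dist_le_of_coordinates (h 0) (h 1) (h 2) (h 3)

theorem isLocallyBilipschitzEmbeddable : IsLocallyBilipschitzEmbeddable BeadedInterval := by
  intro x
  have hlift : ∀ x y : PrePoint, Inseparable x y → preEmbed x = preEmbed y := fun x y h =>
    dist_le_zero.1 ((dist_preEmbed_le x y).trans (by rw [Metric.inseparable_iff.1 h, mul_zero]))
  refine ⟨univ, Filter.univ_mem, 4, fun y => SeparationQuotient.lift preEmbed hlift y.1, 2, 4,
    LipschitzWith.of_dist_le_mul ?_, AntilipschitzWith.of_le_mul_dist ?_⟩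
  all_goals
    rintro ⟨x, -⟩ ⟨y, -⟩
    obtain ⟨x, rfl⟩ := SeparationQuotient.surjective_mk x
    obtain ⟨y, rfl⟩ := SeparationQuotient.surjective_mk y
  · exact dist_preEmbed_le x y
  · exact dist_le_preEmbed x y

/-! ### Rectifiability -/

/-- The nearest point of the unit square, coordinate by coordinate. -/
noncomputable def toSquare (v : EuclideanSpace ℝ (Fin 2)) : I × I :=
  (projIcc 0 1 zero_le_one (v 0), projIcc 0 1 zero_le_one (v 1))

theorem dist_toSquare_le (v w : EuclideanSpace ℝ (Fin 2)) :
    dist (toSquare v) (toSquare w) ≤ dist v w := by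
  have h : ∀ k, dist (projIcc (0 : ℝ) 1 zero_le_one (v k)) (projIcc 0 1 zero_le_one (w k)) ≤
      dist v w := fun k => by
    refine ((LipschitzWith.projIcc (zero_le_one (α := ℝ))).dist_le_mul _ _).trans ?_
    rw [NNReal.coe_one, one_mul, dist_eq_norm v w]
    exact PiLp.norm_apply_le (v - w) k
  exact max_le (h 0) (h 1)

theorem toSquare_coe (z : I × I) : toSquare !₂[(z.1 : ℝ), (z.2 : ℝ)] = z := by
  simp [toSquare]

theorem isRectifiableSpace : IsRectifiableSpace 2 BeadedInterval := by
  -- The index `none` stands for the interval and `some ((k, m), i)` for sheet `i` of the bead at `m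
  -- / 2 ^ k`. Together they cover the whole space, since a bead at a non-dyadic place is a point.
  obtain ⟨s, hs⟩ := exists_surjective_nat (Option ((ℕ × ℤ) × Bool))
  let g : Option ((ℕ × ℤ) × Bool) → EuclideanSpace ℝ (Fin 2) → PrePoint
    | none => fun v => ⟨(toSquare v).1, 0, false⟩
    | some ((k, m), i) => fun v => ⟨projIcc 0 1 zero_le_one ((m : ℝ) / 2 ^ k), toSquare v, i⟩
  have hg : ∀ o v w, dist (g o v) (g o w) ≤ dist v w := by
    rintro (_ | ⟨⟨k, m⟩, i⟩) v w
    · simp only [g]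
      rw [dist_foot]
      exact (le_max_left _ _).trans (dist_toSquare_le v w)
    · simp only [g]
      rw [dist_mk_mk]
      exact (mul_le_of_le_one_left dist_nonneg (dyadicScale_le_one _)).trans (dist_toSquare_le v w)
  refine ⟨fun _ => univ, fun n v => SeparationQuotient.mk (g (s n) v), fun _ => 1,
    fun n => LipschitzOnWith.of_dist_le_mul fun v _ w _ => by
      rw [NNReal.coe_one, one_mul]; exact hg (s n) v w, ?_⟩
  have hcov : (⋃ n, (fun v => (SeparationQuotient.mk (g (s n) v) : BeadedInterval)) '' univ) =
      univ := by
    refine eq_univ_of_forall fun x => ?_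
    obtain ⟨⟨q, z, i⟩, rfl⟩ := SeparationQuotient.surjective_mk x
    obtain h | ⟨k, -, m, hm⟩ := dyadicScale_eq_zero_or q
    · obtain ⟨n, hn⟩ := hs none
      refine mem_iUnion.2 ⟨n, !₂[(q : ℝ), (0 : ℝ)], trivial, ?_⟩
      rw [hn, mk_eq_foot h]
      simp [g, toSquare]
    · obtain ⟨n, hn⟩ := hs (some ((k, m), i))
      refine mem_iUnion.2 ⟨n, !₂[(z.1 : ℝ), (z.2 : ℝ)], trivial, ?_⟩
      rw [hn]
      simp only [g]
      rw [toSquare_coe, ← hm, mul_div_cancel_right₀ _ (by positivity), projIcc_val]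
  rw [hcov, compl_univ, measure_empty]

/-! ### The manifold part -/

/-- The set of points in the interior of a sheet, off the seam. -/
def manifoldPart : Set BeadedInterval :=
  {x | ∃ q z i, 0 < dyadicScale (q : I) ∧ z ∈ openSquare ∧ z ∉ cantorSquare ∧
    x = SeparationQuotient.mk ⟨q, z, i⟩}

theorem exists_eq_mk_of_dist_lt {q : I} {z : I × I} {i : Bool} {y : BeadedInterval}
    (h : dist (SeparationQuotient.mk ⟨q, z, i⟩) y <
      dyadicScale q * Metric.infDist z cantorSquare) :
    ∃ w, y = SeparationQuotient.mk ⟨q, w, i⟩ := by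
  obtain ⟨y, rfl⟩ := SeparationQuotient.surjective_mk y
  obtain ⟨-, h2⟩ := exists_same_sheet (q := q) (z := z) (i := i) h
  exact ⟨y.z, (mk_eq_mk_of_dist h2).symm⟩

theorem infDist_cantorSquare_pos {z : I × I} (hz : z ∉ cantorSquare) :
    0 < Metric.infDist z cantorSquare :=
  (isCompact_cantorSquare.isClosed.notMem_iff_infDist_pos ⟨0, zero_mem_cantorSquare⟩).1 hz

theorem isOpen_image_sheet {q : I} (hq : 0 < dyadicScale q) (i : Bool) {O : Set (I × I)}
    (hO : IsOpen O) (hOC : Disjoint O cantorSquare) :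
    IsOpen ((fun z => (SeparationQuotient.mk ⟨q, z, i⟩ : BeadedInterval)) '' O) := by
  rw [Metric.isOpen_iff]
  rintro _ ⟨z, hz, rfl⟩
  obtain ⟨ε, hε, hball⟩ := Metric.isOpen_iff.1 hO z hz
  refine ⟨min (dyadicScale q * Metric.infDist z cantorSquare) (dyadicScale q * ε),
    lt_min (mul_pos hq (infDist_cantorSquare_pos (disjoint_left.1 hOC hz))) (mul_pos hq hε),
    fun y hy => ?_⟩
  rw [Metric.mem_ball, dist_comm] at hy
  obtain ⟨w, rfl⟩ := exists_eq_mk_of_dist_lt (hy.trans_le (min_le_left _ _))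
  refine ⟨w, hball ?_, rfl⟩
  have := hy.trans_le (min_le_right _ _)
  rw [SeparationQuotient.dist_mk, dist_mk_mk] at this
  rw [Metric.mem_ball, dist_comm]
  exact lt_of_mul_lt_mul_left this hq.le

theorem isEmbedding_sheet {q : I} (hq : 0 < dyadicScale q) (i : Bool) :
    IsEmbedding fun z : I × I => (SeparationQuotient.mk ⟨q, z, i⟩ : BeadedInterval) := by
  have h1 : LipschitzWith 1 fun z : I × I =>
      (SeparationQuotient.mk ⟨q, z, i⟩ : BeadedInterval) :=
    LipschitzWith.of_dist_le_mul fun z w => by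
      rw [SeparationQuotient.dist_mk, dist_mk_mk, NNReal.coe_one]
      exact mul_le_mul_of_nonneg_right (dyadicScale_le_one _) dist_nonneg
  refine (h1.continuous.isClosedEmbedding fun z w h => ?_).isEmbedding
  exact (mk_eq_mk_iff hq h).2

theorem isOpen_manifoldPart : IsOpen manifoldPart := by
  have : manifoldPart = ⋃ (q : I) (_ : 0 < dyadicScale q) (i : Bool),
      (fun z => (SeparationQuotient.mk ⟨q, z, i⟩ : BeadedInterval)) ''
        (openSquare \ cantorSquare) := by
    ext x
    simp only [manifoldPart, mem_ofPred_eq, mem_iUnion, mem_image, mem_sdiff]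
    constructor
    · rintro ⟨q, z, i, hq, hz, hC, rfl⟩
      exact ⟨q, hq, i, z, ⟨hz, hC⟩, rfl⟩
    · rintro ⟨q, hq, i, z, ⟨hz, hC⟩, rfl⟩
      exact ⟨q, z, i, hq, hz, hC, rfl⟩
  rw [this]
  exact isOpen_iUnion fun q => isOpen_iUnion fun hq => isOpen_iUnion fun i =>
    isOpen_image_sheet hq i (isOpen_openSquare.sdiff isCompact_cantorSquare.isClosed)
      disjoint_sdiff_left

/-- Dyadic numbers of scale comparable to `ε` exist within distance `ε`. -/
theorem exists_dyadic_near (q : I) {k : ℕ} :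
    ∃ q' : I, |(q : ℝ) - q'| ≤ (1 / 2) ^ k ∧ (1 / 2) ^ k ≤ dyadicScale q' := by
  have hp : (0 : ℝ) < 2 ^ k := by positivity
  have h0 : (0 : ℝ) ≤ q * 2 ^ k := mul_nonneg q.2.1 hp.le
  have hle := Nat.floor_le h0
  refine ⟨⟨⌊(q : ℝ) * 2 ^ k⌋₊ / 2 ^ k, by positivity, ?_⟩, ?_, pow_le_dyadicScale_iff.2
    ⟨⌊(q : ℝ) * 2 ^ k⌋₊, by simp [div_mul_cancel₀ _ hp.ne']⟩⟩
  · rw [div_le_one hp]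
    exact hle.trans (mul_le_of_le_one_left hp.le q.2.2)
  · have e : (q : ℝ) - ⌊(q : ℝ) * 2 ^ k⌋₊ / 2 ^ k =
        (q * 2 ^ k - ⌊(q : ℝ) * 2 ^ k⌋₊) / 2 ^ k := by field_simp
    dsimp only
    rw [e, abs_of_nonneg (div_nonneg (sub_nonneg.2 hle) hp.le), div_pow, one_pow]
    gcongr
    linarith [Nat.lt_floor_add_one ((q : ℝ) * 2 ^ k)]

/-- A point of a nondegenerate bead is approximated within its sheet; any other point is
approximated by feet of beads at nearby dyadic places. -/
theorem dense_manifoldPart : Dense manifoldPart := by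
  have key : ∀ (q : I) (z : I × I) (i : Bool) (ε : ℝ), 0 < ε → 0 < dyadicScale q →
      ∃ x ∈ manifoldPart, dist (SeparationQuotient.mk ⟨q, z, i⟩) x < ε := by
    intro q z i ε hε hq
    obtain ⟨w, hw, hwC, hd⟩ := exists_notMem_cantorSquare_near z hε
    refine ⟨_, ⟨q, w, i, hq, hw, hwC, rfl⟩, ?_⟩
    rw [SeparationQuotient.dist_mk, dist_mk_mk]
    exact (mul_le_of_le_one_left dist_nonneg (dyadicScale_le_one _)).trans_lt hd
  refine Metric.dense_iff.2 fun x ε hε => ?_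
  obtain ⟨⟨q, z, i⟩, rfl⟩ := SeparationQuotient.surjective_mk x
  obtain hq | hq := (dyadicScale_nonneg q).eq_or_lt
  · obtain ⟨k, hk⟩ := exists_pow_lt_of_lt_one (half_pos hε) (by norm_num : (1 / 2 : ℝ) < 1)
    obtain ⟨q', hq', hs⟩ := exists_dyadic_near q (k := k)
    obtain ⟨x, hx, hd⟩ := key q' 0 false (ε / 2) (half_pos hε)
      (lt_of_lt_of_le (by positivity) hs)
    refine ⟨x, ?_, hx⟩
    rw [mk_eq_foot hq.symm, Metric.mem_ball, dist_comm]
    have h1 := dist_triangle (SeparationQuotient.mk ⟨q, 0, false⟩ : BeadedInterval)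
      (SeparationQuotient.mk ⟨q', 0, false⟩) x
    rw [SeparationQuotient.dist_mk, dist_foot] at h1
    linarith
  · obtain ⟨x, hx, hd⟩ := key q z i ε hε hq
    exact ⟨x, by rwa [Metric.mem_ball, dist_comm], hx⟩

end BeadedInterval

theorem nonempty_chartedSpace {H M : Type*} [TopologicalSpace H] [TopologicalSpace M]
    (h : ∀ x : M, ∃ e : OpenPartialHomeomorph M H, x ∈ e.source) : Nonempty (ChartedSpace H M) := by
  choose e he using h
  exact ⟨{ atlas := univ, chartAt := e, mem_chart_source := he, chart_mem_atlas := fun _ => trivial }⟩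

namespace BeadedInterval

open FatCantor

/-- The inclusion of the open square in the Euclidean plane. -/
noncomputable def toPlane (z : ↥(openSquare \ cantorSquare)) : EuclideanSpace ℝ (Fin 2) :=
  !₂[(z.1.1 : ℝ), (z.1.2 : ℝ)]

theorem continuous_toSquare : Continuous toSquare :=
  (LipschitzWith.of_dist_le_mul (K := 1) fun v w => by
    simpa using dist_toSquare_le v w).continuous

theorem isOpenEmbedding_toPlane : IsOpenEmbedding toPlane := by
  refine ⟨IsEmbedding.of_comp ?_ continuous_toSquare ?_, ?_⟩
  · unfold toPlane
    refine (PiLp.continuous_toLp 2 _).comp (continuous_pi fun k => ?_)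
    fin_cases k
    · exact continuous_subtype_val.comp (continuous_fst.comp continuous_subtype_val)
    · exact continuous_subtype_val.comp (continuous_snd.comp continuous_subtype_val)
  · have : toSquare ∘ toPlane = Subtype.val := funext fun z => toSquare_coe z.1
    rw [this]
    exact IsEmbedding.subtypeVal
  · have : range toPlane = {v | v 0 ∈ Ioo (0 : ℝ) 1} ∩ {v | v 1 ∈ Ioo (0 : ℝ) 1} ∩
        toSquare ⁻¹' cantorSquareᶜ := by
      ext v
      constructor
      · rintro ⟨z, rfl⟩
        refine ⟨⟨z.2.1.1, z.2.1.2⟩, ?_⟩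
        rw [mem_preimage, toPlane, toSquare_coe]
        exact z.2.2
      · rintro ⟨⟨h0, h1⟩, hC⟩
        have e : toSquare v = (⟨v 0, Ioo_subset_Icc_self h0⟩, ⟨v 1, Ioo_subset_Icc_self h1⟩) :=
          Prod.ext (projIcc_of_mem zero_le_one (Ioo_subset_Icc_self h0))
            (projIcc_of_mem zero_le_one (Ioo_subset_Icc_self h1))
        refine ⟨⟨toSquare v, ?_, hC⟩, ?_⟩
        · rw [e]; exact ⟨h0, h1⟩
        · ext k
          simp only [toPlane, e]
          fin_cases k <;> rfl
    rw [this]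
    have hc : ∀ k : Fin 2, Continuous fun v : EuclideanSpace ℝ (Fin 2) => v k := fun k => by
      fun_prop
    exact ((isOpen_Ioo.preimage (hc 0)).inter (isOpen_Ioo.preimage (hc 1))).inter
      (isCompact_cantorSquare.isClosed.isOpen_compl.preimage continuous_toSquare)

theorem nonempty_chartedSpace_manifoldPart :
    Nonempty (ChartedSpace (EuclideanSpace ℝ (Fin 2)) manifoldPart) := by
  refine nonempty_chartedSpace ?_
  rintro ⟨_, q, z, i, hq, hz, hC, rfl⟩
  let h : ↥(openSquare \ cantorSquare) → manifoldPart := fun w =>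
    ⟨SeparationQuotient.mk ⟨q, w, i⟩, q, w, i, hq, w.2.1, w.2.2, rfl⟩
  have hemb : IsEmbedding (Subtype.val ∘ h) := (isEmbedding_sheet hq i).comp IsEmbedding.subtypeVal
  have hopen : IsOpenEmbedding h := by
    refine ⟨IsEmbedding.of_comp (hemb.continuous.subtype_mk _) continuous_subtype_val hemb, ?_⟩
    have : range h = Subtype.val ⁻¹'
        ((fun z => (SeparationQuotient.mk ⟨q, z, i⟩ : BeadedInterval)) ''
          (openSquare \ cantorSquare)) := by
      ext x
      constructor
      · rintro ⟨w, rfl⟩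
        exact ⟨w, w.2, rfl⟩
      · rintro ⟨w, hw, he⟩
        exact ⟨⟨w, hw⟩, Subtype.ext he⟩
    rw [this]
    exact (isOpen_image_sheet hq i (isOpen_openSquare.sdiff isCompact_cantorSquare.isClosed)
      disjoint_sdiff_left).preimage continuous_subtype_val
  have : Nonempty ↥(openSquare \ cantorSquare) := ⟨⟨z, hz, hC⟩⟩
  -- The chart leads from the sheet back to the punctured square and on to the plane.
  refine ⟨(hopen.toOpenPartialHomeomorph h).symm.trans
    (isOpenEmbedding_toPlane.toOpenPartialHomeomorph toPlane), ?_⟩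
  rw [OpenPartialHomeomorph.trans_source]
  simp only [OpenPartialHomeomorph.symm_source, IsOpenEmbedding.toOpenPartialHomeomorph_target,
    IsOpenEmbedding.toOpenPartialHomeomorph_source, preimage_univ, inter_univ]
  exact ⟨⟨z, hz, hC⟩, rfl⟩

end BeadedInterval

namespace BeadedInterval

open FatCantor

/-! ### Ahlfors regularity -/

/-- The inclusion of the unit square in the plane. -/
def squareCoe (z : I × I) : ℝ × ℝ := (z.1, z.2)

theorem isometry_squareCoe : Isometry squareCoe := Isometry.of_dist_eq fun _ _ => rfl

theorem hausdorffMeasure_sheet_le (q : I) (i : Bool) (A : Set (I × I)) :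
    (μH[2] : Measure BeadedInterval) ((fun z => SeparationQuotient.mk ⟨q, z, i⟩) '' A) ≤
      ENNReal.ofReal (dyadicScale q) ^ 2 * volume (squareCoe '' A) := by
  have h : LipschitzWith (dyadicScale q).toNNReal fun z : I × I =>
      (SeparationQuotient.mk ⟨q, z, i⟩ : BeadedInterval) :=
    LipschitzWith.of_dist_le_mul fun z w => by
      rw [SeparationQuotient.dist_mk, dist_mk_mk, Real.coe_toNNReal _ (dyadicScale_nonneg _)]
  have h2 := h.hausdorffMeasure_image_le (d := 2) zero_le_two A
  rw [← hausdorffMeasure_prod_real, isometry_squareCoe.hausdorffMeasure_image (Or.inl zero_le_two)]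
  simpa [ENNReal.ofReal] using h2

theorem hausdorffMeasure_sheet_le_sq (q : I) (i : Bool) :
    (μH[2] : Measure BeadedInterval) (range fun z => SeparationQuotient.mk ⟨q, z, i⟩) ≤
      ENNReal.ofReal (dyadicScale q ^ 2) := by
  rw [← image_univ]
  refine (hausdorffMeasure_sheet_le q i univ).trans ?_
  have h : volume (squareCoe '' univ) ≤ 1 := by
    refine (measure_mono (t := Icc 0 1 ×ˢ Icc 0 1) ?_).trans_eq ?_
    · rintro _ ⟨z, -, rfl⟩
      exact ⟨z.1.2, z.2.2⟩
    · rw [Measure.volume_eq_prod, Measure.prod_prod]; simp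
  rw [ENNReal.ofReal_pow (dyadicScale_nonneg _)]
  exact mul_le_of_le_one_right zero_le h

/-- In the coordinates of the sheet, the ball lies in a planar ball of radius `r / dyadicScale q`,
centred at the position of `x` if `x` lies in the same bead and at the foot otherwise. In the
maximum metric this is a square of side `2 * r / dyadicScale q`, and scaling back gives `4 * r ^ 2`.
-/
theorem hausdorffMeasure_sheet_inter_ball_le (q : I) (i : Bool) (x : BeadedInterval) {r : ℝ}
    (hr : 0 < r) :
    (μH[2] : Measure BeadedInterval)
      ((range fun z => SeparationQuotient.mk ⟨q, z, i⟩) ∩ Metric.ball x r) ≤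
      ENNReal.ofReal (4 * r ^ 2) := by
  obtain ⟨⟨q', w, j⟩, rfl⟩ := SeparationQuotient.surjective_mk x
  obtain ⟨z₀, hz₀⟩ : ∃ z₀ : I × I, ∀ z,
      (SeparationQuotient.mk ⟨q, z, i⟩ : BeadedInterval) ∈
        Metric.ball (SeparationQuotient.mk ⟨q', w, j⟩) r → dyadicScale q * dist z z₀ < r := by
    by_cases hq : q = q'
    · subst hq
      refine ⟨w, fun z hz => ?_⟩
      rw [Metric.mem_ball, SeparationQuotient.dist_mk,
        dist_of_eq (x := ⟨q, z, i⟩) (y := ⟨q, w, j⟩) rfl] at hz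
      exact (mul_le_mul_of_nonneg_left (dist_le_sheetDist (seam_nonempty _) _ _ _ _)
        (dyadicScale_nonneg _)).trans_lt hz
    · refine ⟨0, fun z hz => ?_⟩
      rw [Metric.mem_ball, SeparationQuotient.dist_mk,
        dist_of_ne (x := ⟨q, z, i⟩) (y := ⟨q', w, j⟩) hq] at hz
      have : (PrePoint.mk q z i).height = dyadicScale q * dist z 0 := rfl
      rw [← this]
      linarith [abs_nonneg (((PrePoint.mk q z i).q : ℝ) - (PrePoint.mk q' w j).q),
        (PrePoint.mk q' w j).height_nonneg]
  set A : Set (I × I) := {z | dyadicScale q * dist z z₀ < r}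
  have hsub : (range fun z => (SeparationQuotient.mk ⟨q, z, i⟩ : BeadedInterval)) ∩
      Metric.ball (SeparationQuotient.mk ⟨q', w, j⟩) r ⊆
        (fun z => SeparationQuotient.mk ⟨q, z, i⟩) '' A := by
    rintro _ ⟨⟨z, rfl⟩, hz⟩
    exact ⟨z, hz₀ z hz, rfl⟩
  refine (measure_mono hsub).trans ((hausdorffMeasure_sheet_le q i A).trans ?_)
  obtain h0 | h0 := (dyadicScale_nonneg q).eq_or_lt
  · rw [← h0]; simp
  have hA : squareCoe '' A ⊆ Metric.ball (squareCoe z₀) (r / dyadicScale q) := by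
    rintro _ ⟨z, hz, rfl⟩
    rw [Metric.mem_ball, isometry_squareCoe.dist_eq, lt_div_iff₀ h0, mul_comm]
    exact hz
  have hvol : volume (Metric.ball (squareCoe z₀) (r / dyadicScale q)) =
      ENNReal.ofReal (2 * (r / dyadicScale q)) ^ 2 := by
    rw [← ball_prod_same, Measure.volume_eq_prod, Measure.prod_prod, Real.volume_ball,
      Real.volume_ball, sq]
  refine (mul_le_mul_right ((measure_mono hA).trans_eq hvol) _).trans (le_of_eq ?_)
  rw [← mul_pow, ← ENNReal.ofReal_mul h0.le, ← ENNReal.ofReal_pow (by positivity)]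
  congr 1
  field_simp
  ring

/-- The interval without its beads. -/
def spine : Set BeadedInterval := range fun q : I => SeparationQuotient.mk ⟨q, 0, false⟩

/-- The feet form an isometric copy of the unit interval, whose one-dimensional measure is finite.
-/
theorem hausdorffMeasure_spine : (μH[2] : Measure BeadedInterval) spine = 0 := by
  have h1 : Isometry fun q : I => (SeparationQuotient.mk ⟨q, 0, false⟩ : BeadedInterval) :=
    Isometry.of_dist_eq fun q q' => by
      rw [SeparationQuotient.dist_mk, dist_foot]; rfl
  rw [spine, ← image_univ, h1.hausdorffMeasure_image (Or.inl zero_le_two),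
    ← (isometry_subtype_coe (s := I)).hausdorffMeasure_image (Or.inl zero_le_two)]
  refine (Measure.hausdorffMeasure_zero_or_top (one_lt_two (α := ℝ)) _).resolve_right fun h => ?_
  rw [hausdorffMeasure_real, image_univ, Subtype.range_coe] at h
  simp at h

theorem exists_finset_dyadic (q : I) (k : ℕ) {r : ℝ} (hr : 0 < r) :
    ∃ T : Finset I, (T.card : ℝ) ≤ 2 * r * 2 ^ k + 1 ∧
      ∀ q' : I, IsDyadicAt k q' → |(q' : ℝ) - q| < r → q' ∈ T := by
  classical
  have hp : (0 : ℝ) < 2 ^ k := by positivity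
  refine ⟨(Finset.Icc ⌈((q : ℝ) - r) * 2 ^ k⌉ ⌊((q : ℝ) + r) * 2 ^ k⌋).image
    fun m : ℤ => projIcc 0 1 zero_le_one ((m : ℝ) / 2 ^ k), ?_, ?_⟩
  · refine (Nat.cast_le.2 Finset.card_image_le).trans ?_
    rw [Int.card_Icc]
    have h1 := Int.floor_le (((q : ℝ) + r) * 2 ^ k)
    have h2 := Int.le_ceil (((q : ℝ) - r) * 2 ^ k)
    have h3 : (((⌊((q : ℝ) + r) * 2 ^ k⌋ + 1 - ⌈((q : ℝ) - r) * 2 ^ k⌉).toNat : ℤ) : ℝ) ≤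
        2 * r * 2 ^ k + 1 := by
      rw [Int.toNat_eq_max, Int.cast_max]
      refine max_le ?_ (by push_cast; positivity)
      push_cast
      linarith
    exact_mod_cast h3
  · rintro q' ⟨m, hm⟩ hq'
    rw [abs_lt] at hq'
    refine Finset.mem_image.2 ⟨m, Finset.mem_Icc.2 ⟨Int.ceil_le.2 ?_, Int.le_floor.2 ?_⟩, ?_⟩
    · rw [← hm]; exact mul_le_mul_of_nonneg_right (by linarith) hp.le
    · rw [← hm]; exact mul_le_mul_of_nonneg_right (by linarith) hp.le
    · rw [← hm, mul_div_cancel_right₀ _ hp.ne', projIcc_val]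

theorem measure_biUnion_beads_le {X : Type*} [MeasurableSpace X] (μ : Measure X) (T : Finset I)
    (S : I → Bool → Set X) {c n : ℝ} (hc : 0 ≤ c)
    (hT : (T.card : ℝ) ≤ n) (hS : ∀ q ∈ T, ∀ i, μ (S q i) ≤ ENNReal.ofReal c) :
    μ (⋃ q ∈ T, ⋃ i, S q i) ≤ ENNReal.ofReal (n * (2 * c)) := by
  have h1 : ∀ q ∈ T, μ (⋃ i, S q i) ≤ ENNReal.ofReal (2 * c) := fun q hq => by
    refine (measure_iUnion_le _).trans ?_
    rw [tsum_fintype, Fintype.sum_bool, two_mul, ENNReal.ofReal_add hc hc]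
    exact add_le_add (hS q hq _) (hS q hq _)
  refine (measure_biUnion_finset_le T _).trans ((Finset.sum_le_sum h1).trans ?_)
  rw [Finset.sum_const, nsmul_eq_mul, ENNReal.ofReal_mul ((Nat.cast_nonneg _).trans hT)]
  refine mul_le_mul_left ?_ _
  rw [← ENNReal.ofReal_natCast]
  exact ENNReal.ofReal_le_ofReal hT

/-- Choose `n` with `2⁻ⁿ⁻¹ < r / 3 ≤ 2⁻ⁿ`. Beads of size at least `2⁻ⁿ` sit at no more than `2 * r *
2ⁿ + 1 ≤ 7` places in reach, each with two sheets of area at most `4 * r ^ 2` in the ball: 56 in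
total. For `k > n` there are at most `3 * r * 2ᵏ` places in reach carrying beads of size `2⁻ᵏ`, of
area at most `2 * 4⁻ᵏ` each; the geometric series is below `12 * r ^ 2`. -/
theorem hausdorffMeasure_ball_le (x : BeadedInterval) {r : ℝ} (hr : 0 < r) (hr3 : r ≤ 3) :
    (μH[2] : Measure BeadedInterval) (Metric.ball x r) ≤ ENNReal.ofReal (68 * r ^ 2) := by
  classical
  obtain ⟨n, hn1, hn2⟩ := exists_nat_pow_near_of_lt_one (x := r / 3) (y := 1 / 2)
    (by positivity) (by linarith) (by norm_num) (by norm_num)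
  obtain ⟨⟨p, w, j⟩, rfl⟩ := SeparationQuotient.surjective_mk x
  set x : BeadedInterval := SeparationQuotient.mk ⟨p, w, j⟩
  choose T hT hTmem using fun k => exists_finset_dyadic p k hr
  let S : I → Bool → Set BeadedInterval := fun q i => range fun z => SeparationQuotient.mk ⟨q, z, i⟩
  let T' : ℕ → Finset I := fun k => (T k).filter fun q => dyadicScale q ≤ (1 / 2) ^ k
  have hcover : Metric.ball x r ⊆ spine ∪ ((⋃ q ∈ T n, ⋃ i, S q i ∩ Metric.ball x r) ∪
      ⋃ m, ⋃ q ∈ T' (n + 1 + m), ⋃ i, S q i) := by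
    intro y hy
    obtain ⟨⟨q, z, i⟩, rfl⟩ := SeparationQuotient.surjective_mk y
    have hq : |(q : ℝ) - p| < r := (abs_q_sub_le ⟨q, z, i⟩ ⟨p, w, j⟩).trans_lt hy
    obtain h0 | ⟨k, hk, hd⟩ := dyadicScale_eq_zero_or q
    · exact Or.inl ⟨q, (mk_eq_foot h0 z i).symm⟩
    obtain hkn | hkn := le_or_gt k n
    · exact Or.inr (Or.inl (mem_iUnion₂.2 ⟨q, hTmem n q (hd.mono hkn) hq,
        mem_iUnion.2 ⟨i, ⟨z, rfl⟩, hy⟩⟩))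
    · obtain ⟨m, rfl⟩ := Nat.exists_eq_add_of_le (Nat.succ_le_of_lt hkn)
      exact Or.inr (Or.inr (mem_iUnion.2 ⟨m, mem_iUnion₂.2 ⟨q,
        Finset.mem_filter.2 ⟨hTmem _ q hd hq, hk.le⟩, mem_iUnion.2 ⟨i, z, rfl⟩⟩⟩))
  have hA : (μH[2] : Measure BeadedInterval) (⋃ q ∈ T n, ⋃ i, S q i ∩ Metric.ball x r) ≤
      ENNReal.ofReal (7 * (2 * (4 * r ^ 2))) := by
    refine measure_biUnion_beads_le _ (T n) (fun q i => S q i ∩ Metric.ball x r) (by positivity)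
      ((hT n).trans ?_) fun q _ i => hausdorffMeasure_sheet_inter_ball_le q i x hr
    have : r * 2 ^ n ≤ 3 := by
      have := mul_le_mul_of_nonneg_right hn2 (by positivity : (0 : ℝ) ≤ 2 ^ n)
      rw [← mul_pow] at this
      norm_num at this
      linarith
    linarith
  have hB : ∀ m, (μH[2] : Measure BeadedInterval) (⋃ q ∈ T' (n + 1 + m), ⋃ i, S q i) ≤
      ENNReal.ofReal (6 * r * (1 / 2) ^ (n + 1) * (1 / 2) ^ m) := by
    intro m
    have hp : (0 : ℝ) < 2 ^ (n + 1 + m) := by positivity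
    have hpr : (1 / 2 : ℝ) ^ (n + 1 + m) * 2 ^ (n + 1 + m) = 1 := by
      rw [← mul_pow]; norm_num
    have h1 : 1 ≤ r * 2 ^ (n + 1 + m) := by
      rw [← hpr]
      refine mul_le_mul_of_nonneg_right ?_ hp.le
      calc (1 / 2 : ℝ) ^ (n + 1 + m) ≤ (1 / 2) ^ (n + 1) :=
            pow_le_pow_of_le_one (by norm_num) (by norm_num) (by omega)
        _ ≤ r := by linarith
    refine (measure_biUnion_beads_le _ (T' (n + 1 + m)) S (c := ((1 / 2) ^ (n + 1 + m)) ^ 2)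
      (n := 3 * r * 2 ^ (n + 1 + m)) (by positivity) ?_ fun q hq i => ?_).trans
      (ENNReal.ofReal_le_ofReal (le_of_eq ?_))
    · refine (Nat.cast_le.2 (Finset.card_filter_le _ _)).trans ((hT _).trans ?_)
      linarith
    · refine (hausdorffMeasure_sheet_le_sq q i).trans (ENNReal.ofReal_le_ofReal ?_)
      exact pow_le_pow_left₀ (dyadicScale_nonneg _) (Finset.mem_filter.1 hq).2 2
    · rw [mul_assoc (6 * r), ← pow_add]
      linear_combination (6 * r * (1 / 2 : ℝ) ^ (n + 1 + m)) * hpr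
  have hBsum : ∑' m, (μH[2] : Measure BeadedInterval) (⋃ q ∈ T' (n + 1 + m), ⋃ i, S q i) ≤
      ENNReal.ofReal (12 * r ^ 2) := by
    refine (ENNReal.tsum_le_tsum hB).trans ?_
    rw [← ENNReal.ofReal_tsum_of_nonneg (fun m => by positivity)
      (summable_geometric_two.mul_left _), tsum_mul_left, tsum_geometric_two]
    refine ENNReal.ofReal_le_ofReal ?_
    nlinarith
  calc (μH[2] : Measure BeadedInterval) (Metric.ball x r)
      ≤ (μH[2] : Measure BeadedInterval) spine +
        ((μH[2] : Measure BeadedInterval) (⋃ q ∈ T n, ⋃ i, S q i ∩ Metric.ball x r) +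
        ∑' m, (μH[2] : Measure BeadedInterval) (⋃ q ∈ T' (n + 1 + m), ⋃ i, S q i)) :=
        (measure_mono hcover).trans ((measure_union_le _ _).trans (add_le_add le_rfl
          ((measure_union_le _ _).trans (add_le_add le_rfl (measure_iUnion_le _)))))
    _ ≤ 0 + (ENNReal.ofReal (7 * (2 * (4 * r ^ 2))) + ENNReal.ofReal (12 * r ^ 2)) :=
        add_le_add hausdorffMeasure_spine.le (add_le_add hA hBsum)
    _ = ENNReal.ofReal (68 * r ^ 2) := by
        rw [zero_add, ← ENNReal.ofReal_add (by positivity) (by positivity)]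
        congr 1
        ring

/-- From `a`, the side towards the centre offers at least half of the unit interval, hence length `ρ
/ 2 ≥ m / 2` after scaling. -/
theorem exists_subinterval (a : I) {ρ m : ℝ} (hm : 0 < m) (hρ : m ≤ ρ) :
    ∃ c : ℝ, ∀ y ∈ Ioo c (c + m / 2), ∃ b : I, ρ * b = y ∧ ρ * dist b a < m := by
  have h0 : 0 < ρ := hm.trans_le hρ
  have key : ∀ y : ℝ, 0 ≤ y → y ≤ ρ → |y - ρ * a| < m →
      ∃ b : I, ρ * b = y ∧ ρ * dist b a < m := by
    intro y hy0 hy1 hy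
    have e : ρ * (y / ρ) = y := mul_div_cancel₀ _ h0.ne'
    refine ⟨⟨y / ρ, div_nonneg hy0 h0.le, (div_le_one h0).2 hy1⟩, e, ?_⟩
    rw [Subtype.dist_eq, Real.dist_eq]
    nth_rewrite 1 [← abs_of_pos h0]
    rwa [← abs_mul, mul_sub, e]
  obtain h | h := le_total (a : ℝ) (1 / 2)
  · refine ⟨ρ * a, fun y hy => key y ((mul_nonneg h0.le a.2.1).trans hy.1.le) ?_
      (abs_lt.2 ⟨?_, ?_⟩)⟩
    · nlinarith [hy.2]
    · linarith [hy.1]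
    · linarith [hy.2]
  · refine ⟨ρ * a - m / 2, fun y hy => key y ?_ ?_ (abs_lt.2 ⟨?_, ?_⟩)⟩
    · nlinarith [hy.1]
    · nlinarith [hy.2, a.2.2]
    · linarith [hy.1]
    · linarith [hy.2]

/-- The 1-Lipschitz map `planar` takes the ball to a set that contains a square of side `m / 2`. -/
theorem le_hausdorffMeasure_ball (q : I) (z : I × I) (i : Bool) {m s : ℝ} (hm : 0 < m)
    (hq : m ≤ dyadicScale q) (hs : m ≤ s) :
    ENNReal.ofReal (m / 2) ^ 2 ≤
      (μH[2] : Measure BeadedInterval) (Metric.ball (SeparationQuotient.mk ⟨q, z, i⟩) s) := by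
  obtain ⟨c, hc⟩ := exists_subinterval z.1 hm hq
  obtain ⟨d, hd⟩ := exists_subinterval z.2 hm hq
  have h1 := lipschitzWith_planar.hausdorffMeasure_image_le (d := 2) zero_le_two
    (Metric.ball (SeparationQuotient.mk ⟨q, z, i⟩) s)
  have hsub : Ioo c (c + m / 2) ×ˢ Ioo d (d + m / 2) ⊆
      planar '' Metric.ball (SeparationQuotient.mk ⟨q, z, i⟩) s := by
    rintro ⟨u, v⟩ ⟨hu, hv⟩
    obtain ⟨a, rfl, ha⟩ := hc u hu
    obtain ⟨b, rfl, hb⟩ := hd v hv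
    refine ⟨SeparationQuotient.mk ⟨q, (a, b), i⟩, ?_, rfl⟩
    rw [Metric.mem_ball, SeparationQuotient.dist_mk, dist_mk_mk, Prod.dist_eq,
      mul_max_of_nonneg _ _ (dyadicScale_nonneg _)]
    exact (max_lt ha hb).trans_le hs
  have hvol : volume (Ioo c (c + m / 2) ×ˢ Ioo d (d + m / 2)) = ENNReal.ofReal (m / 2) ^ 2 := by
    rw [Measure.volume_eq_prod, Measure.prod_prod, Real.volume_Ioo, Real.volume_Ioo]
    simp [sq]
  rw [hausdorffMeasure_prod_real, ENNReal.coe_one, ENNReal.one_rpow, one_mul] at h1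
  rw [← hvol]
  exact (measure_mono hsub).trans h1

theorem le_hausdorffMeasure_ball_of_le (x : BeadedInterval) {r : ℝ} (hr : 0 < r) (hr3 : r ≤ 3) :
    ENNReal.ofReal (r / 32) ^ 2 ≤ (μH[2] : Measure BeadedInterval) (Metric.ball x r) := by
  obtain ⟨⟨q, z, i⟩, rfl⟩ := SeparationQuotient.surjective_mk x
  obtain ⟨q', z', hd, hs⟩ : ∃ q' z', dist (PrePoint.mk q' z' i) ⟨q, z, i⟩ ≤ r / 2 ∧
      r / 16 ≤ dyadicScale (q' : I) := by
    by_cases h : r / 16 ≤ dyadicScale q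
    · exact ⟨q, z, by rw [dist_self]; positivity, h⟩
    -- A point of a small bead is within `r / 16` of its foot, and within `2⁻ⁿ⁻¹ < r / 4` of that
    -- foot there is a place of scale at least `2⁻ⁿ⁻¹ ≥ r / 8`.
    · obtain ⟨n, hn1, hn2⟩ := exists_nat_pow_near_of_lt_one (x := r / 4) (y := 1 / 2)
        (by positivity) (by linarith) (by norm_num) (by norm_num)
      obtain ⟨q', hq', hs⟩ := exists_dyadic_near q (k := n + 1)
      rw [pow_succ] at hn1 hq' hs
      refine ⟨q', 0, ?_, by linarith⟩
      rw [dist_comm]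
      refine (dist_le_heights _ _).trans ?_
      have h1 := (PrePoint.mk q z i).height_le
      have h2 : (PrePoint.mk q' 0 i).height = 0 := by simp [PrePoint.height]
      dsimp only at h1 ⊢
      linarith
  have h := le_hausdorffMeasure_ball q' z' i (m := r / 16) (s := r / 2) (by positivity) hs
    (by linarith)
  rw [show r / 16 / 2 = r / 32 by ring] at h
  exact h.trans (measure_mono (Metric.ball_subset_ball' (by
    rw [SeparationQuotient.dist_mk]; linarith)))

theorem ediam_le : Metric.ediam (univ : Set BeadedInterval) ≤ ENNReal.ofReal 3 := by
  refine Metric.ediam_le fun x _ y _ => ?_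
  obtain ⟨x, rfl⟩ := SeparationQuotient.surjective_mk x
  obtain ⟨y, rfl⟩ := SeparationQuotient.surjective_mk y
  rw [edist_mk]
  refine ENNReal.ofReal_le_ofReal ((dist_le_heights x y).trans ?_)
  have h : |(x.q : ℝ) - y.q| ≤ 1 := abs_le.2
    ⟨by linarith [x.q.2.1, y.q.2.2], by linarith [x.q.2.2, y.q.2.1]⟩
  linarith [x.height_le.trans (dyadicScale_le_one _), y.height_le.trans (dyadicScale_le_one _)]

theorem isAhlforsRegular : IsAhlforsRegular 2 (μH[2] : Measure BeadedInterval) := by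
  -- The constant is `32 ^ 2` from the lower bound, and exceeds the 68 of the upper bound.
  refine ⟨1024, by norm_num, fun x r hr hdiam => ?_⟩
  have hr3 : r ≤ 3 := (ENNReal.ofReal_le_ofReal_iff (by norm_num)).1 (hdiam.trans ediam_le)
  have e : ((1024 : ℝ≥0) : ℝ≥0∞) = ENNReal.ofReal 1024 := by simp
  rw [e]
  constructor
  · refine le_trans (le_of_eq ?_) (le_hausdorffMeasure_ball_of_le x hr hr3)
    rw [← ENNReal.ofReal_inv_of_pos (by norm_num), ← ENNReal.ofReal_pow hr.le,
      ← ENNReal.ofReal_pow (by positivity), ← ENNReal.ofReal_mul (by norm_num)]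
    congr 1
    ring
  · refine (hausdorffMeasure_ball_le x hr hr3).trans ?_
    rw [← ENNReal.ofReal_pow hr.le, ← ENNReal.ofReal_mul (by norm_num)]
    exact ENNReal.ofReal_le_ofReal (by nlinarith)

theorem isLocallyFiniteMeasure : IsLocallyFiniteMeasure (μH[2] : Measure BeadedInterval) :=
  ⟨fun x => ⟨Metric.ball x 1, Metric.ball_mem_nhds x one_pos,
    (hausdorffMeasure_ball_le x one_pos (by norm_num)).trans_lt ENNReal.ofReal_lt_top⟩⟩

theorem isTypeA123 : IsTypeA123 2 BeadedInterval where
  two_le := le_rfl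
  rectifiable := isRectifiableSpace
  locallyFinite := by simpa using isLocallyFiniteMeasure
  ahlforsRegular := by simpa using isAhlforsRegular
  bilipschitz := isLocallyBilipschitzEmbeddable

end BeadedInterval

namespace AlexanderSpanier

/-! ### Generalities -/

section General

variable {X Y : Type*}

theorem coboundary_apply (p : ℕ) (φ : Cochain X p) (s : Fin (p + 2) → X) :
    coboundary p φ s = ∑ i : Fin (p + 2), (-1) ^ (i : ℕ) * φ (fun j => s (i.succAbove j)) := rfl

theorem coboundary_one (φ : Cochain X 0) (a b : X) :
    coboundary 0 φ ![a, b] = φ ![b] - φ ![a] := by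
  rw [coboundary_apply, Fin.sum_univ_two]
  have h0 : (fun j => ![a, b] ((0 : Fin 2).succAbove j)) = ![b] := by
    ext j; fin_cases j; rfl
  have h1 : (fun j => ![a, b] ((1 : Fin 2).succAbove j)) = ![a] := by
    ext j; fin_cases j; rfl
  rw [h0, h1]
  simp
  ring

theorem coboundary_two (φ : Cochain X 1) (a b c : X) :
    coboundary 1 φ ![a, b, c] = φ ![b, c] - φ ![a, c] + φ ![a, b] := by
  rw [coboundary_apply, Fin.sum_univ_three]
  have h0 : (fun j => ![a, b, c] ((0 : Fin 3).succAbove j)) = ![b, c] := by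
    ext j; fin_cases j <;> rfl
  have h1 : (fun j => ![a, b, c] ((1 : Fin 3).succAbove j)) = ![a, c] := by
    ext j; fin_cases j <;> rfl
  have h2 : (fun j => ![a, b, c] ((2 : Fin 3).succAbove j)) = ![a, b] := by
    ext j; fin_cases j <;> rfl
  rw [h0, h1, h2]
  simp
  ring

theorem coboundary_three (φ : Cochain X 2) (a b c d : X) :
    coboundary 2 φ ![a, b, c, d] =
      φ ![b, c, d] - φ ![a, c, d] + φ ![a, b, d] - φ ![a, b, c] := by
  rw [coboundary_apply, Fin.sum_univ_four]
  have h0 : (fun j => ![a, b, c, d] ((0 : Fin 4).succAbove j)) = ![b, c, d] := by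
    ext j; fin_cases j <;> rfl
  have h1 : (fun j => ![a, b, c, d] ((1 : Fin 4).succAbove j)) = ![a, c, d] := by
    ext j; fin_cases j <;> rfl
  have h2 : (fun j => ![a, b, c, d] ((2 : Fin 4).succAbove j)) = ![a, b, d] := by
    ext j; fin_cases j <;> rfl
  have h3 : (fun j => ![a, b, c, d] ((3 : Fin 4).succAbove j)) = ![a, b, c] := by
    ext j; fin_cases j <;> rfl
  rw [h0, h1, h2, h3]
  simp
  ring

/-- A coboundary only depends on the cochain along the faces. -/
theorem coboundary_congr {p : ℕ} {φ ψ : Cochain X p} {N : Set X}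
    (h : ∀ s : Fin (p + 1) → X, (∀ i, s i ∈ N) → φ s = ψ s) {s : Fin (p + 2) → X}
    (hs : ∀ i, s i ∈ N) : coboundary p φ s = coboundary p ψ s := by
  rw [coboundary_apply, coboundary_apply]
  exact Finset.sum_congr rfl fun i _ => by rw [h _ fun j => hs _]

/-- The cochain on `Y` that a map `Y → X` induces. -/
def pullback (g : Y → X) {p : ℕ} : Cochain X p →+ Cochain Y p where
  toFun φ s := φ (g ∘ s)
  map_zero' := rfl
  map_add' _ _ := rfl

theorem pullback_coboundary (g : Y → X) {p : ℕ} (φ : Cochain X p) :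
    pullback g (coboundary p φ) = coboundary p (pullback g φ) := rfl

variable [TopologicalSpace X] [TopologicalSpace Y]

theorem support_pullback_subset {g : Y → X} (hg : Continuous g) {p : ℕ} (φ : Cochain X p) :
    support (pullback g φ) ⊆ g ⁻¹' support φ := by
  intro y hy
  by_contra h
  obtain ⟨N, hN, hφ⟩ := notMem_support.1 h
  exact notMem_support.2 ⟨g ⁻¹' N, hg.continuousAt hN, fun s hs => hφ _ hs⟩ hy

theorem support_coboundary_subset {p : ℕ} (φ : Cochain X p) :
    support (coboundary p φ) ⊆ support φ := by
  intro x hx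
  by_contra h
  obtain ⟨N, hN, hφ⟩ := notMem_support.1 h
  refine notMem_support.2 ⟨N, hN, fun s hs => ?_⟩ hx
  rw [coboundary_congr (ψ := 0) hφ hs, map_zero]
  rfl

end General

/-- A Lebesgue number makes local vanishing uniform, as needed for fine grids and small roundings.
-/
theorem exists_pos_forall_eq_zero {Y : Type*} [PseudoMetricSpace Y] {p : ℕ} {φ : Cochain Y p}
    {F : Set Y} (hF : IsCompact F) (h : Disjoint F (support φ)) :
    ∃ ε > 0, ∀ y ∈ F, ∀ s : Fin (p + 1) → Y, (∀ i, dist (s i) y < ε) → φ s = 0 := by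
  obtain ⟨ε, hε, hball⟩ := lebesgue_number_lemma_of_metric (ι := {N : Set Y // IsOpen N ∧
    ∀ s : Fin (p + 1) → Y, (∀ i, s i ∈ N) → φ s = 0}) (c := fun N => N.1) hF (fun N => N.2.1)
    (fun y hy => by
      obtain ⟨N, hN, hφ⟩ := notMem_support.1 (disjoint_left.1 h hy)
      obtain ⟨O, hON, hO, hyO⟩ := mem_nhds_iff.1 hN
      exact mem_iUnion.2 ⟨⟨O, hO, fun s hs => hφ s fun i => hON (hs i)⟩, hyO⟩)
  refine ⟨ε, hε, fun y hy s hs => ?_⟩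
  obtain ⟨N, hN⟩ := hball y hy
  exact N.2.2 s fun i => hN (hs i)

/-! ### Cocycles supported at a point -/

section Point

variable {X : Type*}

/-- The indicator function of the half-line above `u`. -/
noncomputable def step (u t : ℝ) : ℤ := if u < t then 1 else 0

open Classical in
/-- The cup product of the coboundaries of the indicator functions of two half-spaces, cut off
outside `B`. -/
noncomputable def pointCochain (F G : X → ℝ) (u v : ℝ) (B : Set X) : Cochain X 2 := fun s =>
  if ∀ i, s i ∈ B then
    (step u (F (s 1)) - step u (F (s 0))) * (step v (G (s 2)) - step v (G (s 1)))
  else 0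

theorem coboundary_pointCochain_eq_zero (F G : X → ℝ) (u v : ℝ) {B : Set X} {s : Fin 4 → X}
    (hs : ∀ i, s i ∈ B) : coboundary 2 (pointCochain F G u v B) s = 0 := by
  have e : s = ![s 0, s 1, s 2, s 3] := by ext i; fin_cases i <;> rfl
  have h : ∀ a b c : X, a ∈ B → b ∈ B → c ∈ B → pointCochain F G u v B ![a, b, c] =
      (step u (F b) - step u (F a)) * (step v (G c) - step v (G b)) := by
    intro a b c ha hb hc
    rw [pointCochain, if_pos]
    · rfl
    · intro i; fin_cases i <;> assumption
  rw [e, coboundary_three, h _ _ _ (hs 1) (hs 2) (hs 3), h _ _ _ (hs 0) (hs 2) (hs 3),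
    h _ _ _ (hs 0) (hs 1) (hs 3), h _ _ _ (hs 0) (hs 1) (hs 2)]
  ring

variable [TopologicalSpace X]

theorem eventually_step_eq {F : X → ℝ} (hF : Continuous F) {u : ℝ} {x : X} (h : F x ≠ u) :
    ∀ᶠ y in 𝓝 x, step u (F y) = step u (F x) := by
  unfold step
  obtain h | h := h.lt_or_gt
  · filter_upwards [hF.continuousAt.eventually_lt_const h] with y hy
    rw [if_neg hy.not_gt, if_neg h.not_gt]
  · filter_upwards [hF.continuousAt.eventually_const_lt h] with y hy
    rw [if_pos hy, if_pos h]

/-- Where `F x ≠ u` or `G x ≠ v`, one of the indicator functions is locally constant and its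
increment vanishes on small tuples. -/
theorem support_pointCochain_subset {F G : X → ℝ} (hF : Continuous F) (hG : Continuous G)
    {u v : ℝ} {B : Set X} {p : X} (hp : ∀ x ∈ closure B, F x = u → G x = v → x = p) :
    support (pointCochain F G u v B) ⊆ {p} := by
  intro x hx
  by_contra hxp
  by_cases hB : x ∈ closure B
  · by_cases hu : F x = u
    · have hv : G x ≠ v := fun hv => hxp (hp x hB hu hv)
      refine notMem_support.2 ⟨_, eventually_step_eq hG hv, fun s hs => ?_⟩ hx
      have h1 : step v (G (s 1)) = _ := hs 1
      have h2 : step v (G (s 2)) = _ := hs 2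
      simp [pointCochain, h1, h2]
    · refine notMem_support.2 ⟨_, eventually_step_eq hF hu, fun s hs => ?_⟩ hx
      have h0 : step u (F (s 0)) = _ := hs 0
      have h1 : step u (F (s 1)) = _ := hs 1
      simp [pointCochain, h0, h1]
  · refine notMem_support.2 ⟨(closure B)ᶜ, isClosed_closure.isOpen_compl.mem_nhds hB,
      fun s hs => ?_⟩ hx
    rw [pointCochain, if_neg]
    exact fun h => hs 0 (subset_closure (h 0))

/-- The cut-off does no harm: near `p` all vertices lie in `B`, and elsewhere the cochain is locally
zero. -/
theorem pointCochain_mem_cocycles {F G : X → ℝ} (hF : Continuous F) (hG : Continuous G)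
    {u v : ℝ} {B : Set X} {p : X} (hp : ∀ x ∈ closure B, F x = u → G x = v → x = p)
    (hB : B ∈ 𝓝 p) {V : Set X} (hV : p ∈ V) : pointCochain F G u v B ∈ cocycles V 2 := by
  have hsup := support_pointCochain_subset hF hG hp
  refine ⟨⟨?_, hsup.trans (singleton_subset_iff.2 hV)⟩, ?_⟩
  · exact ((finite_singleton p).subset hsup).isCompact
  · refine eq_empty_of_forall_notMem fun x hx => ?_
    obtain rfl : x = p := hsup (support_coboundary_subset _ hx)
    exact notMem_support.2 ⟨B, hB, fun s hs => coboundary_pointCochain_eq_zero F G u v hs⟩ hx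

end Point

/-! ### Summation over grids in the unit square -/

/-- The points of the grid of mesh `1 / N` in the unit square. -/
noncomputable def gridPoint (N i j : ℕ) : I × I :=
  (projIcc 0 1 zero_le_one ((i : ℝ) / N), projIcc 0 1 zero_le_one ((j : ℝ) / N))

/-- The sum of a cochain over the triangles of the grid of mesh `1 / N`. -/
noncomputable def gridSum (N : ℕ) : Cochain (I × I) 2 →+ ℤ where
  toFun φ := ∑ i ∈ Finset.range N, ∑ j ∈ Finset.range N,
    (φ ![gridPoint N i j, gridPoint N (i + 1) j, gridPoint N (i + 1) (j + 1)] -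
      φ ![gridPoint N i j, gridPoint N i (j + 1), gridPoint N (i + 1) (j + 1)])
  map_zero' := by simp
  map_add' φ ψ := by
    rw [← Finset.sum_add_distrib]
    refine Finset.sum_congr rfl fun i _ => ?_
    rw [← Finset.sum_add_distrib]
    refine Finset.sum_congr rfl fun j _ => ?_
    simp only [Pi.add_apply]
    ring

theorem gridSum_apply (N : ℕ) (φ : Cochain (I × I) 2) :
    gridSum N φ = ∑ i ∈ Finset.range N, ∑ j ∈ Finset.range N,
      (φ ![gridPoint N i j, gridPoint N (i + 1) j, gridPoint N (i + 1) (j + 1)] -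
        φ ![gridPoint N i j, gridPoint N i (j + 1), gridPoint N (i + 1) (j + 1)]) := rfl

theorem dist_projIcc_succ_le (N i : ℕ) :
    dist (projIcc (0 : ℝ) 1 zero_le_one (((i + 1 : ℕ) : ℝ) / N))
      (projIcc 0 1 zero_le_one ((i : ℝ) / N)) ≤ 1 / N := by
  refine ((LipschitzWith.projIcc (zero_le_one (α := ℝ))).dist_le_mul _ _).trans (le_of_eq ?_)
  rw [NNReal.coe_one, one_mul, Real.dist_eq, ← sub_div, Nat.cast_add, Nat.cast_one,
    add_sub_cancel_left]
  exact abs_of_nonneg (by positivity)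

theorem dist_gridPoint_le (N i j : ℕ) {a b : ℕ} (ha : a = i ∨ a = i + 1) (hb : b = j ∨ b = j + 1) :
    dist (gridPoint N a b) (gridPoint N i j) ≤ 1 / N := by
  have h : ∀ {i a : ℕ}, (a = i ∨ a = i + 1) →
      dist (projIcc (0 : ℝ) 1 zero_le_one ((a : ℝ) / N))
        (projIcc 0 1 zero_le_one ((i : ℝ) / N)) ≤ 1 / N := by
    rintro i a (rfl | rfl)
    · rw [dist_self]; positivity
    · exact dist_projIcc_succ_le N i
  exact max_le (h ha) (h hb)

theorem eventually_one_div_lt {ε : ℝ} (hε : 0 < ε) : ∀ᶠ N : ℕ in Filter.atTop, 1 / (N : ℝ) < ε :=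
  tendsto_one_div_atTop_nhds_zero_nat.eventually_lt_const hε

theorem eventually_gridSum_eq_zero {φ : Cochain (I × I) 2} (h : support φ = ∅) :
    ∀ᶠ N in Filter.atTop, gridSum N φ = 0 := by
  obtain ⟨ε, hε, hφ⟩ := exists_pos_forall_eq_zero (φ := φ) isCompact_univ (by simp [h])
  filter_upwards [eventually_one_div_lt hε] with N hN
  rw [gridSum_apply]
  refine Finset.sum_eq_zero fun i _ => Finset.sum_eq_zero fun j _ => ?_
  rw [hφ (gridPoint N i j) trivial, hφ (gridPoint N i j) trivial, sub_zero]
  all_goals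
    intro k
    fin_cases k
    all_goals exact (dist_gridPoint_le N i j (by simp) (by simp)).trans_lt hN

theorem gridPoint_zero_left (N j : ℕ) : (gridPoint N 0 j).1 = 0 := by simp [gridPoint]

theorem gridPoint_zero_right (N i : ℕ) : (gridPoint N i 0).2 = 0 := by simp [gridPoint]

theorem gridPoint_top_left {N : ℕ} (hN : N ≠ 0) (j : ℕ) : (gridPoint N N j).1 = 1 := by
  simp [gridPoint, div_self (Nat.cast_ne_zero.2 hN : (N : ℝ) ≠ 0)]

theorem gridPoint_top_right {N : ℕ} (hN : N ≠ 0) (i : ℕ) : (gridPoint N i N).2 = 1 := by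
  simp [gridPoint, div_self (Nat.cast_ne_zero.2 hN : (N : ℝ) ≠ 0)]

/-- The complement of the open square. -/
theorem isClosed_compl_openSquare : IsClosed FatCantor.openSquareᶜ :=
  FatCantor.isOpen_openSquare.isClosed_compl

/-- A discrete Stokes formula: the diagonals cancel, the other edges telescope to the boundary of
the square, and there `ψ` vanishes on short edges. -/
theorem eventually_gridSum_coboundary_eq_zero {ψ : Cochain (I × I) 1}
    (h : support ψ ⊆ FatCantor.openSquare) :
    ∀ᶠ N in Filter.atTop, gridSum N (coboundary 1 ψ) = 0 := by
  obtain ⟨ε, hε, hψ⟩ := exists_pos_forall_eq_zero (φ := ψ) isClosed_compl_openSquare.isCompact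
    (disjoint_compl_left.mono_right h)
  filter_upwards [eventually_one_div_lt hε, Filter.eventually_ne_atTop 0] with N hN hN0
  have hz : ∀ i j a b, (a = i ∨ a = i + 1) → (b = j ∨ b = j + 1) →
      gridPoint N i j ∉ FatCantor.openSquare → ψ ![gridPoint N i j, gridPoint N a b] = 0 := by
    intro i j a b ha hb hmem
    refine hψ (gridPoint N i j) hmem _ fun k => ?_
    fin_cases k
    · exact (dist_self _).trans_lt hε
    · exact (dist_gridPoint_le N i j ha hb).trans_lt hN
  have e : gridSum N (coboundary 1 ψ) =
      ∑ i ∈ Finset.range N, ∑ j ∈ Finset.range N,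
        ((ψ ![gridPoint N (i + 1) j, gridPoint N (i + 1) (j + 1)] -
          ψ ![gridPoint N i j, gridPoint N i (j + 1)]) -
        (ψ ![gridPoint N i (j + 1), gridPoint N (i + 1) (j + 1)] -
          ψ ![gridPoint N i j, gridPoint N (i + 1) j])) := by
    rw [gridSum_apply]
    refine Finset.sum_congr rfl fun i _ => Finset.sum_congr rfl fun j _ => ?_
    rw [coboundary_two, coboundary_two]
    ring
  rw [e]
  simp only [Finset.sum_sub_distrib]
  rw [← Finset.sum_sub_distrib, ← Finset.sum_sub_distrib]
  have h1 : ∑ i ∈ Finset.range N,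
      (∑ j ∈ Finset.range N, ψ ![gridPoint N (i + 1) j, gridPoint N (i + 1) (j + 1)] -
        ∑ j ∈ Finset.range N, ψ ![gridPoint N i j, gridPoint N i (j + 1)]) = 0 := by
    rw [Finset.sum_range_sub
      (fun i => ∑ j ∈ Finset.range N, ψ ![gridPoint N i j, gridPoint N i (j + 1)])]
    rw [Finset.sum_eq_zero fun j _ => hz N j N (j + 1) (by simp) (by simp) fun hm => by
      have := hm.1.2; rw [gridPoint_top_left hN0] at this; exact lt_irrefl _ this]
    rw [Finset.sum_eq_zero fun j _ => hz 0 j 0 (j + 1) (by simp) (by simp) fun hm => by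
      have := hm.1.1; rw [gridPoint_zero_left] at this; exact lt_irrefl _ this]
    simp
  have h2 : ∀ i, ∑ j ∈ Finset.range N, ψ ![gridPoint N i (j + 1), gridPoint N (i + 1) (j + 1)] -
        ∑ j ∈ Finset.range N, ψ ![gridPoint N i j, gridPoint N (i + 1) j] = 0 := by
    intro i
    rw [← Finset.sum_sub_distrib, Finset.sum_range_sub
      (fun j => ψ ![gridPoint N i j, gridPoint N (i + 1) j])]
    rw [hz i N (i + 1) N (by simp) (by simp) fun hm => by
      have := hm.2.2; rw [gridPoint_top_right hN0] at this; exact lt_irrefl _ this]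
    rw [hz i 0 (i + 1) 0 (by simp) (by simp) fun hm => by
      have := hm.2.1; rw [gridPoint_zero_right] at this; exact lt_irrefl _ this]
    simp
  rw [h1, Finset.sum_eq_zero fun i _ => h2 i, sub_zero]

/-- Coboundaries with support in `V` have sum zero over fine grids in a square whose boundary does
not meet `V`. -/
theorem eventually_gridSum_pullback_eq_zero {X : Type*} [TopologicalSpace X] {V : Set X}
    {g : I × I → X} (hg : Continuous g) (hV : g ⁻¹' V ⊆ FatCantor.openSquare) {ω : Cochain X 2}
    (hω : ω ∈ coboundaries V 2) : ∀ᶠ N in Filter.atTop, gridSum N (pullback g ω) = 0 := by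
  obtain ⟨α, hα, _, ⟨ψ, hψ, rfl⟩, rfl⟩ := AddSubgroup.mem_sup.1 hω
  have h1 : support (pullback g α) = ∅ := subset_empty_iff.1
    ((support_pullback_subset hg α).trans (by rw [show support α = ∅ from hα, preimage_empty]))
  have h2 : support (pullback g ψ) ⊆ FatCantor.openSquare :=
    (support_pullback_subset hg ψ).trans ((preimage_mono hψ.2).trans hV)
  filter_upwards [eventually_gridSum_eq_zero h1, eventually_gridSum_coboundary_eq_zero h2]
    with N hN1 hN2
  rw [map_add, map_add, pullback_coboundary, hN1, hN2, add_zero]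

/-- In the second triangle of a cell the first two vertices share their first coordinate, so it
contributes 0. The first triangle gives a product of increments, and the sum factors into two
telescoping sums equal to 1. -/
theorem gridSum_pointCochain {N : ℕ} (hN : N ≠ 0) {u v : ℝ} (hu : u ∈ Ioo (0 : ℝ) 1)
    (hv : v ∈ Ioo (0 : ℝ) 1) :
    gridSum N (pointCochain (fun z => (z.1 : ℝ)) (fun z => (z.2 : ℝ)) u v univ) = 1 := by
  set x : ℕ → ℤ := fun i => step u (projIcc (0 : ℝ) 1 zero_le_one ((i : ℝ) / N) : I)
  set y : ℕ → ℤ := fun j => step v (projIcc (0 : ℝ) 1 zero_le_one ((j : ℝ) / N) : I)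
  have hN' : (N : ℝ) / N = 1 := div_self (Nat.cast_ne_zero.2 hN)
  have e : gridSum N (pointCochain (fun z => (z.1 : ℝ)) (fun z => (z.2 : ℝ)) u v univ) =
      ∑ i ∈ Finset.range N, ∑ j ∈ Finset.range N, (x (i + 1) - x i) * (y (j + 1) - y j) := by
    rw [gridSum_apply]
    refine Finset.sum_congr rfl fun i _ => Finset.sum_congr rfl fun j _ => ?_
    simp only [pointCochain, mem_univ, implies_true, if_true]
    simp [gridPoint, x, y]
  rw [e, ← Finset.sum_mul_sum, Finset.sum_range_sub, Finset.sum_range_sub]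
  simp [x, y, step, hN', hu.2, hv.2, hu.1.not_gt, hv.1.not_gt]

/-- The pullback agrees with the planar model near `z₀`, and both are locally zero elsewhere; fine
grid sums do not see the difference. -/
theorem eventually_gridSum_pullback_pointCochain {X : Type*} [TopologicalSpace X]
    {F G : X → ℝ} (hF : Continuous F) (hG : Continuous G) {g : I × I → X} (hg : Continuous g)
    (hFg : ∀ z, F (g z) = z.1) (hGg : ∀ z, G (g z) = z.2) {z₀ : I × I}
    (hz₀ : z₀ ∈ FatCantor.openSquare) {B : Set X} (hB : B ∈ 𝓝 (g z₀))
    (hp : ∀ x ∈ closure B, F x = z₀.1 → G x = z₀.2 → x = g z₀) :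
    ∀ᶠ N in Filter.atTop, gridSum N (pullback g (pointCochain F G z₀.1 z₀.2 B)) = 1 := by
  set c : Cochain (I × I) 2 :=
    pointCochain (fun z => (z.1 : ℝ)) (fun z => (z.2 : ℝ)) z₀.1 z₀.2 univ
  have hc : support c ⊆ {z₀} := support_pointCochain_subset
    (continuous_subtype_val.comp continuous_fst) (continuous_subtype_val.comp continuous_snd)
    fun z _ h1 h2 => Prod.ext (Subtype.ext h1) (Subtype.ext h2)
  have hsub : support (pullback g (pointCochain F G z₀.1 z₀.2 B)) ⊆ {z₀} := by
    intro z hz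
    have : g z = g z₀ := support_pointCochain_subset hF hG hp (support_pullback_subset hg _ hz)
    refine Prod.ext (Subtype.ext ?_) (Subtype.ext ?_)
    · rw [← hFg, this, hFg]
    · rw [← hGg, this, hGg]
  have hdiff : support (pullback g (pointCochain F G z₀.1 z₀.2 B) - c) = ∅ := by
    refine eq_empty_of_forall_notMem fun z hz => ?_
    have hz' : z = z₀ := by
      rw [sub_eq_add_neg] at hz
      obtain h | h := support_add _ _ hz
      · exact hsub h
      · rw [support_neg] at h; exact hc h
    subst hz'
    refine notMem_support.2 ⟨g ⁻¹' B, hg.continuousAt hB, fun s hs => ?_⟩ hz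
    have : pullback g (pointCochain F G z.1 z.2 B) s = c s := by
      change pointCochain F G z.1 z.2 B (g ∘ s) = _
      rw [pointCochain, if_pos (show ∀ i, (g ∘ s) i ∈ B from hs)]
      simp only [c, pointCochain, mem_univ, implies_true, if_true, Function.comp_apply, hFg, hGg]
    rw [Pi.sub_apply, this, sub_self]
  filter_upwards [eventually_gridSum_eq_zero hdiff, Filter.eventually_ne_atTop 0] with N hN hN0
  have h1 : gridSum N c = 1 := gridSum_pointCochain hN0 ⟨hz₀.1.1, hz₀.1.2⟩ ⟨hz₀.2.1, hz₀.2.2⟩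
  rw [map_sub, h1] at hN
  linarith

end AlexanderSpanier

namespace AlexanderSpanier

/-! ### Cones and the square of the coboundary -/

section Cone

variable {X : Type*}

/-- The cochain `τ ↦ φ (v, τ)`. -/
def cone {p : ℕ} (v : X) : Cochain X (p + 1) →+ Cochain X p where
  toFun φ s := φ (Fin.cons v s)
  map_zero' := rfl
  map_add' _ _ := rfl

theorem cone_apply {p : ℕ} (v : X) (φ : Cochain X (p + 1)) (s : Fin (p + 1) → X) :
    cone v φ s = φ (Fin.cons v s) := rfl

theorem cone_self {p : ℕ} (φ : Cochain X (p + 1)) (s : Fin (p + 2) → X) :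
    cone (s 0) φ (fun j => s j.succ) = φ s := by
  rw [cone_apply]
  congr 1
  exact Fin.cons_self_tail s

/-- Coning is a contracting homotopy of the full cochain complex; it drives the inductions below. -/
theorem cone_coboundary {p : ℕ} (v : X) (φ : Cochain X (p + 1)) :
    cone v (coboundary (p + 1) φ) = φ - coboundary p (cone v φ) := by
  ext s
  rw [cone_apply, coboundary_apply, Fin.sum_univ_succ, Pi.sub_apply, coboundary_apply, sub_eq_add_neg,
    ← Finset.sum_neg_distrib]
  congr 1
  · simp only [Fin.val_zero, pow_zero, one_mul, Fin.zero_succAbove, Fin.cons_succ]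
  · refine Finset.sum_congr rfl fun i _ => ?_
    rw [Fin.val_succ, pow_succ, cone_apply, mul_neg_one, neg_mul]
    congr 3
    ext j
    refine Fin.cases ?_ (fun j => ?_) j
    · simp
    · simp [Fin.succ_succAbove_succ]

theorem cone_coboundary_zero (v : X) (φ : Cochain X 0) :
    cone v (coboundary 0 φ) = φ - fun _ => φ (fun _ => v) := by
  ext s
  have e : (Fin.cons v s : Fin 2 → X) = ![v, s 0] := by ext i; fin_cases i <;> rfl
  have e1 : s = ![s 0] := by ext i; fin_cases i; rfl
  have e2 : (fun _ => v : Fin 1 → X) = ![v] := by ext i; fin_cases i; rfl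
  rw [cone_apply, e, coboundary_one, Pi.sub_apply, ← e1, ← e2]

theorem coboundary_coboundary : ∀ {p : ℕ} (φ : Cochain X p),
    coboundary (p + 1) (coboundary p φ) = 0
  | 0, φ => by
    ext s
    rw [← cone_self (coboundary _ (coboundary _ φ)) s, cone_coboundary, cone_coboundary_zero, map_sub, sub_sub_cancel]
    have e : (fun j : Fin 2 => s j.succ) = ![s 1, s 2] := by ext i; fin_cases i <;> rfl
    rw [e, coboundary_one, sub_self]
    rfl
  | p + 1, φ => by
    ext s
    rw [← cone_self (coboundary _ (coboundary _ φ)) s, cone_coboundary, cone_coboundary, map_sub, coboundary_coboundary (cone _ φ),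
      sub_zero, sub_self]
    rfl

end Cone

/-! ### The homotopy to a projection with small carriers -/

section Homotopy

variable {X : Type*}

/-- The homotopy between the identity and the natural map `Θ`, by recursion over cones. -/
noncomputable def homotopy (Θ : ∀ p, Cochain X p →+ Cochain X p) :
    ∀ p, Cochain X (p + 1) → Cochain X p
  | 0, φ => fun s => (cone (s 0) φ - Θ 0 (cone (s 0) φ)) s
  | p + 1, φ => fun s => (cone (s 0) φ - Θ (p + 1) (cone (s 0) φ) -
      coboundary p (homotopy Θ p (cone (s 0) φ))) s

theorem homotopy_sub (Θ : ∀ p, Cochain X p →+ Cochain X p) :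
    ∀ p (φ ψ : Cochain X (p + 1)), homotopy Θ p (φ - ψ) = homotopy Θ p φ - homotopy Θ p ψ
  | 0, φ, ψ => by
    ext s
    simp only [homotopy, map_sub, Pi.sub_apply]
    ring
  | p + 1, φ, ψ => by
    ext s
    simp only [homotopy, map_sub, Pi.sub_apply, homotopy_sub Θ p]
    ring

/-- The recursion evaluates cochains only on vertices of `s` and, through `Θ`, on tuples that stay
in `M`; hence the homotopy enlarges supports by no more than `Θ` requires. -/
theorem homotopy_eq_zero {Θ : ∀ p, Cochain X p →+ Cochain X p} {M M' : Set X} (hM : M' ⊆ M)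
    (hΘ : ∀ p (φ : Cochain X p), (∀ s : Fin (p + 1) → X, (∀ i, s i ∈ M) → φ s = 0) →
      ∀ s : Fin (p + 1) → X, (∀ i, s i ∈ M') → Θ p φ s = 0) :
    ∀ p (φ : Cochain X (p + 1)), (∀ s : Fin (p + 2) → X, (∀ i, s i ∈ M) → φ s = 0) →
      ∀ s : Fin (p + 1) → X, (∀ i, s i ∈ M') → homotopy Θ p φ s = 0 := by
  have hcone : ∀ p (φ : Cochain X (p + 1)), (∀ s : Fin (p + 2) → X, (∀ i, s i ∈ M) → φ s = 0) →
      ∀ v ∈ M, ∀ s : Fin (p + 1) → X, (∀ i, s i ∈ M) → cone v φ s = 0 := by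
    intro p φ hφ v hv s hs
    exact hφ _ fun i => Fin.cases hv hs i
  intro p
  induction p with
  | zero =>
    intro φ hφ s hs
    have h := hcone 0 φ hφ (s 0) (hM (hs 0))
    simp only [homotopy, Pi.sub_apply]
    rw [h s fun i => hM (hs i), hΘ 0 _ h s hs, sub_zero]
  | succ p ih =>
    intro φ hφ s hs
    have h := hcone (p + 1) φ hφ (s 0) (hM (hs 0))
    simp only [homotopy, Pi.sub_apply]
    rw [h s fun i => hM (hs i), hΘ (p + 1) _ h s hs, coboundary_congr (ψ := 0) (ih _ h) hs,
      map_zero]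
    rfl

/-- The homotopy formula on the tuples in a set on which `Θ` is a cochain map. -/
theorem homotopy_coboundary {Θ : ∀ p, Cochain X p →+ Cochain X p} {N : Set X}
    (hΘ0 : ∀ c : ℤ, Θ 0 (fun _ => c) = fun _ => c)
    (hΘ : ∀ p (φ : Cochain X p) (s : Fin (p + 2) → X), (∀ i, s i ∈ N) →
      Θ (p + 1) (coboundary p φ) s = coboundary p (Θ p φ) s) :
    ∀ p (φ : Cochain X (p + 1)) (s : Fin (p + 2) → X), (∀ i, s i ∈ N) →
      homotopy Θ (p + 1) (coboundary (p + 1) φ) s =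
        φ s - Θ (p + 1) φ s - coboundary p (homotopy Θ p φ) s := by
  have hzero : ∀ (φ : Cochain X 0), homotopy Θ 0 (coboundary 0 φ) = φ - Θ 0 φ := by
    intro φ
    ext s
    simp only [homotopy, cone_coboundary_zero, map_sub, Pi.sub_apply, hΘ0]
    ring
  -- Freeze the first vertex as `v`. Since `cone v` turns `δφ` into `φ - δ(cone v φ)`, the formula
  -- one degree lower, applied to `cone v φ`, cancels every surplus term.
  have hgen : ∀ p (φ : Cochain X (p + 1)) (s : Fin (p + 2) → X), (∀ i, s i ∈ N) →
      (∀ v, coboundary p (homotopy Θ p (coboundary p (cone v φ))) s =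
        coboundary p (cone v φ) s - coboundary p (Θ p (cone v φ)) s) →
      homotopy Θ (p + 1) (coboundary (p + 1) φ) s =
        φ s - Θ (p + 1) φ s - coboundary p (homotopy Θ p φ) s := by
    intro p φ s hs h
    simp only [homotopy, cone_coboundary, map_sub, Pi.sub_apply, homotopy_sub]
    rw [h, hΘ p _ s hs]
    ring
  intro p
  induction p with
  | zero =>
    intro φ s hs
    refine hgen 0 φ s hs fun v => ?_
    rw [hzero, map_sub, Pi.sub_apply]
  | succ p ih =>
    intro φ s hs
    refine hgen (p + 1) φ s hs fun v => ?_
    rw [coboundary_congr (ψ := cone v φ - Θ (p + 1) (cone v φ) -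
      coboundary p (homotopy Θ p (cone v φ))) (N := N) (fun t ht => ih (cone v φ) t ht) hs,
      map_sub, map_sub, coboundary_coboundary, sub_zero, Pi.sub_apply]

end Homotopy

/-! ### Alternation in low degrees -/

section Alternation

variable {T : Type*} [LinearOrder T]

/-- The alternation of a `1`-cochain by the order of the vertices. -/
def alt₁ (φ : Cochain T 1) (a b : T) : ℤ :=
  if a < b then φ ![a, b] else if b < a then -φ ![b, a] else 0

/-- The alternation of a `2`-cochain by the order of the vertices. -/
def alt₂ (φ : Cochain T 2) (a b c : T) : ℤ :=
  if a < b ∧ b < c then φ ![a, b, c]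
  else if a < c ∧ c < b then -φ ![a, c, b]
  else if b < a ∧ a < c then -φ ![b, a, c]
  else if b < c ∧ c < a then φ ![b, c, a]
  else if c < a ∧ a < b then φ ![c, a, b]
  else if c < b ∧ b < a then -φ ![c, b, a]
  else 0

theorem alt₂_swap_left (φ : Cochain T 2) (a b c : T) : alt₂ φ b a c = -alt₂ φ a b c := by
  unfold alt₂
  grind

theorem alt₂_swap_right (φ : Cochain T 2) (a b c : T) : alt₂ φ a c b = -alt₂ φ a b c := by
  unfold alt₂
  grind

theorem alt₂_eq_zero (φ : Cochain T 2) (a c : T) : alt₂ φ a a c = 0 := by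
  have := alt₂_swap_left φ a a c
  omega

theorem alt₂_eq_zero' (φ : Cochain T 2) (a c : T) : alt₂ φ a c c = 0 := by
  have := alt₂_swap_right φ a c c
  omega

theorem alt₁_coboundary (φ : Cochain T 0) (a b : T) :
    alt₁ (coboundary 0 φ) a b = φ ![b] - φ ![a] := by
  simp only [alt₁, coboundary_one]
  grind

theorem alt₂_coboundary (φ : Cochain T 1) (a b c : T) :
    alt₂ (coboundary 1 φ) a b c = alt₁ φ b c - alt₁ φ a c + alt₁ φ a b := by
  simp only [alt₂, alt₁, coboundary_two]
  grind

/-- If two vertices coincide, the two faces that contain both of them vanish, and the two others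
cancel by alternation. -/
theorem alt₂_cocycle (φ : Cochain T 2) {a b c d : T}
    (h : a = b ∨ a = c ∨ a = d ∨ b = c ∨ b = d ∨ c = d) :
    alt₂ φ b c d - alt₂ φ a c d + alt₂ φ a b d - alt₂ φ a b c = 0 := by
  have h1 := alt₂_swap_left φ
  have h2 := alt₂_swap_right φ
  have h3 := alt₂_eq_zero φ
  have h4 := alt₂_eq_zero' φ
  obtain rfl | rfl | rfl | rfl | rfl | rfl := h
  · grind
  · have := h1 a b d; have := h2 a a b; grind
  · have := h2 b a c; have := h1 a b c; have := h2 a a b; have := h2 a a c; grind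
  · grind
  · have := h2 a b c; have := h2 b b c; grind
  · grind

/-- The projection onto alternating cochains of degree at most two. -/
def altern : ∀ p, Cochain T p →+ Cochain T p
  | 0 => AddMonoidHom.id _
  | 1 =>
    { toFun := fun φ s => alt₁ φ (s 0) (s 1)
      map_zero' := by ext s; simp [alt₁]
      map_add' := fun φ ψ => by ext s; simp only [alt₁, Pi.add_apply]; grind }
  | 2 =>
    { toFun := fun φ s => alt₂ φ (s 0) (s 1) (s 2)
      map_zero' := by ext s; simp [alt₂]
      map_add' := fun φ ψ => by ext s; simp only [alt₂, Pi.add_apply]; grind }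
  | _ + 3 => 0

/-- The point is the passage from degree two to three, where `altern` is cut off to zero: four
vertices with only three values repeat one, so `alt₂_cocycle` applies. -/
theorem altern_coboundary {A B C : T} : ∀ p (φ : Cochain T p) (s : Fin (p + 2) → T),
    (∀ i, s i = A ∨ s i = B ∨ s i = C) →
      altern (p + 1) (coboundary p φ) s = coboundary p (altern p φ) s
  | 0, φ, s, _ => by
    have e : s = ![s 0, s 1] := by ext i; fin_cases i <;> rfl
    rw [e, coboundary_one]
    exact alt₁_coboundary φ _ _
  | 1, φ, s, _ => by
    have e : s = ![s 0, s 1, s 2] := by ext i; fin_cases i <;> rfl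
    rw [e, coboundary_two]
    exact alt₂_coboundary φ _ _ _
  | 2, φ, s, hs => by
    have e : s = ![s 0, s 1, s 2, s 3] := by ext i; fin_cases i <;> rfl
    rw [e, coboundary_three]
    refine (alt₂_cocycle φ (a := s 0) (b := s 1) (c := s 2) (d := s 3) ?_).symm
    have h0 := hs 0
    have h1 := hs 1
    have h2 := hs 2
    have h3 := hs 3
    grind
  | p + 3, φ, s, _ => by
    change 0 = coboundary (p + 3) 0 s
    rw [map_zero]
    rfl

theorem altern_eq_zero {M : Set T} : ∀ p (φ : Cochain T p),
    (∀ s : Fin (p + 1) → T, (∀ i, s i ∈ M) → φ s = 0) →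
      ∀ s : Fin (p + 1) → T, (∀ i, s i ∈ M) → altern p φ s = 0
  | 0, _, h, s, hs => h s hs
  | 1, φ, h, s, hs => by
    have H : ∀ a ∈ M, ∀ b ∈ M, φ ![a, b] = 0 := fun a ha b hb => h _ fun i => by
      fin_cases i <;> assumption
    have h0 := hs 0
    have h1 := hs 1
    change alt₁ φ _ _ = 0
    unfold alt₁
    grind
  | 2, φ, h, s, hs => by
    have H : ∀ a ∈ M, ∀ b ∈ M, ∀ c ∈ M, φ ![a, b, c] = 0 := fun a ha b hb c hc => h _ fun i => by
      fin_cases i <;> assumption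
    have h0 := hs 0
    have h1 := hs 1
    have h2 := hs 2
    change alt₂ φ _ _ _ = 0
    unfold alt₂
    grind
  | _ + 3, _, _, _, _ => rfl

end Alternation

open Classical in
/-- Compactly supported cocycles of degree at least three are coboundaries on an open set `W` with
arbitrarily small roundings that take at most three values near each point of `W`. -/
theorem cocycles_le_coboundaries {X : Type*} [MetricSpace X] [CompactSpace X] {W : Set X}
    (hW : IsOpen W) (h : ∀ ε > 0, ∃ R : X → X, (∀ x, dist (R x) x < ε) ∧
      ∀ x ∈ W, ∃ M ∈ 𝓝 x, ∃ A B C, ∀ y ∈ M, R y = A ∨ R y = B ∨ R y = C) (k : ℕ) :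
    cocycles W (k + 3) ≤ coboundaries W (k + 3) := by
  rintro φ ⟨⟨hc, hsub⟩, hz⟩
  have hz' : support (coboundary (k + 3) φ) = ∅ := hz
  -- Here `δ` is a margin around the support inside `W`. Below size `ε₁` the cocycle identity holds,
  -- and below `ε₂` the cochain vanishes off the `δ`-neighbourhood; rounding by half the minimum
  -- keeps tuples in balls of that size.
  obtain ⟨δ, hδ, hδW⟩ := hc.exists_cthickening_subset_open hW hsub
  obtain ⟨ε₁, hε₁, h1⟩ := exists_pos_forall_eq_zero (φ := coboundary (k + 3) φ)
    isCompact_univ (by rw [hz']; exact disjoint_empty _)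
  obtain ⟨ε₂, hε₂, h2⟩ := exists_pos_forall_eq_zero (φ := φ)
    (F := (Metric.thickening δ (support φ))ᶜ) Metric.isOpen_thickening.isClosed_compl.isCompact
    (disjoint_compl_left_iff_subset.2 (Metric.self_subset_thickening hδ _))
  obtain ⟨R, hR, hRW⟩ := h (min ε₁ ε₂ / 2) (by positivity)
  -- Any linear order will do for the alternation.
  let _ : LinearOrder X := linearOrderOfSTO WellOrderingRel
  let Θ : ∀ p, Cochain X p →+ Cochain X p := fun p => (pullback R).comp (altern p)
  have hΘ0 : ∀ c : ℤ, Θ 0 (fun _ => c) = fun _ => c := fun _ => rfl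
  have hvan : ∀ y : X, ∀ p (φ : Cochain X p),
      (∀ s : Fin (p + 1) → X, (∀ i, s i ∈ Metric.ball y (min ε₁ ε₂)) → φ s = 0) →
      ∀ s : Fin (p + 1) → X, (∀ i, s i ∈ Metric.ball y (min ε₁ ε₂ / 2)) → Θ p φ s = 0 := by
    intro y p φ hφ s hs
    refine altern_eq_zero p φ hφ (R ∘ s) fun i => ?_
    have := hR (s i)
    have := Metric.mem_ball.1 (hs i)
    have := dist_triangle (R (s i)) (s i) y
    rw [Metric.mem_ball, Function.comp_apply]
    linarith
  have hball : ∀ y : X, Metric.ball y (min ε₁ ε₂ / 2) ⊆ Metric.ball y (min ε₁ ε₂) := fun y =>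
    Metric.ball_subset_ball (half_le_self (by positivity))
  have hpos : 0 < min ε₁ ε₂ / 2 := by positivity
  have hψ : support (homotopy Θ (k + 2) φ) ⊆ Metric.thickening δ (support φ) := by
    intro y hy
    by_contra hyn
    refine notMem_support.2 ⟨Metric.ball y (min ε₁ ε₂ / 2), Metric.ball_mem_nhds y hpos,
      homotopy_eq_zero (hball y) (hvan y) (k + 2) φ fun s hs => ?_⟩ hy
    exact h2 y hyn s fun i => (Metric.mem_ball.1 (hs i)).trans_le (min_le_right _ _)
  have hψW : support (homotopy Θ (k + 2) φ) ⊆ W :=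
    hψ.trans ((Metric.thickening_subset_cthickening _ _).trans hδW)
  have hlz : φ - coboundary (k + 2) (homotopy Θ (k + 2) φ) ∈ locallyZero X (k + 3) := by
    refine eq_empty_of_forall_notMem fun y => notMem_support.2 ?_
    by_cases hy : y ∈ W
    · obtain ⟨M, hM, A, B, C, hABC⟩ := hRW y hy
      refine ⟨M ∩ Metric.ball y (min ε₁ ε₂ / 2),
        Filter.inter_mem hM (Metric.ball_mem_nhds y hpos), fun s hs => ?_⟩
      have e := homotopy_coboundary (N := M) hΘ0 (fun p φ s hs =>
        altern_coboundary p φ (R ∘ s) fun i => hABC _ (hs i)) (k + 2) φ s fun i => (hs i).1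
      rw [homotopy_eq_zero (hball y) (hvan y) (k + 3) _ (fun t ht => h1 y (mem_univ y) t fun i =>
        (Metric.mem_ball.1 (ht i)).trans_le (min_le_left _ _)) s fun i => (hs i).2] at e
      -- As `Θ` is zero in degree at least three, the homotopy formula exhibits `φ` as a coboundary
      -- near `y`.
      have e0 : Θ (k + 2 + 1) φ s = 0 := rfl
      rw [e0, sub_zero] at e
      exact e.symm
    · refine notMem_support.1 fun h => hy ?_
      rw [sub_eq_add_neg] at h
      obtain h | h := support_add _ _ h
      · exact hsub h
      · rw [support_neg] at h
        exact hψW (support_coboundary_subset _ h)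
  rw [← sub_add_cancel φ (coboundary (k + 2) (homotopy Θ (k + 2) φ))]
  exact AddSubgroup.add_mem_sup hlz
    ⟨_, ⟨(isClosed_support _).isCompact, hψW⟩, rfl⟩

end AlexanderSpanier

/-! ### Brick tilings of the plane -/

/-- The tile of the brick tiling with bricks of side `1 / N` that contains a point. -/
noncomputable def brick (N : ℝ) (z : ℝ × ℝ) : ℤ × ℤ :=
  (⌊N * z.1 + ⌊N * z.2⌋ / 2⌋, ⌊N * z.2⌋)

theorem dist_le_of_brick_eq {N : ℝ} (hN : 0 < N) {z w : ℝ × ℝ} (h : brick N z = brick N w) :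
    dist z w ≤ 1 / N := by
  obtain ⟨h1, h2⟩ := Prod.ext_iff.1 h
  simp only [brick] at h1 h2
  have h3 := Int.abs_sub_lt_one_of_floor_eq_floor h1
  have h4 := Int.abs_sub_lt_one_of_floor_eq_floor h2
  rw [h2, add_sub_add_right_eq_sub, ← mul_sub, abs_mul, abs_of_pos hN] at h3
  rw [← mul_sub, abs_mul, abs_of_pos hN] at h4
  refine max_le ?_ ?_
  · rw [Real.dist_eq, le_div_iff₀' hN]
    exact h3.le
  · rw [Real.dist_eq, le_div_iff₀' hN]
    exact h4.le

theorem eventually_floor_eq_or {X : Type*} [TopologicalSpace X] {g : X → ℝ} (hg : Continuous g)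
    (x : X) : ∀ᶠ y in 𝓝 x, ⌊g y⌋ = ⌊g x⌋ ∨ (g x = ⌊g x⌋ ∧ ⌊g y⌋ = ⌊g x⌋ - 1) := by
  have h1 : ∀ᶠ y in 𝓝 x, g y < ⌊g x⌋ + 1 :=
    hg.continuousAt.eventually_lt_const (Int.lt_floor_add_one _)
  obtain h | h := (Int.floor_le (g x)).eq_or_lt
  · have h2 : ∀ᶠ y in 𝓝 x, (⌊g x⌋ : ℝ) - 1 < g y :=
      hg.continuousAt.eventually_const_lt (by linarith)
    filter_upwards [h1, h2] with y h1 h2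
    obtain h3 | h3 := lt_or_ge (g y) ⌊g x⌋
    · exact Or.inr ⟨h.symm, Int.floor_eq_iff.2 ⟨by push_cast; exact h2.le, by push_cast; linarith⟩⟩
    · exact Or.inl (Int.floor_eq_iff.2 ⟨h3, h1⟩)
  · filter_upwards [h1, hg.continuousAt.eventually_const_lt h] with y h1 h2
    exact Or.inl (Int.floor_eq_iff.2 ⟨h2.le, h1⟩)

/-- At most three bricks meet near a point. -/
theorem exists_eventually_brick (N : ℝ) (z : ℝ × ℝ) : ∃ A B C, ∀ᶠ w in 𝓝 z,
    brick N w = A ∨ brick N w = B ∨ brick N w = C := by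
  have h2 := eventually_floor_eq_or (g := fun w : ℝ × ℝ => N * w.2) (by fun_prop) z
  have ha := eventually_floor_eq_or
    (g := fun w : ℝ × ℝ => N * w.1 + (⌊N * z.2⌋ : ℝ) / 2) (by fun_prop) z
  have hb := eventually_floor_eq_or
    (g := fun w : ℝ × ℝ => N * w.1 + ((⌊N * z.2⌋ - 1 : ℤ) : ℝ) / 2) (by fun_prop) z
  set j := ⌊N * z.2⌋
  set a := ⌊N * z.1 + (j : ℝ) / 2⌋
  set b := ⌊N * z.1 + ((j - 1 : ℤ) : ℝ) / 2⌋
  -- Consecutive rows are shifted by half a brick. If `z` is on a vertical edge of its own row, it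
  -- is on none of the row below, so two bricks and one meet; otherwise one and at most two.
  by_cases hint : N * z.1 + (j : ℝ) / 2 = a
  · refine ⟨(a, j), (a - 1, j), (b, j - 1), ?_⟩
    filter_upwards [h2, ha, hb] with w h2 ha hb
    obtain h2 | ⟨-, h2⟩ := h2
    · rw [brick, h2]
      obtain h | ⟨-, h⟩ := ha <;> simp [h]
    · rw [brick, h2]
      obtain h | ⟨h, -⟩ := hb
      · rw [h]; simp
      · exfalso
        push_cast at h
        have h' : ((2 * a : ℤ) : ℝ) = ((2 * b + 1 : ℤ) : ℝ) := by push_cast; linarith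
        have := Int.cast_injective h'
        omega
  · refine ⟨(a, j), (b, j - 1), (b - 1, j - 1), ?_⟩
    filter_upwards [h2, ha, hb] with w h2 ha hb
    obtain h2 | ⟨-, h2⟩ := h2
    · rw [brick, h2]
      obtain h | ⟨h, -⟩ := ha
      · simp [h]
      · exact absurd h hint
    · rw [brick, h2]
      obtain h | ⟨-, h⟩ := hb <;> rw [h] <;> simp

/-! ### Vanishing criteria and relations between cohomology classes -/

namespace AlexanderSpanier

theorem cocycles_le_coboundaries_of_isometric {X : Type*} [MetricSpace X] [CompactSpace X]
    {W : Set X} (hW : IsOpen W) {u : X → ℝ × ℝ} (hu : Continuous u)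
    (hd : ∀ x ∈ W, ∀ y ∈ W, dist (u x) (u y) = dist x y) (k : ℕ) :
    cocycles W (k + 3) ≤ coboundaries W (k + 3) := by
  classical
  refine cocycles_le_coboundaries hW (fun ε hε => ?_) k
  obtain hX | hX := isEmpty_or_nonempty X
  · exact ⟨id, fun x => (hX.false x).elim, fun x => (hX.false x).elim⟩
  -- Rounding moves a point of `W` to a chosen point of `W` in the same brick. It need not be
  -- continuous, as cochains pull back along arbitrary maps.
  set g := Function.invFunOn (fun x => brick (2 / ε) (u x)) W
  refine ⟨fun x => if x ∈ W then g (brick (2 / ε) (u x)) else x, fun x => ?_, fun x hx => ?_⟩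
  · dsimp only
    split_ifs with hx
    · have h1 : g (brick (2 / ε) (u x)) ∈ W := Function.invFunOn_mem ⟨x, hx, rfl⟩
      have h2 : brick (2 / ε) (u (g (brick (2 / ε) (u x)))) = brick (2 / ε) (u x) :=
        Function.invFunOn_eq (f := fun x => brick (2 / ε) (u x)) ⟨x, hx, rfl⟩
      rw [← hd _ h1 _ hx]
      refine (dist_le_of_brick_eq (by positivity) h2).trans_lt ?_
      rw [one_div_div]
      exact half_lt_self hε
    · rwa [dist_self]
  · obtain ⟨A, B, C, h⟩ := exists_eventually_brick (2 / ε) (u x)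
    refine ⟨W ∩ u ⁻¹' _, Filter.inter_mem (hW.mem_nhds hx) (hu.continuousAt h), g A, g B, g C, ?_⟩
    rintro y ⟨hyW, hy⟩
    simp only [if_pos hyW]
    exact hy.imp (congrArg g) (Or.imp (congrArg g) (congrArg g))

/-- A cocycle of degree 0 is a locally constant function, hence constant, and it vanishes at a point
outside `V`. -/
theorem cocycles_zero_le {X : Type*} [TopologicalSpace X] [PreconnectedSpace X] {V : Set X}
    (hV : V ≠ univ) : cocycles V 0 ≤ coboundaries V 0 := by
  rintro φ ⟨⟨-, hsub⟩, hz⟩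
  have hz' : support (coboundary 0 φ) = ∅ := hz
  obtain ⟨y, hy⟩ := (ne_univ_iff_exists_notMem V).1 hV
  obtain ⟨N, hN, hφ⟩ := notMem_support.1 fun h => hy (hsub h)
  have hconst : IsLocallyConstant fun x => φ ![x] := by
    refine (IsLocallyConstant.iff_eventually_eq _).2 fun x => ?_
    obtain ⟨M, hM, h⟩ := notMem_support.1 (hz'.symm ▸ notMem_empty x)
    filter_upwards [hM] with w hw
    have := h ![x, w] fun i => by
      fin_cases i
      exacts [mem_of_mem_nhds hM, hw]
    rwa [coboundary_one, sub_eq_zero] at this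
  have hzero : φ = 0 := by
    ext s
    have e : s = ![s 0] := by ext i; fin_cases i; rfl
    rw [e]
    refine (hconst.apply_eq_of_preconnectedSpace (s 0) y).trans (hφ _ fun i => ?_)
    fin_cases i
    exact mem_of_mem_nhds hN
  rw [hzero]
  exact zero_mem _

section Cohomology

variable {X : Type*} [TopologicalSpace X] {V W : Set X} {p : ℕ}

theorem mk_eq_zero_iff (c : cocycles V p) :
    (QuotientAddGroup.mk c : Cohomology V p) = 0 ↔ (c : Cochain X p) ∈ coboundaries V p := by
  rw [QuotientAddGroup.eq_zero_iff, AddSubgroup.mem_addSubgroupOf]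

theorem subsingleton_cohomology (h : cocycles V p ≤ coboundaries V p) :
    Subsingleton (Cohomology V p) := by
  refine subsingleton_of_forall_eq 0 fun x => ?_
  obtain ⟨c, rfl⟩ := QuotientAddGroup.mk_surjective x
  exact (mk_eq_zero_iff c).2 (h c.2)

theorem mem_coboundaries_of_subsingleton [Subsingleton (Cohomology V p)] {c : Cochain X p}
    (hc : c ∈ cocycles V p) : c ∈ coboundaries V p :=
  (mk_eq_zero_iff ⟨c, hc⟩).1 (Subsingleton.elim _ _)

theorem not_nonempty_addEquiv_int [Subsingleton (Cohomology V p)] :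
    ¬ Nonempty (Cohomology V p ≃+ ℤ) := fun ⟨e⟩ => by
  have := e.symm.injective (Subsingleton.elim (e.symm 0) (e.symm 1))
  exact zero_ne_one this

/-- If `H_c^p(V) ≅ ℤ`, then any two classes are linearly dependent. -/
theorem exists_zsmul_add_zsmul_mem (e : Cohomology V p ≃+ ℤ) {a b : Cochain X p}
    (ha : a ∈ cocycles V p) (hb : b ∈ cocycles V p) (hb' : b ∉ coboundaries V p) :
    ∃ m n : ℤ, m ≠ 0 ∧ m • a + n • b ∈ coboundaries V p := by
  set α : Cohomology V p := QuotientAddGroup.mk ⟨a, ha⟩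
  set β : Cohomology V p := QuotientAddGroup.mk ⟨b, hb⟩
  -- The relation is `e β * e α - e α * e β = 0` in `ℤ`.
  refine ⟨e β, -e α, fun h => hb' ?_, ?_⟩
  · exact (mk_eq_zero_iff ⟨b, hb⟩).1 (e.map_eq_zero_iff.1 h)
  · have h : (QuotientAddGroup.mk (e β • ⟨a, ha⟩ + (-e α) • ⟨b, hb⟩ : cocycles V p) :
        Cohomology V p) = e β • α + (-e α) • β := rfl
    refine (mk_eq_zero_iff (e β • ⟨a, ha⟩ + (-e α) • ⟨b, hb⟩)).1 (h.trans ?_)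
    apply e.injective
    rw [map_add, map_zsmul, map_zsmul, map_zero, smul_eq_mul, smul_eq_mul]
    ring

end Cohomology

end AlexanderSpanier

namespace BeadedInterval

open FatCantor AlexanderSpanier

instance : CompactSpace BeadedInterval :=
  ⟨by
    rw [← SeparationQuotient.range_mk (X := PrePoint)]
    exact isCompact_range SeparationQuotient.continuous_mk⟩

/-! ### Cohomology of the beaded interval -/

/-- A sheet of the bead at `1`. -/
noncomputable def lastSheet (i : Bool) (z : I × I) : BeadedInterval :=
  SeparationQuotient.mk ⟨1, z, i⟩

theorem isometry_lastSheet (i : Bool) : Isometry (lastSheet i) := isometry_mk_one i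

theorem planar_lastSheet (i : Bool) (z : I × I) : planar (lastSheet i z) = (↑z.1, ↑z.2) := by
  rw [lastSheet, planar_mk, Icc.coe_one, dyadicScale_one, one_mul, one_mul]

theorem lastSheet_ne {i j : Bool} (hij : i ≠ j) {z : I × I} (hz : z ∉ cantorSquare) (w : I × I) :
    lastSheet i z ≠ lastSheet j w := by
  intro h
  have h1 : (0 : ℝ) < dyadicScale (1 : I) := by rw [Icc.coe_one, dyadicScale_one]; exact one_pos
  obtain rfl : z = w := (mk_eq_mk_iff h1 h).2
  have hd : dist (PrePoint.mk 1 z i) ⟨1, z, j⟩ = 0 := by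
    rw [← SeparationQuotient.dist_mk]
    exact dist_eq_zero.2 h
  rw [dist_of_eq (x := ⟨1, z, i⟩) (y := ⟨1, z, j⟩) rfl, sheetDist, if_neg hij] at hd
  have h2 := infDist_le_throughDist (seam_nonempty (1 : I)) z z
  rw [(mul_eq_zero.1 hd).resolve_left h1.ne', seam_of_ne one_ne_zero] at h2
  linarith [infDist_cantorSquare_pos hz]

theorem exists_eq_lastSheet {i : Bool} {z : I × I} {y : BeadedInterval}
    (h : dist y (lastSheet i z) < Metric.infDist z cantorSquare) : ∃ w, y = lastSheet i w := by
  refine exists_eq_mk_of_dist_lt (q := 1) (z := z) ?_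
  rw [Icc.coe_one, dyadicScale_one, one_mul, dist_comm]
  exact h

theorem continuous_planar : Continuous planar := lipschitzWith_planar.continuous

/-- The points over the interior of the square. -/
def openPart : Set BeadedInterval := planar ⁻¹' (Ioo 0 1 ×ˢ Ioo 0 1)

theorem isOpen_openPart : IsOpen openPart :=
  (isOpen_Ioo.prod isOpen_Ioo).preimage continuous_planar

theorem lastSheet_mem_openPart {i : Bool} {z : I × I} :
    lastSheet i z ∈ openPart ↔ z ∈ openSquare := by
  rw [openPart, mem_preimage, planar_lastSheet]
  rfl

/-- The class of a point of the last bead off the Cantor set. -/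
theorem exists_pointCocycle {z : I × I} (hz : z ∈ openSquare) (hzC : z ∉ cantorSquare) (i : Bool) :
    ∃ φ : Cochain BeadedInterval 2, (∀ V, lastSheet i z ∈ V → φ ∈ cocycles V 2) ∧
      (∀ᶠ N in Filter.atTop, gridSum N (pullback (lastSheet i) φ) = 1) ∧
      ∀ j, i ≠ j → ∀ᶠ N in Filter.atTop, gridSum N (pullback (lastSheet j) φ) = 0 := by
  have hr := infDist_cantorSquare_pos hzC
  set r := Metric.infDist z cantorSquare
  -- Half the distance to the Cantor set, so that the closure of `B` stays in one sheet, where the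
  -- planar coordinates are injective.
  set B := Metric.ball (lastSheet i z) (r / 2)
  have hF : Continuous fun x => (planar x).1 := continuous_fst.comp continuous_planar
  have hG : Continuous fun x => (planar x).2 := continuous_snd.comp continuous_planar
  have hp : ∀ x ∈ closure B, (planar x).1 = z.1 → (planar x).2 = z.2 → x = lastSheet i z := by
    intro x hx h1 h2
    have hx' := Metric.mem_closedBall.1 (Metric.closure_ball_subset_closedBall hx)
    obtain ⟨w, rfl⟩ := exists_eq_lastSheet (hx'.trans_lt (half_lt_self hr))
    rw [planar_lastSheet] at h1 h2
    rw [show w = z from Prod.ext (Subtype.ext h1) (Subtype.ext h2)]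
  have hB : B ∈ 𝓝 (lastSheet i z) := Metric.ball_mem_nhds _ (half_pos hr)
  refine ⟨pointCochain (fun x => (planar x).1) (fun x => (planar x).2) z.1 z.2 B,
    fun V hV => pointCochain_mem_cocycles hF hG hp hB hV,
    eventually_gridSum_pullback_pointCochain hF hG (isometry_lastSheet i).continuous
      (fun w => by rw [planar_lastSheet]) (fun w => by rw [planar_lastSheet]) hz hB hp,
    fun j hij => eventually_gridSum_eq_zero ?_⟩
  refine subset_empty_iff.1 fun w hw => ?_
  have h := support_pointCochain_subset hF hG hp
    (support_pullback_subset (isometry_lastSheet j).continuous _ hw)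
  exact lastSheet_ne hij hzC w (mem_singleton_iff.1 h).symm

theorem gridSum_eq_zero_of_mem_coboundaries {V : Set BeadedInterval} (hV : V ⊆ openPart)
    {ω : Cochain BeadedInterval 2} (hω : ω ∈ coboundaries V 2) (i : Bool) :
    ∀ᶠ N in Filter.atTop, gridSum N (pullback (lastSheet i) ω) = 0 :=
  eventually_gridSum_pullback_eq_zero (isometry_lastSheet i).continuous
    (fun _ hz => lastSheet_mem_openPart.1 (hV hz)) hω

theorem not_subsingleton_cohomology_openPart : ¬ Subsingleton (Cohomology openPart 2) := by
  intro h
  obtain ⟨z, hz, hzC, -⟩ := exists_notMem_cantorSquare_near 0 one_pos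
  obtain ⟨φ, hφ, h1, -⟩ := exists_pointCocycle hz hzC false
  have hb := mem_coboundaries_of_subsingleton (hφ _ (lastSheet_mem_openPart.2 hz))
  obtain ⟨N, h0, h1⟩ := ((gridSum_eq_zero_of_mem_coboundaries subset_rfl hb false).and h1).exists
  exact zero_ne_one (h0.symm.trans h1)

/-- Each neighbourhood of a Cantor point contains points of both sheets off the Cantor set.
Summation over the sheets separately shows that their classes are linearly independent. -/
theorem not_nonempty_cohomology_two_addEquiv {z : I × I} (hzC : z ∈ cantorSquare)
    {V : Set BeadedInterval} (hV : IsOpen V) (hVo : V ⊆ openPart) (hzV : lastSheet false z ∈ V) :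
    ¬ Nonempty (Cohomology V 2 ≃+ ℤ) := by
  rintro ⟨e⟩
  have hseam : lastSheet true z = lastSheet false z :=
    mk_eq_mk_of_dist (dist_seam (by rwa [seam_of_ne one_ne_zero]) _ _)
  obtain ⟨ε, hε, hball⟩ := Metric.isOpen_iff.1 hV _ hzV
  obtain ⟨w, hw, hwC, hd⟩ := exists_notMem_cantorSquare_near z hε
  have hwV : ∀ i, lastSheet i w ∈ V := by
    intro i
    refine hball ?_
    have : lastSheet i z = lastSheet false z := by
      cases i
      exacts [rfl, hseam]
    rw [Metric.mem_ball, ← this, (isometry_lastSheet i).dist_eq, dist_comm]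
    exact hd
  obtain ⟨a, ha, ha1, -⟩ := exists_pointCocycle hw hwC false
  obtain ⟨b, hb, hb1, hb0⟩ := exists_pointCocycle hw hwC true
  have hb' : b ∉ coboundaries V 2 := by
    intro h
    obtain ⟨N, h0, h1⟩ := ((gridSum_eq_zero_of_mem_coboundaries hVo h true).and hb1).exists
    exact zero_ne_one (h0.symm.trans h1)
  obtain ⟨m, n, hm, hmn⟩ := exists_zsmul_add_zsmul_mem e (ha V (hwV _)) (hb V (hwV _)) hb'
  obtain ⟨N, h, h1, h0⟩ := ((gridSum_eq_zero_of_mem_coboundaries hVo hmn false).and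
    (ha1.and (hb0 false (by simp)))).exists
  -- Over the sheet `false`, `a` sums to 1 and `b` to 0, so the relation leaves `m = 0`.
  rw [map_add, map_add, map_zsmul, map_zsmul, map_zsmul, map_zsmul, h1, h0] at h
  exact hm (by simpa using h)

/-- Cohomology classes of degree at least three vanish after shrinking to a small disc. -/
theorem exists_cocycles_le_coboundaries {z : I × I} (hzC : z ∉ cantorSquare)
    {V : Set BeadedInterval} (hV : IsOpen V) (hzV : lastSheet false z ∈ V) :
    ∃ W ⊆ V, IsOpen W ∧ lastSheet false z ∈ W ∧
      ∀ k, cocycles W (k + 3) ≤ coboundaries W (k + 3) := by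
  have hr := infDist_cantorSquare_pos hzC
  refine ⟨V ∩ Metric.ball (lastSheet false z) (Metric.infDist z cantorSquare), inter_subset_left,
    hV.inter Metric.isOpen_ball, ⟨hzV, Metric.mem_ball_self hr⟩, fun k =>
    cocycles_le_coboundaries_of_isometric (hV.inter Metric.isOpen_ball) continuous_planar ?_ k⟩
  rintro x ⟨-, hx⟩ y ⟨-, hy⟩
  obtain ⟨x, rfl⟩ := exists_eq_lastSheet hx
  obtain ⟨y, rfl⟩ := exists_eq_lastSheet hy
  rw [planar_lastSheet, planar_lastSheet, (isometry_lastSheet false).dist_eq]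
  rfl

theorem not_isGeneralizedManifold (n : ℕ) : ¬ IsGeneralizedManifold n BeadedInterval := by
  intro h
  obtain ⟨c, hcC, hco⟩ := exists_mem_cantorSquare_mem_openSquare
  obtain ⟨z, hz, hzC, -⟩ := exists_notMem_cantorSquare_near 0 one_pos
  match n, h with
  | 0, h =>
    -- A second point is removed so that `V` is a proper subset.
    obtain ⟨V, -, -, hVU, hiso, -⟩ := h.localCohomology (lastSheet true z) {lastSheet false z}ᶜ
      isOpen_compl_singleton (lastSheet_ne (by simp) hzC z)
    have := subsingleton_cohomology
      (cocycles_zero_le (V := V) fun h => hVU (h ▸ mem_univ (lastSheet false z)) rfl)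
    exact not_nonempty_addEquiv_int hiso
  | 1, h =>
    exact not_subsingleton_cohomology_openPart
      (h.cohomologicalDimension_le 2 one_lt_two _ isOpen_openPart)
  | 2, h =>
    obtain ⟨V, hV, hcV, hVU, hiso, -⟩ := h.localCohomology (lastSheet false c) openPart
      isOpen_openPart (lastSheet_mem_openPart.2 hco)
    exact not_nonempty_cohomology_two_addEquiv hcC hV hVU hcV hiso
  | k + 3, h =>
    obtain ⟨V, hV, hzV, -, hiso, -, hsurj⟩ := h.localCohomology (lastSheet false z) univ
      isOpen_univ trivial
    -- The top cohomology of the small disc `W` is zero and maps onto that of `V`, which cannot then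
    -- be `ℤ`.
    obtain ⟨W, hWV, hW, hzW, hc⟩ := exists_cocycles_le_coboundaries hzC hV hzV
    have := subsingleton_cohomology (hc k)
    have := (hsurj W hWV hW hzW).subsingleton
    exact not_nonempty_addEquiv_int hiso

end BeadedInterval

theorem mainTheorem4 :
    ∃ (X : Type) (_ : MetricSpace X) (_ : MeasurableSpace X) (_ : BorelSpace X) (f : X → X),
      CompactSpace X ∧ CompleteSpace X ∧ IsPathMetricSpace X ∧
      IsAhlforsRegular 2 (μH[2] : Measure X) ∧
      IsBLD 2 f ∧
      0 < (μH[2] : Measure X) (branchSet f) ∧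
      (∃ e : (ℕ → Bool) → X, IsEmbedding e ∧ range e ⊆ branchSet f ∧
        0 < (μH[2] : Measure X) (range e)) ∧
      IsTypeA123 2 X ∧
      (∃ U : Set X, IsOpen U ∧ Dense U ∧
        Nonempty (ChartedSpace (EuclideanSpace ℝ (Fin 2)) U)) ∧
      (∃ x : X, IsLocalCutPoint x) ∧
      ∀ n : ℕ, ¬ IsGeneralizedManifold n X := by
  have hsub : range BeadedInterval.branchParam ⊆ branchSet BeadedInterval.tentMap :=
    range_subset_iff.2 BeadedInterval.branchParam_mem_branchSet
  exact ⟨BeadedInterval, inferInstance, inferInstance, inferInstance, BeadedInterval.tentMap,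
    inferInstance, inferInstance, BeadedInterval.isPathMetricSpace, BeadedInterval.isAhlforsRegular,
    BeadedInterval.isBLD_tentMap,
    BeadedInterval.hausdorffMeasure_range_branchParam_pos.trans_le (measure_mono hsub),
    ⟨_, BeadedInterval.isEmbedding_branchParam, hsub,
      BeadedInterval.hausdorffMeasure_range_branchParam_pos⟩,
    BeadedInterval.isTypeA123,
    ⟨_, BeadedInterval.isOpen_manifoldPart, BeadedInterval.dense_manifoldPart,
      BeadedInterval.nonempty_chartedSpace_manifoldPart⟩,
    ⟨_, BeadedInterval.isLocalCutPoint_zero⟩, BeadedInterval.not_isGeneralizedManifold⟩
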